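/- **Setting.** Let $N\ge 3$. Let $V\in C(\mathbb R^N,\mathbb R)$ with $\inf_{\mathbb R^N}V>0$ and $\sup_{\mathbb R^N} V<\infty$, and let $\Omega\subset\mathbb R^N$ be a bounded domain with $m_0:=\inf_\Omega V<\inf_{\partial\Omega}V$. Let $f\in C(\mathbb R,\mathbb R)$ with $f(\xi)=0$ for $\xi\le 0$, $\lim_{\xi\to0}f(\xi)/\xi=0$, $\lim_{\xi\to\infty}f(\xi)/\xi^p=0$ for some $p\in(1,\frac{N+2}{N-2})$, and $F(\xi_0)>\frac12m_0\xi_0^2$ for some $\xi_0>0$, where $F(\xi)=\int_0^\xi f$. Put $$K=\{x\in\Omega:V(x)=m_0\},\qquad \Omega(I)=\{y\in\Omega: V(y)-m_0\in I\},\qquad \|u\|_{H^1(A)}^2=\int_A(|\nabla u|^2+u^2)\,dx,$$ with $\|u\|_{H^1}=\|u\|_{H^1(\mathbb R^N)}$. For $a>0$ let $$L_a(u)=\tfrac12\|\nabla u\|_2^2+\tfrac a2\|u\|_2^2-\int_{\mathbb R^N} F(u)\,dx\quad(u\in H^1(\mathbb R^N)),\qquad E(a)=\inf\{L_a(u):u\ne0,\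 L_a'(u)=0\},$$ $$S_a=\{U\in H^1(\mathbb R^N)\setminus\{0\}: L_a'(U)=0,\ L_a(U)\le\ell_0,\ U(0)=\max U\},\qquad \widehat S=\bigcup_{a\in[m_0,m_0+\nu_0]}S_a,$$ where $U(0)=\max U$ refers to the continuous representative of $U$. Here $0<\nu_0<\inf_{\partial\Omega}V-m_0$, $F(\xi_0)>\frac12(m_0+\nu_0)\xi_0^2$ and $E(m_0+\nu_0)<\ell_0<2E(m_0)$. Fix $\nu_1\in(0,\nu_0)$. **Center of mass.** Let $r_*=\inf_{U\in\widehat S}\|U\|_{H^1}$ and fix $R_0>1$ such that $\|U\|_{H^1(|x|\le R_0)}>\frac34r_*$ and $\|U\|_{H^1(|x|\ge R_0)}<\frac18r_*$ for all $U\in\widehat S$. Fix $\psi\in C_0^\infty(\mathbb R)$ with $\psi=1$ on $[0,\frac14r_*]$, $\psi=0$ on $[\frac12r_*,\infty)$ and $0\le\psi\le1$ on $[0,\infty)$. Put $$d(q,u)=\psi\Bigl(\inf_{U\in\widehat S}\|u-U(\cdot-q)\|_{H^1(|x-q|\le R_0)}\Bigr),\qquad \Upsilon(u)=\frac{\int_{\mathbb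 R^N} q\,d(q,u)\,dq}{\int_{\mathbb R^N} d(q,u)\,dq}.$$ **Neighborhood of expected solutions.** Let $\Omega_h=\Omega\cup\{x\notin\Omega:\mathrm{dist}(x,\partial\Omega)<h\}$ and fix $h_0>0$ with $V>m_0$ on $\overline{\Omega_{2h_0}\setminus\Omega}$. For $\varepsilon>0$ put $$J_\varepsilon(u)=\tfrac12\|\nabla u\|_2^2+\tfrac12\int_{\mathbb R^N} V(\varepsilon x)u^2\,dx-\int_{\mathbb R^N} F(u)\,dx+\Bigl(\varepsilon^{-2}\|u\|^2_{L^2(\mathbb R^N\setminus(\Omega_{2h_0}/\varepsilon))}-1\Bigr)_+^{\frac{p+1}2}.$$ Fix $0<\rho_1<\rho_0<\frac18r_*$, $\delta_2>0$ and $0<\delta<\frac{\delta_2}4(\rho_0-\rho_1)$. With $$\mathcal S(r)=\{U(\cdot-y)+\varphi: y\in\mathbb R^N,\ U\in\widehat S,\ \|\varphi\|_{H^1}<r\},\qquad \widehat\rho(u)=\inf_{y\in\mathbb R^N,\,U\in\widehat S}\|u-U(\cdot-y)\|_{H^1},$$ let $$\mathcal X_{\varepsilon,\delta}=\bigl\{u\in\mathcal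 S(\rho_0):\varepsilon\Upsilon(u)\in\Omega([0,\nu_0]),\ J_\varepsilon(u)\le E(m_0)+\delta-\tfrac{\delta_2}2(\widehat\rho(u)-\rho_1)_+\bigr\},\qquad \mathcal X_{\varepsilon,\delta}^c=\{u\in\mathcal X_{\varepsilon,\delta}:J_\varepsilon(u)\le c\}.$$ **The two maps.** Fix $U_0\in\widehat S$ with $L_{m_0}'(U_0)=0$ and $L_{m_0}(U_0)=E(m_0)$, fix $s_0\in(0,1)$ with $\|U_0(\cdot/s)-U_0\|_{H^1}<\rho_1$ for all $s\in[1-s_0,1+s_0]$, and fix $\hat\delta>0$ with $g(1\pm s_0)E(m_0)<E(m_0)-\hat\delta$, where $g(t)=\frac12(Nt^{N-2}-(N-2)t^N)$. Let $$P_0(u)=\left(\frac{N\bigl(\int_{\mathbb R^N} F(u)\,dx-\frac{m_0}2\|u\|_2^2\bigr)}{\frac{N-2}2\|\nabla u\|_2^2}\right)^{1/2},$$ let $\tilde P_0(u)$ be the truncation of $P_0(u)$ to $[1-s_0,1+s_0]$ (equal to $1+s_0$ if $P_0(u)\ge1+s_0$, to $1-s_0$ if $P_0(u)\le1-s_0$,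 and to $P_0(u)$ otherwise), and put $$\Phi_\varepsilon(s,y)=U_0\Bigl(\frac{\,\cdot\,-y/\varepsilon}{s}\Bigr),\qquad \Psi_\varepsilon(u)=(\tilde P_0(u),\varepsilon\Upsilon(u)).$$ **Proposition 4.2.** There is $\varepsilon_0>0$ such that for every $\varepsilon\in(0,\varepsilon_0)$ the following hold. (A map of pairs $(A,B)\to(A',B')$, where $B\subset A$ and $B'\subset A'$, is a continuous map $A\to A'$ sending $B$ into $B'$.) 1. $\Phi_\varepsilon$ is a map of pairs $([1-s_0,1+s_0]\times K,\{1\pm s_0\}\times K)\to(\mathcal X_{\varepsilon,\delta}^{E(m_0)+\hat\delta},\mathcal X_{\varepsilon,\delta}^{E(m_0)-\hat\delta})$, so that the composition $\Psi_\varepsilon\circ\Phi_\varepsilon$ is defined. 2. $\Psi_\varepsilon\circ\Phi_\varepsilon$ is a map of pairs $$([1-s_0,1+s_0]\times K,\{1\pm s_0\}\times K)\to([1-s_0,1+s_0]\times\Omega([0,\nu_1]),([1-s_0,1+s_0]\setminus\{1\})\times\Omega([0,\nu_1]))$$ and, as such, is homotopic to the inclusion $j(s,y)=(s,y)$. That is,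 there is a continuous map $\eta:[0,1]\times[1-s_0,1+s_0]\times K\to[1-s_0,1+s_0]\times\Omega([0,\nu_1])$ with $\eta(0,s,y)=(\Psi_\varepsilon\circ\Phi_\varepsilon)(s,y)$ and $\eta(1,s,y)=(s,y)$ for all $(s,y)\in[1-s_0,1+s_0]\times K$, and $\eta(t,s,y)\in([1-s_0,1+s_0]\setminus\{1\})\times\Omega([0,\nu_1])$ for all $t\in[0,1]$ and $(s,y)\in\{1\pm s_0\}\times K$. -/

import Mathlib

open MeasureTheory Set
open scoped ContDiff ENNReal

noncomputable section

namespace SemiclassicalNLS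

/-- The Euclidean space `ℝ^N`. -/
abbrev E (N : ℕ) : Type := EuclideanSpace ℝ (Fin N)

/-! ### The Sobolev space `H¹(ℝ^N)` -/

/-- `G` is the weak (distributional) gradient of `u`: for every test function `φ ∈ C_c^∞(ℝ^N)` and
every direction `v`, `∫ u ∂_v φ = - ∫ φ ⟨G, v⟩`. -/
def IsWeakGradient {N : ℕ} (u : E N → ℝ) (G : E N → E N) : Prop :=
  ∀ φ : E N → ℝ, ContDiff ℝ ∞ φ → HasCompactSupport φ → ∀ v : E N,
    ∫ x, u x * fderiv ℝ φ x v = - ∫ x, φ x * inner ℝ (G x) v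

/-- The ambient Hilbert space `L²(ℝ^N) × L²(ℝ^N; ℝ^N)`, with norm
`‖(u, G)‖² = ‖u‖₂² + ‖G‖₂²`. -/
abbrev L2Pair (N : ℕ) : Type :=
  WithLp 2 (Lp ℝ 2 (volume : Measure (E N)) × Lp (E N) 2 (volume : Measure (E N)))

lemma integrable_mul_test {N : ℕ} {u : E N → ℝ} (hu : MemLp u 2 volume) {φ : E N → ℝ}
    (hφ : ContDiff ℝ ∞ φ) (hc : HasCompactSupport φ) (v : E N) :
    Integrable (fun x => u x * fderiv ℝ φ x v) := by
  have h1 : Continuous (fun x => fderiv ℝ φ x v) :=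
    (hφ.continuous_fderiv (by simp)).clm_apply continuous_const
  have h2 : HasCompactSupport (fun x => fderiv ℝ φ x v) :=
    (hc.fderiv (𝕜 := ℝ)).comp_left (g := fun L : E N →L[ℝ] ℝ => L v) (by simp)
  exact hu.integrable_mul (h1.memLp_of_hasCompactSupport (p := 2) h2)

lemma integrable_test_inner {N : ℕ} {G : E N → E N} (hG : MemLp G 2 volume) {φ : E N → ℝ}
    (hφ : ContDiff ℝ ∞ φ) (hc : HasCompactSupport φ) (v : E N) :
    Integrable (fun x => φ x * inner ℝ (G x) v) :=
  (hφ.continuous.memLp_of_hasCompactSupport (p := 2) hc).integrable_mul (q := 2) (hG.inner_const v)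

/-- `H¹(ℝ^N)`, realized as the subspace of all pairs `(u, ∇u)` with `u ∈ L²` and weak gradient
`∇u ∈ L²`. -/
def h1Submodule (N : ℕ) : Submodule ℝ (L2Pair N) where
  carrier := {w | IsWeakGradient (w.fst : E N → ℝ) (w.snd : E N → E N)}
  zero_mem' := by
    intro φ hφ hc v
    have h1 : ∀ᵐ x : E N, ((0 : L2Pair N).fst : E N → ℝ) x * fderiv ℝ φ x v = 0 := by
      filter_upwards [Lp.coeFn_zero ℝ 2 (volume : Measure (E N))] with x hx
      rw [WithLp.zero_fst, hx, Pi.zero_apply, zero_mul]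
    have h2 : ∀ᵐ x : E N, φ x * inner ℝ (((0 : L2Pair N).snd : E N → E N) x) v = 0 := by
      filter_upwards [Lp.coeFn_zero (E N) 2 (volume : Measure (E N))] with x hx
      rw [WithLp.zero_snd, hx, Pi.zero_apply, inner_zero_left, mul_zero]
    rw [integral_eq_zero_of_ae h1, integral_eq_zero_of_ae h2, neg_zero]
  add_mem' := by
    intro a b ha hb φ hφ hc v
    have h1 : ∀ᵐ x : E N, ((a + b).fst : E N → ℝ) x * fderiv ℝ φ x v =
        (a.fst : E N → ℝ) x * fderiv ℝ φ x v + (b.fst : E N → ℝ) x * fderiv ℝ φ x v := by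
      filter_upwards [Lp.coeFn_add a.fst b.fst] with x hx
      rw [WithLp.add_fst, hx, Pi.add_apply, add_mul]
    have h2 : ∀ᵐ x : E N, φ x * inner ℝ (((a + b).snd : E N → E N) x) v =
        φ x * inner ℝ ((a.snd : E N → E N) x) v + φ x * inner ℝ ((b.snd : E N → E N) x) v := by
      filter_upwards [Lp.coeFn_add a.snd b.snd] with x hx
      rw [WithLp.add_snd, hx, Pi.add_apply, inner_add_left, mul_add]
    rw [integral_congr_ae h1, integral_congr_ae h2,
      integral_add (integrable_mul_test (Lp.memLp _) hφ hc v)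
        (integrable_mul_test (Lp.memLp _) hφ hc v),
      integral_add (integrable_test_inner (Lp.memLp _) hφ hc v)
        (integrable_test_inner (Lp.memLp _) hφ hc v), ha φ hφ hc v, hb φ hφ hc v]
    ring
  smul_mem' := by
    intro c a ha φ hφ hc v
    have h1 : ∀ᵐ x : E N, ((c • a).fst : E N → ℝ) x * fderiv ℝ φ x v =
        c * ((a.fst : E N → ℝ) x * fderiv ℝ φ x v) := by
      filter_upwards [Lp.coeFn_smul c a.fst] with x hx
      rw [WithLp.smul_fst, hx, Pi.smul_apply, smul_eq_mul, mul_assoc]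
    have h2 : ∀ᵐ x : E N, φ x * inner ℝ (((c • a).snd : E N → E N) x) v =
        c * (φ x * inner ℝ ((a.snd : E N → E N) x) v) := by
      filter_upwards [Lp.coeFn_smul c a.snd] with x hx
      rw [WithLp.smul_snd, hx, Pi.smul_apply, real_inner_smul_left]
      ring
    rw [integral_congr_ae h1, integral_congr_ae h2, integral_const_mul, integral_const_mul,
      ha φ hφ hc v]
    ring

/-- The Hilbert space `H¹(ℝ^N)`, with norm `‖u‖_{H¹} = (∫ |∇u|² + u²)^{1/2}`. -/
abbrev H1 (N : ℕ) : Type := h1Submodule N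

/-- The function (class) underlying an element of `H¹`. -/
def H1.fn {N : ℕ} (u : H1 N) : Lp ℝ 2 (volume : Measure (E N)) := u.1.fst

/-- The weak gradient of an element of `H¹`. -/
def H1.grad {N : ℕ} (u : H1 N) : Lp (E N) 2 (volume : Measure (E N)) := u.1.snd

lemma H1.norm_eq {N : ℕ} (u : H1 N) : ‖u‖ = Real.sqrt (‖u.fn‖ ^ 2 + ‖u.grad‖ ^ 2) :=
  WithLp.prod_norm_eq_of_L2 u.1

/-- The local norm `‖u‖_{H¹(A)} = (∫_A |∇u|² + u²)^{1/2}`. -/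
def h1NormOn {N : ℕ} (A : Set (E N)) (u : H1 N) : ℝ :=
  Real.sqrt (∫ x in A, (‖u.grad x‖ ^ 2 + u.fn x ^ 2))

lemma memLp_comp_affine {N : ℕ} {F : Type*} [NormedAddCommGroup F] {g : E N → F}
    (hg : MemLp g 2 volume) {s : ℝ} (hs : s ≠ 0) (y : E N) :
    MemLp (fun x => g (s⁻¹ • (x - y))) 2 volume := by
  have h1 : MemLp (fun x => g (s⁻¹ • x)) 2 volume := by
    refine MemLp.comp_of_map (f := fun x : E N => s⁻¹ • x) ?_ (by fun_prop)
    rw [Measure.map_addHaar_smul volume (inv_ne_zero hs)]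
    exact hg.smul_measure ENNReal.ofReal_ne_top
  exact h1.comp_measurePreserving (measurePreserving_sub_right volume y)

lemma integral_comp_affine {N : ℕ} (g : E N → ℝ) (s : ℝ) (y : E N) :
    ∫ x, g (s⁻¹ • (x - y)) = |((s⁻¹) ^ N)⁻¹| * ∫ x, g x := by
  rw [integral_sub_right_eq_self (fun x => g (s⁻¹ • x)) y, Measure.integral_comp_smul]
  simp

lemma isWeakGradient_affine {N : ℕ} {u : E N → ℝ} {G : E N → E N} (h : IsWeakGradient u G)
    {s : ℝ} (hs : s ≠ 0) (y : E N) :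
    IsWeakGradient (fun x => u (s⁻¹ • (x - y))) (fun x => s⁻¹ • G (s⁻¹ • (x - y))) := by
  intro φ hφ hc v
  have hinv : ∀ x : E N, s • (s⁻¹ • (x - y)) + y = x := by
    intro x; rw [smul_smul, mul_inv_cancel₀ hs, one_smul, sub_add_cancel]
  have hd : ∀ z, fderiv ℝ (fun z => φ (s • z + y)) z v = s * fderiv ℝ φ (s • z + y) v := by
    intro z
    have h1 : HasFDerivAt (fun z : E N => s • z + y) (s • ContinuousLinearMap.id ℝ (E N)) z :=
      ((hasFDerivAt_id z).const_smul s).add_const y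
    have h2 : HasFDerivAt φ (fderiv ℝ φ (s • z + y)) (s • z + y) :=
      (hφ.differentiable (by simp) _).hasFDerivAt
    have h3 : HasFDerivAt (fun z => φ (s • z + y)) _ z := h2.comp z h1
    rw [h3.fderiv]
    simp
  have hcs : HasCompactSupport (fun z => φ (s • z + y)) :=
    hc.comp_homeomorph ((Homeomorph.smulOfNeZero s hs).trans (Homeomorph.addRight y))
  have key := h (fun z => φ (s • z + y)) (by fun_prop) hcs v
  have e1 := integral_comp_affine (fun z => u z * fderiv ℝ φ (s • z + y) v) s y
  have e2 := integral_comp_affine (fun z => φ (s • z + y) * inner ℝ (s⁻¹ • G z) v) s y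
  simp only [hinv] at e1 e2
  rw [e1, e2]
  have k1 : ∫ z, u z * fderiv ℝ (fun z => φ (s • z + y)) z v =
      s * ∫ z, u z * fderiv ℝ φ (s • z + y) v := by
    rw [← integral_const_mul]
    congr 1; ext z; rw [hd]; ring
  have k2 : ∫ z, φ (s • z + y) * inner ℝ (s⁻¹ • G z) v =
      s⁻¹ * ∫ z, φ (s • z + y) * inner ℝ (G z) v := by
    rw [← integral_const_mul]
    congr 1; ext z; rw [real_inner_smul_left]; ring
  rw [k1] at key
  rw [k2]
  have : ∫ z, u z * fderiv ℝ φ (s • z + y) v =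
      - (s⁻¹ * ∫ z, φ (s • z + y) * inner ℝ (G z) v) := by
    rw [← mul_right_inj' hs, key]
    field_simp
  rw [this]; ring

/-- The rescaled and translated function `x ↦ u ((x - y) / s)`, for `s ≠ 0` (and `0` if `s = 0`,
which never occurs below). Its weak gradient is `x ↦ s⁻¹ ∇u ((x - y) / s)`. -/
def rescale {N : ℕ} (s : ℝ) (y : E N) (u : H1 N) : H1 N :=
  if hs : s = 0 then 0 else
    ⟨WithLp.toLp 2
      ((memLp_comp_affine (Lp.memLp u.fn) hs y).toLp (fun x => u.fn (s⁻¹ • (x - y))),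
       ((memLp_comp_affine (Lp.memLp u.grad) hs y).const_smul s⁻¹).toLp
         (fun x => s⁻¹ • u.grad (s⁻¹ • (x - y)))), by
      intro φ hφ hc v
      have h := isWeakGradient_affine u.2 hs y φ hφ hc v
      have h1 := MemLp.coeFn_toLp (memLp_comp_affine (Lp.memLp u.fn) hs y)
      have h2 := MemLp.coeFn_toLp ((memLp_comp_affine (Lp.memLp u.grad) hs y).const_smul s⁻¹)
      refine (integral_congr_ae ?_).trans (h.trans (congrArg Neg.neg (integral_congr_ae ?_)))
      · filter_upwards [h1] with x hx
        exact congrArg (· * fderiv ℝ φ x v) hx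
      · filter_upwards [h2] with x hx
        exact congrArg (fun z => φ x * inner ℝ z v) hx.symm⟩

lemma rescale_fn {N : ℕ} {s : ℝ} (hs : s ≠ 0) (y : E N) (u : H1 N) :
    (rescale s y u).fn =ᵐ[volume] fun x => u.fn (s⁻¹ • (x - y)) := by
  simp only [rescale, dif_neg hs]
  exact MemLp.coeFn_toLp (memLp_comp_affine (Lp.memLp u.fn) hs y)

/-- The translate `x ↦ u (x - y)`. -/
def translate {N : ℕ} (y : E N) (u : H1 N) : H1 N := rescale 1 y u

/-! ### The data of the problem -/

/-- The data of the equation `-ε² Δv + V(x) v = f(v)`: the potential `V`, the domain `Ω`, the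
nonlinearity `f`, the growth exponent `p` and the number `ξ₀`. -/
structure Problem (N : ℕ) where
  V : E N → ℝ
  Ω : Set (E N)
  f : ℝ → ℝ
  p : ℝ
  ξ₀ : ℝ

namespace Problem

variable {N : ℕ} (P : Problem N)

/-- `m₀ = inf_Ω V`. -/
def m₀ : ℝ := sInf (P.V '' P.Ω)

/-- The primitive `F(ξ) = ∫₀^ξ f`. -/
def F (ξ : ℝ) : ℝ := ∫ τ in (0 : ℝ)..ξ, P.f τ

/-- The standing assumptions on the potential and on the nonlinearity. -/
structure Assumptions : Prop where
  V_continuous : Continuous P.V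
  V_inf_pos : 0 < ⨅ x, P.V x
  V_bddAbove : BddAbove (range P.V)
  Ω_open : IsOpen P.Ω
  Ω_connected : IsConnected P.Ω
  Ω_bounded : Bornology.IsBounded P.Ω
  V_well : P.m₀ < sInf (P.V '' frontier P.Ω)
  f_continuous : Continuous P.f
  f_zero : P.f 0 = 0
  f_superlinear : Filter.Tendsto (fun ξ => P.f ξ / ξ) (nhdsWithin 0 {0}ᶜ) (nhds 0)
  p_range : 1 < P.p ∧ P.p < ((N : ℝ) + 2) / ((N : ℝ) - 2)
  f_subcritical : Filter.Tendsto (fun ξ => P.f ξ / ξ ^ P.p) Filter.atTop (nhds 0)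
  ξ₀_pos : 0 < P.ξ₀
  F_ξ₀ : P.m₀ * P.ξ₀ ^ 2 / 2 < P.F P.ξ₀
  f_nonpos : ∀ ξ ≤ 0, P.f ξ = 0

/-- `K = {x ∈ Ω : V(x) = m₀}`. -/
def K : Set (E N) := {x | x ∈ P.Ω ∧ P.V x = P.m₀}

/-- `Ω(I) = {y ∈ Ω : V(y) - m₀ ∈ I}`. -/
def ΩOf (I : Set ℝ) : Set (E N) := {y | y ∈ P.Ω ∧ P.V y - P.m₀ ∈ I}

/-- `Ω_h = {x ∉ Ω : dist(x, ∂Ω) < h} ∪ Ω`. -/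
def Ωnhd (h : ℝ) : Set (E N) := {x | x ∉ P.Ω ∧ Metric.infDist x (frontier P.Ω) < h} ∪ P.Ω

/-- `L_a(u) = ½ ‖∇u‖₂² + (a/2) ‖u‖₂² - ∫ F(u)`. -/
def L (a : ℝ) (u : H1 N) : ℝ :=
  ‖u.grad‖ ^ 2 / 2 + a / 2 * ‖u.fn‖ ^ 2 - ∫ x, P.F (u.fn x)

/-- `u` is a critical point of `L_a` on `H¹`: `L_a'(u) = 0` (Fréchet derivative). -/
def IsCritical (a : ℝ) (u : H1 N) : Prop := HasFDerivAt (P.L a) (0 : H1 N →L[ℝ] ℝ) u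

/-- The least energy level `E(a) = inf {L_a(u) : u ≠ 0, L_a'(u) = 0}`. -/
def leastEnergy (a : ℝ) : ℝ := sInf (P.L a '' {u | u ≠ 0 ∧ P.IsCritical a u})

/-- `S_a = {U ∈ H¹ ∖ {0} : L_a'(U) = 0, L_a(U) ≤ ℓ₀, U(0) = max U}`, where pointwise values are
those of the continuous representative of `U`. -/
def S (ℓ₀ a : ℝ) : Set (H1 N) :=
  {U | U ≠ 0 ∧ P.IsCritical a U ∧ P.L a U ≤ ℓ₀ ∧
    ∃ W : E N → ℝ, Continuous W ∧ (U.fn : E N → ℝ) =ᵐ[volume] W ∧ ∀ x, W x ≤ W 0}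

/-- `P₀(u) = (N (∫ F(u) - (m₀/2) ‖u‖₂²) / (((N-2)/2) ‖∇u‖₂²))^{1/2}`. -/
def P₀ (u : H1 N) : ℝ :=
  Real.sqrt ((N : ℝ) * ((∫ x, P.F (u.fn x)) - P.m₀ / 2 * ‖u.fn‖ ^ 2) /
    (((N : ℝ) - 2) / 2 * ‖u.grad‖ ^ 2))

/-- `I_ε(u) = ½ ‖∇u‖₂² + ½ ∫ V(εx) u² - ∫ F(u)`. -/
def I (ε : ℝ) (u : H1 N) : ℝ :=
  ‖u.grad‖ ^ 2 / 2 + (∫ x, P.V (ε • x) * u.fn x ^ 2) / 2 - ∫ x, P.F (u.fn x)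

/-- The penalization `Q_ε(u) = (ε⁻² ‖u‖²_{L²(ℝ^N ∖ (Ω_{2h₀}/ε))} - 1)_+^{(p+1)/2}`. -/
def Q (h₀ ε : ℝ) (u : H1 N) : ℝ :=
  (max (ε⁻¹ ^ 2 * (∫ x in {x : E N | ε • x ∉ P.Ωnhd (2 * h₀)}, u.fn x ^ 2) - 1) 0) ^
    ((P.p + 1) / 2)

/-- The penalized functional `J_ε = I_ε + Q_ε`. -/
def J (h₀ ε : ℝ) (u : H1 N) : ℝ := P.I ε u + P.Q h₀ ε u

end Problem

/-- `g(t) = ½ (N t^{N-2} - (N-2) t^N)`, for `N ≥ 3`. -/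
def gFun (N : ℕ) (t : ℝ) : ℝ := ((N : ℝ) * t ^ (N - 2) - ((N : ℝ) - 2) * t ^ N) / 2

/-! ### The auxiliary constants and the constructions depending on them -/

/-- The auxiliary constants and objects that are fixed in the course of the construction. -/
structure Constants (N : ℕ) where
  ν₀ : ℝ
  ν₁ : ℝ
  ℓ₀ : ℝ
  R₀ : ℝ
  ψ : ℝ → ℝ
  h₀ : ℝ
  ρ₀ : ℝ
  ρ₁ : ℝ
  δ₂ : ℝ
  δ : ℝ
  s₀ : ℝ
  δhat : ℝ
  U₀ : H1 N

namespace Constants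

variable {N : ℕ} (C : Constants N) (P : Problem N)

/-- `Ŝ = ⋃_{a ∈ [m₀, m₀+ν₀]} S_a`. -/
def Shat : Set (H1 N) := ⋃ a ∈ Icc P.m₀ (P.m₀ + C.ν₀), P.S C.ℓ₀ a

/-- `r_* = min_{U ∈ Ŝ} ‖U‖_{H¹}`. -/
def rStar : ℝ := sInf ((fun U : H1 N => ‖U‖) '' C.Shat P)

/-- `𝒮(r) = {U(x - y) + φ(x) : y ∈ ℝ^N, U ∈ Ŝ, ‖φ‖_{H¹} < r}`. -/
def tube (r : ℝ) : Set (H1 N) :=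
  {u | ∃ y : E N, ∃ U ∈ C.Shat P, ∃ φ : H1 N, ‖φ‖ < r ∧ u = translate y U + φ}

/-- `ρ̂(u) = inf {‖u - U(x - y)‖_{H¹} : y ∈ ℝ^N, U ∈ Ŝ}`. -/
def rhoHat (u : H1 N) : ℝ :=
  sInf {t | ∃ y : E N, ∃ U ∈ C.Shat P, t = ‖u - translate y U‖}

/-- The density `d(q,u) = ψ(inf_{U ∈ Ŝ} ‖u - U(x - q)‖_{H¹(|x-q| ≤ R₀)})`. -/
def density (q : E N) (u : H1 N) : ℝ :=
  C.ψ (sInf ((fun U : H1 N => h1NormOn (Metric.closedBall q C.R₀) (u - translate q U)) ''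
    C.Shat P))

/-- The center of mass `Υ(u) = ∫ q d(q,u) dq / ∫ d(q,u) dq`. -/
def Upsilon (u : H1 N) : E N :=
  (∫ q, C.density P q u)⁻¹ • ∫ q, C.density P q u • q

/-- The neighborhood `𝒳_{ε,δ}` of expected solutions. -/
def X (ε : ℝ) : Set (H1 N) :=
  {u | u ∈ C.tube P C.ρ₀ ∧ ε • C.Upsilon P u ∈ P.ΩOf (Icc 0 C.ν₀) ∧
    P.J C.h₀ ε u ≤ P.leastEnergy P.m₀ + C.δ - C.δ₂ / 2 * max (C.rhoHat P u - C.ρ₁) 0}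

/-- The sublevel set `𝒳_{ε,δ}^c = {u ∈ 𝒳_{ε,δ} : J_ε(u) ≤ c}`. -/
def Xlevel (ε c : ℝ) : Set (H1 N) := {u | u ∈ C.X P ε ∧ P.J C.h₀ ε u ≤ c}

/-- `P̃₀`: the truncation of `P₀` to the interval `[1 - s₀, 1 + s₀]`. -/
def P₀t (u : H1 N) : ℝ :=
  if 1 + C.s₀ ≤ P.P₀ u then 1 + C.s₀
  else if P.P₀ u ≤ 1 - C.s₀ then 1 - C.s₀
  else P.P₀ u

/-- `Φ_ε(s, y) = U₀((x - y/ε) / s)`. -/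
def Phi (ε : ℝ) (z : ℝ × E N) : H1 N := rescale z.1 (ε⁻¹ • z.2) C.U₀

/-- `Ψ_ε(u) = (P̃₀(u), ε Υ(u))`. -/
def Psi (ε : ℝ) (u : H1 N) : ℝ × E N := (C.P₀t P u, ε • C.Upsilon P u)

/-- The requirements under which the auxiliary constants and objects are chosen. -/
structure Admissible : Prop where
  /- the range of frozen potentials, the energy bound and the radius `ν₁` -/
  ν₀_pos : 0 < C.ν₀
  ν₀_lt : C.ν₀ < sInf (P.V '' frontier P.Ω) - P.m₀
  ν₀_F : (P.m₀ + C.ν₀) * P.ξ₀ ^ 2 / 2 < P.F P.ξ₀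
  ℓ₀_gt : P.leastEnergy (P.m₀ + C.ν₀) < C.ℓ₀
  ℓ₀_lt : C.ℓ₀ < 2 * P.leastEnergy P.m₀
  ν₁_pos : 0 < C.ν₁
  ν₁_lt : C.ν₁ < C.ν₀
  /- the radius and the cutoff in the center of mass -/
  R₀_gt : 1 < C.R₀
  R₀_inside : ∀ U ∈ C.Shat P, 3 / 4 * C.rStar P < h1NormOn {x | ‖x‖ ≤ C.R₀} U
  R₀_outside : ∀ U ∈ C.Shat P, h1NormOn {x | C.R₀ ≤ ‖x‖} U < 1 / 8 * C.rStar P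
  ψ_smooth : ContDiff ℝ ∞ C.ψ
  ψ_support : HasCompactSupport C.ψ
  ψ_one : ∀ r, 0 ≤ r → r ≤ C.rStar P / 4 → C.ψ r = 1
  ψ_zero : ∀ r, C.rStar P / 2 ≤ r → C.ψ r = 0
  ψ_mem : ∀ r, 0 ≤ r → C.ψ r ∈ Icc (0 : ℝ) 1
  /- the width of the region where the penalization is switched off -/
  h₀_pos : 0 < C.h₀
  h₀_V : ∀ x ∈ closure (P.Ωnhd (2 * C.h₀) \ P.Ω), P.m₀ < P.V x
  /- the size of the neighborhood of expected solutions -/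
  ρ₁_pos : 0 < C.ρ₁
  ρ₁_lt : C.ρ₁ < C.ρ₀
  ρ₀_lt : C.ρ₀ < C.rStar P / 8
  δ₂_pos : 0 < C.δ₂
  δ_pos : 0 < C.δ
  δ_lt : C.δ < C.δ₂ / 4 * (C.ρ₀ - C.ρ₁)
  /- the least energy solution `U₀` of `-Δu + m₀ u = f(u)` -/
  U₀_mem : C.U₀ ∈ C.Shat P
  U₀_critical : P.IsCritical P.m₀ C.U₀
  U₀_energy : P.L P.m₀ C.U₀ = P.leastEnergy P.m₀
  /- the numbers `s₀` and `δ̂` -/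
  s₀_pos : 0 < C.s₀
  s₀_lt : C.s₀ < 1
  s₀_close : ∀ s ∈ Icc (1 - C.s₀) (1 + C.s₀), ‖rescale s 0 C.U₀ - C.U₀‖ < C.ρ₁
  δhat_pos : 0 < C.δhat
  δhat_left : gFun N (1 - C.s₀) * P.leastEnergy P.m₀ < P.leastEnergy P.m₀ - C.δhat
  δhat_right : gFun N (1 + C.s₀) * P.leastEnergy P.m₀ < P.leastEnergy P.m₀ - C.δhat

end Constants

/-- `φ : (A, B) → (A', B')` is a map of pairs: `B ⊆ A`, `B' ⊆ A'`, `φ : A → A'` is continuous and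
`φ(B) ⊆ B'`. -/
def IsPairMap {X Y : Type*} [TopologicalSpace X] [TopologicalSpace Y]
    (φ : X → Y) (A B : Set X) (A' B' : Set Y) : Prop :=
  B ⊆ A ∧ B' ⊆ A' ∧ ContinuousOn φ A ∧ MapsTo φ A A' ∧ MapsTo φ B B'

end SemiclassicalNLS

end

namespace SemiclassicalNLS

variable {N : ℕ}

/-! ### Square-integrable functions -/

/-! On dilates and translates of the least energy profile `U₀` all the quantities in the statement
can be computed. Once `U₀` satisfies the Pohozaev identity, `P₀` of `U₀((· - y)/s)` is exactly `s`
(`P₀_rescale`), and its `L` energy at `m₀` is `g(s) E(m₀)` (`L_rescale_eq_gFun`), where `g ≤ 1` and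
`g(1 ± s₀) E(m₀) < E(m₀) - δ̂`. By translation invariance its center of mass is `y + c(s)` with
`|c(s)| ≤ 2 R₀` (`Upsilon_rescale`, `norm_profileShift_le`). Hence the composition of the two maps
is `(s, y) ↦ (s, y + ε c(s))`. The homotopy shrinks `ε c(s)` to `0` and leaves `s` alone, so it
never meets `s = 1` over the endpoints. For small `ε` it also stays in the neighborhood of the
compact set `K` where `V ≤ m₀ + ν₁`. The functional `J` exceeds the energy at `m₀` by at most a
small error: `V(εx)` is close to `m₀` where the profile concentrates, and the penalization vanishes
identically. Both facts rest on the finite second moment of `U₀²`.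

It remains to extract the second moment and the Pohozaev identity from criticality in `H¹` and from
the upper bound `U₀ ≤ M` given by the maximum. Below the level `M` the nonlinearity may be replaced
by its truncation, which is bounded and uniformly continuous. The nonlinear term then has a first
order expansion whose error `κ ‖u‖ ‖d‖ + C ‖d‖²` involves `L²` norms only
(`exists_integral_taylor`). The admissible variations are those that keep the function below `M`;
multiplication by factors in `[0, 1]` and dilations are among them.

The first kind, with weights growing like `|x|`, gives second moments of `U₀²` and `|∇U₀|²`
(`exists_weighted_bound`). Consequently `U₀(·/s) - U₀` is `O(|s - 1|)` in `L²`
(`rescale_sub_norm_le`). Its gradient enters the expansion of the energy only through a nonnegative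
square. The energy of `U₀(·/s)` is therefore at least that of `U₀` up to `o(|s - 1|)` on both sides
of `s = 1`, and its derivative there vanishes. This is the Pohozaev identity. -/

lemma integrable_norm_sq {X F : Type*} [MeasurableSpace X] {μ : Measure X} [NormedAddCommGroup F]
    {f : X → F} (hf : MemLp f 2 μ) : Integrable (fun x => ‖f x‖ ^ 2) μ :=
  (memLp_two_iff_integrable_sq_norm hf.1).1 hf

section L2

variable {X F : Type*} [MeasurableSpace X] {μ : Measure X} [NormedAddCommGroup F]
  [InnerProductSpace ℝ F]

lemma l2_norm_sq (f : Lp F 2 μ) : ‖f‖ ^ 2 = ∫ x, ‖f x‖ ^ 2 ∂μ := by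
  rw [← real_inner_self_eq_norm_sq, L2.inner_def]
  simp

lemma integrable_sq {f : X → ℝ} (hf : MemLp f 2 μ) : Integrable (fun x => f x ^ 2) μ :=
  (memLp_two_iff_integrable_sq hf.1).1 hf

lemma toLp_norm_sq {f : X → F} (hf : MemLp f 2 μ) : ‖hf.toLp f‖ ^ 2 = ∫ x, ‖f x‖ ^ 2 ∂μ := by
  rw [l2_norm_sq]
  refine integral_congr_ae ?_
  filter_upwards [hf.coeFn_toLp] with x hx
  rw [hx]

lemma toLp_inner {f g : X → F} (hf : MemLp f 2 μ) (hg : MemLp g 2 μ) :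
    inner ℝ (hf.toLp f) (hg.toLp g) = ∫ x, inner ℝ (f x) (g x) ∂μ := by
  rw [L2.inner_def]
  refine integral_congr_ae ?_
  filter_upwards [hf.coeFn_toLp, hg.coeFn_toLp] with x hx hx'
  rw [hx, hx']

lemma integrable_inner {f g : X → F} (hf : MemLp f 2 μ) (hg : MemLp g 2 μ) :
    Integrable (fun x => inner ℝ (f x) (g x)) μ := by
  have := L2.integrable_inner (𝕜 := ℝ) (hf.toLp f) (hg.toLp g)
  refine this.congr ?_
  filter_upwards [hf.coeFn_toLp, hg.coeFn_toLp] with x hx hx'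
  rw [hx, hx']

lemma abs_integral_inner_le {f g : X → F} (hf : MemLp f 2 μ) (hg : MemLp g 2 μ) :
    |∫ x, inner ℝ (f x) (g x) ∂μ| ≤
      Real.sqrt (∫ x, ‖f x‖ ^ 2 ∂μ) * Real.sqrt (∫ x, ‖g x‖ ^ 2 ∂μ) := by
  rw [← toLp_inner hf hg, ← toLp_norm_sq hf, ← toLp_norm_sq hg, Real.sqrt_sq (norm_nonneg _),
    Real.sqrt_sq (norm_nonneg _)]
  exact abs_real_inner_le_norm _ _

lemma integral_inner_coeFn (f g : Lp ℝ 2 μ) : inner ℝ f g = ∫ x, f x * g x ∂μ := by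
  rw [L2.inner_def]
  simp [mul_comm]

end L2

/-! ### Basic properties of `H¹` -/

namespace H1

lemma fn_add (u v : H1 N) : (u + v).fn = u.fn + v.fn := rfl
lemma fn_sub (u v : H1 N) : (u - v).fn = u.fn - v.fn := rfl
lemma fn_smul (c : ℝ) (u : H1 N) : (c • u).fn = c • u.fn := rfl
lemma grad_add (u v : H1 N) : (u + v).grad = u.grad + v.grad := rfl
lemma grad_smul (c : ℝ) (u : H1 N) : (c • u).grad = c • u.grad := rfl

lemma norm_sq (u : H1 N) : ‖u‖ ^ 2 = ‖u.fn‖ ^ 2 + ‖u.grad‖ ^ 2 := by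
  rw [norm_eq, Real.sq_sqrt (by positivity)]

lemma ext_fn_grad {u v : H1 N} (h : u.fn = v.fn) (h' : u.grad = v.grad) : u = v :=
  Subtype.ext (WithLp.ofLp_injective 2 (Prod.ext h h'))

lemma ext_ae {u v : H1 N} (h : u.fn =ᵐ[volume] v.fn) (h' : u.grad =ᵐ[volume] v.grad) : u = v :=
  ext_fn_grad (Lp.ext h) (Lp.ext h')

lemma isWeakGradient (u : H1 N) : IsWeakGradient (u.fn : E N → ℝ) (u.grad : E N → E N) := u.2

lemma exists_of_isWeakGradient {g : E N → ℝ} {G : E N → E N} (hg : MemLp g 2 volume)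
    (hG : MemLp G 2 volume) (h : IsWeakGradient g G) :
    ∃ w : H1 N, w.fn =ᵐ[volume] g ∧ w.grad =ᵐ[volume] G := by
  refine ⟨⟨WithLp.toLp 2 (hg.toLp g, hG.toLp G), ?_⟩, hg.coeFn_toLp, hG.coeFn_toLp⟩
  intro φ hφ hc v
  refine (integral_congr_ae ?_).trans
    ((h φ hφ hc v).trans (congrArg Neg.neg (integral_congr_ae ?_)))
  · filter_upwards [hg.coeFn_toLp] with x hx
    exact congrArg (· * fderiv ℝ φ x v) hx
  · filter_upwards [hG.coeFn_toLp] with x hx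
    exact congrArg (fun z => φ x * inner ℝ z v) hx.symm

lemma memLp_fn (u : H1 N) : MemLp (u.fn : E N → ℝ) 2 volume := Lp.memLp _
lemma memLp_grad (u : H1 N) : MemLp (u.grad : E N → E N) 2 volume := Lp.memLp _

lemma fn_norm_sq (u : H1 N) : ‖u.fn‖ ^ 2 = ∫ x, u.fn x ^ 2 := by
  rw [l2_norm_sq]; simp

lemma grad_norm_sq (u : H1 N) : ‖u.grad‖ ^ 2 = ∫ x, ‖u.grad x‖ ^ 2 := l2_norm_sq _

lemma fn_sub_ae (u v : H1 N) : (u - v).fn =ᵐ[volume] fun x => u.fn x - v.fn x :=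
  Lp.coeFn_sub u.fn v.fn

lemma grad_sub_ae (u v : H1 N) : (u - v).grad =ᵐ[volume] fun x => u.grad x - v.grad x :=
  Lp.coeFn_sub u.grad v.grad

lemma fn_add_ae (u v : H1 N) : (u + v).fn =ᵐ[volume] fun x => u.fn x + v.fn x :=
  Lp.coeFn_add u.fn v.fn

lemma fn_smul_ae (c : ℝ) (u : H1 N) : (c • u).fn =ᵐ[volume] fun x => c * u.fn x :=
  Lp.coeFn_smul c u.fn

/-- Multiplication of an `H¹` function by a bounded smooth function with bounded derivative. -/
lemma exists_mul (u : H1 N) {η : E N → ℝ} (hη : ContDiff ℝ ∞ η) {A B : ℝ} (hA : ∀ x, |η x| ≤ A)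
    (hB : ∀ x, ‖gradient η x‖ ≤ B) :
    ∃ w : H1 N, w.fn =ᵐ[volume] (fun x => η x * u.fn x) ∧
      w.grad =ᵐ[volume] fun x => η x • u.grad x + u.fn x • gradient η x := by
  have hcη : Continuous η := hη.continuous
  have hcg : Continuous (gradient η) :=
    (InnerProductSpace.toDual ℝ (E N)).symm.continuous.comp (hη.continuous_fderiv (by simp))
  have m1 : MemLp (fun x => η x * u.fn x) 2 volume :=
    u.memLp_fn.of_le_mul (c := A) (hcη.aestronglyMeasurable.mul u.memLp_fn.1)
      (Filter.Eventually.of_forall fun x => by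
        rw [norm_mul]; exact mul_le_mul_of_nonneg_right (hA x) (norm_nonneg _))
  have m2 : MemLp (fun x => η x • u.grad x) 2 volume :=
    u.memLp_grad.of_le_mul (c := A) (hcη.aestronglyMeasurable.smul u.memLp_grad.1)
      (Filter.Eventually.of_forall fun x => by
        rw [norm_smul]; exact mul_le_mul_of_nonneg_right (hA x) (norm_nonneg _))
  have m3 : MemLp (fun x => u.fn x • gradient η x) 2 volume :=
    u.memLp_fn.of_le_mul (c := B) (u.memLp_fn.1.smul hcg.aestronglyMeasurable)
      (Filter.Eventually.of_forall fun x => by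
        rw [norm_smul, mul_comm]; exact mul_le_mul_of_nonneg_right (hB x) (norm_nonneg _))
  refine exists_of_isWeakGradient m1 (m2.add m3) ?_
  intro φ hφ hc v
  have hprod : ContDiff ℝ ∞ (fun x => η x * φ x) := hη.mul hφ
  have hpc : HasCompactSupport (fun x => η x * φ x) := hc.mul_left
  -- The weak gradient of `u` is tested against `η φ`; the product rule then moves `η` onto `u`.
  have key := u.isWeakGradient _ hprod hpc v
  have hd : ∀ x, fderiv ℝ (fun x => η x * φ x) x v
      = η x * fderiv ℝ φ x v + φ x * inner ℝ (gradient η x) v := by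
    intro x
    have h1 := (hη.differentiable (by simp) x)
    rw [fderiv_fun_mul h1 (hφ.differentiable (by simp) x)]
    simp [gradient, InnerProductSpace.toDual_symm_apply]
  have i1 : Integrable (fun x => η x * u.fn x * fderiv ℝ φ x v) :=
    integrable_mul_test m1 hφ hc v
  have i2 := integrable_test_inner m3 hφ hc v
  have i3 := integrable_test_inner m2 hφ hc v
  have e1 : ∫ x, u.fn x * fderiv ℝ (fun x => η x * φ x) x v =
      (∫ x, η x * u.fn x * fderiv ℝ φ x v) +
        ∫ x, φ x * inner ℝ (u.fn x • gradient η x) v := by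
    rw [← integral_add i1 i2]
    refine integral_congr_ae (Filter.Eventually.of_forall fun x => ?_)
    simp only [hd, real_inner_smul_left]; ring
  have e2 : ∫ x, η x * φ x * inner ℝ (u.grad x) v =
      ∫ x, φ x * inner ℝ (η x • u.grad x) v := by
    refine integral_congr_ae (Filter.Eventually.of_forall fun x => ?_)
    simp only [real_inner_smul_left]; ring
  have e3 : ∫ x, φ x * inner ℝ (η x • u.grad x + u.fn x • gradient η x) v =
      (∫ x, φ x * inner ℝ (η x • u.grad x) v) +
        ∫ x, φ x * inner ℝ (u.fn x • gradient η x) v := by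
    rw [← integral_add i3 i2]
    refine integral_congr_ae (Filter.Eventually.of_forall fun x => ?_)
    simp only [inner_add_left]; ring
  simp only
  rw [e3]
  linarith

end H1

/-! ### Rescaling -/

lemma quasiMeasurePreserving_affine {s : ℝ} (hs : s ≠ 0) (y : E N) :
    Measure.QuasiMeasurePreserving (fun x : E N => s⁻¹ • (x - y)) volume volume := by
  have h1 : Measure.QuasiMeasurePreserving (fun x : E N => s⁻¹ • x) volume volume := by
    refine ⟨by fun_prop, ?_⟩
    rw [Measure.map_addHaar_smul volume (inv_ne_zero hs)]
    exact Measure.smul_absolutelyContinuous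
  exact h1.comp (measurePreserving_sub_right volume y).quasiMeasurePreserving

lemma ae_eq_comp_affine {F : Type*} {g h : E N → F} (hgh : g =ᵐ[volume] h) {s : ℝ} (hs : s ≠ 0)
    (y : E N) : (fun x => g (s⁻¹ • (x - y))) =ᵐ[volume] fun x => h (s⁻¹ • (x - y)) :=
  (quasiMeasurePreserving_affine hs y).ae_eq_comp hgh

lemma rescale_grad {s : ℝ} (hs : s ≠ 0) (y : E N) (u : H1 N) :
    (rescale s y u).grad =ᵐ[volume] fun x => s⁻¹ • u.grad (s⁻¹ • (x - y)) := by
  simp only [rescale, dif_neg hs]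
  exact MemLp.coeFn_toLp ((memLp_comp_affine (Lp.memLp u.grad) hs y).const_smul s⁻¹)

lemma integral_comp_affine_of_pos (g : E N → ℝ) {s : ℝ} (hs : 0 < s) (y : E N) :
    ∫ x, g (s⁻¹ • (x - y)) = s ^ N * ∫ x, g x := by
  rw [integral_comp_affine, inv_pow, inv_inv, abs_of_pos (by positivity)]

lemma integrable_comp_affine {g : E N → ℝ} (hg : Integrable g) {s : ℝ} (hs : s ≠ 0) (y : E N) :
    Integrable (fun x => g (s⁻¹ • (x - y))) :=
  ((integrable_comp_smul_iff volume g (inv_ne_zero hs)).2 hg).comp_sub_right y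

lemma rescale_sub (s : ℝ) (y : E N) (u v : H1 N) :
    rescale s y (u - v) = rescale s y u - rescale s y v := by
  by_cases hs : s = 0
  · simp [rescale, hs]
  · refine H1.ext_ae ?_ ?_
    · filter_upwards [rescale_fn hs y (u - v), rescale_fn hs y u, rescale_fn hs y v,
        H1.fn_sub_ae (rescale s y u) (rescale s y v),
        ae_eq_comp_affine (H1.fn_sub_ae u v) hs y] with x h1 h2 h3 h4 h5
      rw [h1, h4, h2, h3, h5]
    · filter_upwards [rescale_grad hs y (u - v), rescale_grad hs y u, rescale_grad hs y v,
        H1.grad_sub_ae (rescale s y u) (rescale s y v),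
        ae_eq_comp_affine (H1.grad_sub_ae u v) hs y] with x h1 h2 h3 h4 h5
      rw [h1, h4, h2, h3, h5, smul_sub]

lemma translate_rescale {s : ℝ} (hs : s ≠ 0) (y z : E N) (u : H1 N) :
    translate y (rescale s z u) = rescale s (z + y) u := by
  have e : ∀ x : E N, (1 : ℝ)⁻¹ • (x - y) - z = x - (z + y) := by
    intro x; rw [inv_one, one_smul]; abel
  refine H1.ext_ae ?_ ?_
  · filter_upwards [rescale_fn one_ne_zero y (rescale s z u), rescale_fn hs (z + y) u,
      ae_eq_comp_affine (rescale_fn hs z u) one_ne_zero y] with x h1 h2 h3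
    rw [translate, h1, h2, h3, e]
  · filter_upwards [rescale_grad one_ne_zero y (rescale s z u), rescale_grad hs (z + y) u,
      ae_eq_comp_affine (rescale_grad hs z u) one_ne_zero y] with x h1 h2 h3
    rw [translate, h1, h2, h3, e, inv_one, one_smul]

lemma translate_sub (y : E N) (u v : H1 N) :
    translate y (u - v) = translate y u - translate y v := rescale_sub 1 y u v

lemma rescale_fn_norm_sq {s : ℝ} (hs : 0 < s) (y : E N) (u : H1 N) :
    ‖(rescale s y u).fn‖ ^ 2 = s ^ N * ‖u.fn‖ ^ 2 := by
  rw [H1.fn_norm_sq, H1.fn_norm_sq, ← integral_comp_affine_of_pos _ hs y]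
  refine integral_congr_ae ?_
  filter_upwards [rescale_fn hs.ne' y u] with x hx
  rw [hx]

lemma rescale_grad_norm_sq (hN : 2 ≤ N) {s : ℝ} (hs : 0 < s) (y : E N) (u : H1 N) :
    ‖(rescale s y u).grad‖ ^ 2 = s ^ (N - 2) * ‖u.grad‖ ^ 2 := by
  have h2 : s ^ N = s ^ (N - 2) * s ^ 2 := by rw [← pow_add, Nat.sub_add_cancel hN]
  rw [H1.grad_norm_sq, H1.grad_norm_sq]
  have : s ^ (N - 2) * ∫ x, ‖u.grad x‖ ^ 2 = s⁻¹ ^ 2 * (s ^ N * ∫ x, ‖u.grad x‖ ^ 2) := by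
    rw [h2]; field_simp
  rw [this, ← integral_comp_affine_of_pos (fun x => ‖u.grad x‖ ^ 2) hs y, ← integral_const_mul]
  refine integral_congr_ae ?_
  filter_upwards [rescale_grad hs.ne' y u] with x hx
  rw [hx, norm_smul, mul_pow, Real.norm_of_nonneg (by positivity)]

lemma integral_comp_rescale_fn (Φ : ℝ → ℝ) {s : ℝ} (hs : 0 < s) (y : E N) (u : H1 N) :
    ∫ x, Φ ((rescale s y u).fn x) = s ^ N * ∫ x, Φ (u.fn x) := by
  rw [← integral_comp_affine_of_pos _ hs y]
  refine integral_congr_ae ?_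
  filter_upwards [rescale_fn hs.ne' y u] with x hx
  rw [hx]

lemma norm_translate (y : E N) (u : H1 N) : ‖translate y u‖ = ‖u‖ := by
  have h1 : ‖(translate y u).fn‖ ^ 2 = ‖u.fn‖ ^ 2 := by
    rw [translate, rescale_fn_norm_sq one_pos]; simp
  have h2 : ‖(translate y u).grad‖ ^ 2 = ‖u.grad‖ ^ 2 := by
    rw [H1.grad_norm_sq, H1.grad_norm_sq]
    have := integral_comp_affine_of_pos (fun x => ‖u.grad x‖ ^ 2) one_pos y
    rw [one_pow, one_mul] at this
    rw [← this]
    refine integral_congr_ae ?_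
    filter_upwards [rescale_grad one_ne_zero y u] with x hx
    rw [translate, hx, inv_one, one_smul, one_smul]
  rw [H1.norm_eq, H1.norm_eq, h1, h2]

/-! ### Continuity of the rescaling -/

/-- Dominated convergence applies because the supports stay in one ball for parameters near `p₀`. -/
lemma tendsto_integral_comp_affine_of_hasCompactSupport {F : Type*} [NormedAddCommGroup F]
    {k : E N → F} (hk : Continuous k) (hc : HasCompactSupport k) {p₀ : ℝ × E N} (h₀ : 0 < p₀.1) :
    Filter.Tendsto (fun p : ℝ × E N =>
      ∫ x, ‖k (p.1⁻¹ • (x - p.2)) - k (p₀.1⁻¹ • (x - p₀.2))‖ ^ 2) (nhds p₀) (nhds 0) := by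
  obtain ⟨C, hC⟩ := hc.exists_bound_of_continuous hk
  obtain ⟨R, hR⟩ := hc.isCompact.isBounded.subset_closedBall (0 : E N)
  have hzero : ∀ z : E N, R < ‖z‖ → k z = 0 := by
    intro z hz
    by_contra hne
    have := hR (subset_tsupport k (Function.mem_support.2 hne))
    rw [mem_closedBall_zero_iff] at this
    linarith
  -- This ball contains the support of `k((· - y)/s)` whenever `0 < s < 2 p₀.1` and `|y| < |p₀.2| +
  -- 1`.
  set ρ : ℝ := ‖p₀.2‖ + 1 + 2 * p₀.1 * max R 0 with hρ
  have hfar : ∀ p : ℝ × E N, 0 < p.1 → p.1 < 2 * p₀.1 → ‖p.2‖ < ‖p₀.2‖ + 1 → ∀ x : E N,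
      ρ < ‖x‖ → k (p.1⁻¹ • (x - p.2)) = 0 := by
    intro p h1 h2 h3 x hx
    refine hzero _ ?_
    rw [norm_smul, norm_inv, Real.norm_of_nonneg h1.le, inv_mul_eq_div, lt_div_iff₀ h1]
    have h4 := norm_sub_norm_le x p.2
    have h5 : R * p.1 ≤ 2 * p₀.1 * max R 0 := by
      have : R * p.1 ≤ max R 0 * p.1 := mul_le_mul_of_nonneg_right (le_max_left _ _) h1.le
      have h6 : max R 0 * p.1 ≤ max R 0 * (2 * p₀.1) :=
        mul_le_mul_of_nonneg_left h2.le (le_max_right _ _)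
      linarith
    linarith
  have hev : ∀ᶠ p : ℝ × E N in nhds p₀, 0 < p.1 ∧ p.1 < 2 * p₀.1 ∧ ‖p.2‖ < ‖p₀.2‖ + 1 := by
    refine ((continuous_fst.tendsto p₀).eventually (lt_mem_nhds h₀)).and
      (((continuous_fst.tendsto p₀).eventually (gt_mem_nhds (by linarith))).and
        ((continuous_snd.norm.tendsto p₀).eventually (gt_mem_nhds (by simp))))
  have h00 : (0 : ℝ) = ∫ _x : E N, (0 : ℝ) := by simp
  rw [h00]
  refine tendsto_integral_filter_of_dominated_convergence
    ((Metric.closedBall (0 : E N) ρ).indicator fun _ => (2 * C) ^ 2) ?_ ?_ ?_ ?_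
  · exact Filter.Eventually.of_forall fun p => by
      have : Continuous fun x : E N => ‖k (p.1⁻¹ • (x - p.2)) - k (p₀.1⁻¹ • (x - p₀.2))‖ ^ 2 := by
        fun_prop
      exact this.aestronglyMeasurable
  · filter_upwards [hev] with p hp
    refine Filter.Eventually.of_forall fun x => ?_
    by_cases hx : ‖x‖ ≤ ρ
    · rw [indicator_of_mem (by simpa using hx), Real.norm_of_nonneg (by positivity)]
      refine pow_le_pow_left₀ (norm_nonneg _) ?_ 2
      have := norm_sub_le (k (p.1⁻¹ • (x - p.2))) (k (p₀.1⁻¹ • (x - p₀.2)))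
      linarith [hC (p.1⁻¹ • (x - p.2)), hC (p₀.1⁻¹ • (x - p₀.2))]
    · rw [hfar p hp.1 hp.2.1 hp.2.2 x (not_le.1 hx),
        hfar p₀ h₀ (by linarith) (by linarith) x (not_le.1 hx)]
      simp only [sub_zero, norm_zero, ne_eq, OfNat.ofNat_ne_zero, not_false_eq_true, zero_pow]
      exact indicator_nonneg (fun _ _ => sq_nonneg _) _
  · exact (integrable_indicator_iff measurableSet_closedBall).2
      (integrableOn_const (measure_closedBall_lt_top.ne))
  · refine Filter.Eventually.of_forall fun x => ?_
    have hcont : ContinuousAt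
        (fun p : ℝ × E N => ‖k (p.1⁻¹ • (x - p.2)) - k (p₀.1⁻¹ • (x - p₀.2))‖ ^ 2) p₀ := by
      have h1 : ContinuousAt (fun p : ℝ × E N => p.1⁻¹ • (x - p.2)) p₀ :=
        (continuousAt_fst.inv₀ h₀.ne').smul (continuousAt_const.sub continuousAt_snd)
      exact (((hk.continuousAt (x := p₀.1⁻¹ • (x - p₀.2))).comp
        (f := fun p : ℝ × E N => p.1⁻¹ • (x - p.2)) h1).sub continuousAt_const).norm.pow 2
    simpa [ContinuousAt] using! hcont

lemma norm_add₃_sq_le {F : Type*} [NormedAddCommGroup F] (a b c : F) :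
    ‖a + b + c‖ ^ 2 ≤ 3 * (‖a‖ ^ 2 + ‖b‖ ^ 2 + ‖c‖ ^ 2) := by
  have h := norm_add₃_le (a := a) (b := b) (c := c)
  have h2 := pow_le_pow_left₀ (norm_nonneg _) h 2
  nlinarith [sq_nonneg (‖a‖ - ‖b‖), sq_nonneg (‖a‖ - ‖c‖), sq_nonneg (‖b‖ - ‖c‖)]

/-- Approximate `g` in `L²` by a compactly supported continuous `k`. The approximation error is
transported by the affine change of variables with a locally bounded Jacobian factor. -/
lemma tendsto_integral_comp_affine {F : Type*} [NormedAddCommGroup F] [InnerProductSpace ℝ F]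
    [CompleteSpace F]
    {g : E N → F} (hg : MemLp g 2 volume) {p₀ : ℝ × E N} (h₀ : 0 < p₀.1) :
    Filter.Tendsto (fun p : ℝ × E N =>
      ∫ x, ‖g (p.1⁻¹ • (x - p.2)) - g (p₀.1⁻¹ • (x - p₀.2))‖ ^ 2) (nhds p₀) (nhds 0) := by
  rw [Metric.tendsto_nhds]
  intro ε hε
  -- `A` bounds the sum of the two Jacobian factors. The factor `3` from `norm_add₃_sq_le` turns `A
  -- · ε/(6A)` and the bound `ε/6` for `k` into two halves of `ε`.
  set A : ℝ := (2 * p₀.1) ^ N + p₀.1 ^ N with hA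
  have hApos : 0 < A := by positivity
  have hδ : 0 < ε / (6 * A) := by positivity
  obtain ⟨k, hkc, hk, hkε⟩ := hg.exist_eLpNorm_sub_le (by simp) (by norm_num)
    (Real.sqrt_pos.2 hδ)
  have hkm : MemLp k 2 volume := hk.continuous.memLp_of_hasCompactSupport hkc
  have hgk : MemLp (fun x => g x - k x) 2 volume := hg.sub hkm
  have hI : ∫ x, ‖g x - k x‖ ^ 2 ≤ ε / (6 * A) := by
    rw [← toLp_norm_sq hgk, Lp.norm_toLp, ← Real.sq_sqrt hδ.le]
    refine pow_le_pow_left₀ ENNReal.toReal_nonneg ?_ 2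
    exact ENNReal.toReal_le_of_le_ofReal (Real.sqrt_nonneg _) hkε
  have hlim := tendsto_integral_comp_affine_of_hasCompactSupport hk.continuous hkc h₀
  rw [Metric.tendsto_nhds] at hlim
  have hev : ∀ᶠ p : ℝ × E N in nhds p₀, 0 < p.1 ∧ p.1 < 2 * p₀.1 :=
    ((continuous_fst.tendsto p₀).eventually (lt_mem_nhds h₀)).and
      ((continuous_fst.tendsto p₀).eventually (gt_mem_nhds (by linarith)))
  filter_upwards [hev, hlim (ε / 6) (by positivity)] with p hp hp'
  rw [Real.dist_0_eq_abs, abs_of_nonneg (integral_nonneg fun x => by positivity)] at hp' ⊢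
  have m1 := memLp_comp_affine hgk hp.1.ne' p.2
  have m2 := memLp_comp_affine hgk h₀.ne' p₀.2
  have m3 := (memLp_comp_affine hkm hp.1.ne' p.2).sub (memLp_comp_affine hkm h₀.ne' p₀.2)
  have j1 := integral_comp_affine_of_pos (fun x => ‖g x - k x‖ ^ 2) hp.1 p.2
  have j2 := integral_comp_affine_of_pos (fun x => ‖g x - k x‖ ^ 2) h₀ p₀.2
  have i1 := integrable_norm_sq m1
  have i2 := integrable_norm_sq m2
  have i3 := integrable_norm_sq m3
  simp only [Pi.sub_apply] at i3
  have hle : ∫ x, ‖g (p.1⁻¹ • (x - p.2)) - g (p₀.1⁻¹ • (x - p₀.2))‖ ^ 2 ≤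
      ∫ x, 3 * (‖g (p.1⁻¹ • (x - p.2)) - k (p.1⁻¹ • (x - p.2))‖ ^ 2 +
        ‖k (p.1⁻¹ • (x - p.2)) - k (p₀.1⁻¹ • (x - p₀.2))‖ ^ 2 +
        ‖g (p₀.1⁻¹ • (x - p₀.2)) - k (p₀.1⁻¹ • (x - p₀.2))‖ ^ 2) := by
    refine integral_mono_of_nonneg (Filter.Eventually.of_forall fun x => by positivity)
      (((i1.add i3).add i2).const_mul 3) (Filter.Eventually.of_forall fun x => ?_)
    have := norm_add₃_sq_le (g (p.1⁻¹ • (x - p.2)) - k (p.1⁻¹ • (x - p.2)))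
      (k (p.1⁻¹ • (x - p.2)) - k (p₀.1⁻¹ • (x - p₀.2)))
      (k (p₀.1⁻¹ • (x - p₀.2)) - g (p₀.1⁻¹ • (x - p₀.2)))
    rw [norm_sub_rev (k (p₀.1⁻¹ • (x - p₀.2))) (g (p₀.1⁻¹ • (x - p₀.2)))] at this
    rwa [sub_add_sub_cancel, sub_add_sub_cancel] at this
  have i4 : Integrable (fun x => ‖g (p.1⁻¹ • (x - p.2)) - k (p.1⁻¹ • (x - p.2))‖ ^ 2 +
      ‖k (p.1⁻¹ • (x - p.2)) - k (p₀.1⁻¹ • (x - p₀.2))‖ ^ 2) := i1.add i3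
  rw [integral_const_mul, integral_add i4 i2, integral_add i1 i3, j1, j2] at hle
  have hnn : 0 ≤ ∫ x, ‖g x - k x‖ ^ 2 := integral_nonneg fun x => by positivity
  have hpow : p.1 ^ N ≤ (2 * p₀.1) ^ N := pow_le_pow_left₀ hp.1.le hp.2.le N
  have hfin : (p.1 ^ N + p₀.1 ^ N) * ∫ x, ‖g x - k x‖ ^ 2 ≤ ε / 6 := by
    calc (p.1 ^ N + p₀.1 ^ N) * ∫ x, ‖g x - k x‖ ^ 2 ≤ A * (ε / (6 * A)) := by
          refine mul_le_mul ?_ hI hnn hApos.le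
          rw [hA]; linarith
      _ = ε / 6 := by field_simp
  linarith

/-- The function part is the previous limit. In the gradient the prefactor `s⁻¹` varies as well, so
the difference is split into a varying function and a varying factor times a fixed function. -/
lemma continuousAt_rescale (u : H1 N) {p₀ : ℝ × E N} (h₀ : 0 < p₀.1) :
    ContinuousAt (fun p : ℝ × E N => rescale p.1 p.2 u) p₀ := by
  have hf := tendsto_integral_comp_affine u.memLp_fn h₀
  have hg := tendsto_integral_comp_affine u.memLp_grad h₀
  have hinv : Filter.Tendsto (fun p : ℝ × E N => p.1⁻¹) (nhds p₀) (nhds p₀.1⁻¹) :=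
    (continuousAt_fst.inv₀ h₀.ne')
  set A := ∫ x, ‖u.grad (p₀.1⁻¹ • (x - p₀.2))‖ ^ 2
  have hb : Filter.Tendsto (fun p : ℝ × E N =>
      (∫ x, ‖u.fn (p.1⁻¹ • (x - p.2)) - u.fn (p₀.1⁻¹ • (x - p₀.2))‖ ^ 2) +
        (2 * (p.1⁻¹ ^ 2 *
          ∫ x, ‖u.grad (p.1⁻¹ • (x - p.2)) - u.grad (p₀.1⁻¹ • (x - p₀.2))‖ ^ 2) +
        2 * ((p.1⁻¹ - p₀.1⁻¹) ^ 2 * A))) (nhds p₀) (nhds 0) := by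
    have := hf.add ((((hinv.pow 2).mul hg).const_mul 2).add
      ((((hinv.sub_const p₀.1⁻¹).pow 2).mul_const A).const_mul 2))
    simpa using this
  have hsq : Filter.Tendsto (fun p : ℝ × E N => ‖rescale p.1 p.2 u - rescale p₀.1 p₀.2 u‖ ^ 2)
      (nhds p₀) (nhds 0) := by
    refine tendsto_of_tendsto_of_tendsto_of_le_of_le' tendsto_const_nhds hb
      (Filter.Eventually.of_forall fun p => sq_nonneg _) ?_
    filter_upwards [(continuous_fst.tendsto p₀).eventually (lt_mem_nhds h₀)] with p hp
    rw [H1.norm_sq, H1.fn_norm_sq, H1.grad_norm_sq]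
    refine add_le_add (le_of_eq (integral_congr_ae ?_)) ?_
    · filter_upwards [H1.fn_sub_ae (rescale p.1 p.2 u) (rescale p₀.1 p₀.2 u),
        rescale_fn hp.ne' p.2 u, rescale_fn h₀.ne' p₀.2 u] with x h1 h2 h3
      rw [h1, h2, h3, Real.norm_eq_abs, sq_abs]
    · have mp := memLp_comp_affine u.memLp_grad hp.ne' p.2
      have m0 := memLp_comp_affine u.memLp_grad h₀.ne' p₀.2
      have i1 := integrable_norm_sq (mp.sub m0)
      have i2 := integrable_norm_sq m0
      simp only [Pi.sub_apply] at i1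
      rw [← integral_const_mul, ← integral_const_mul, ← integral_const_mul, ← integral_const_mul,
        ← integral_add ((i1.const_mul _).const_mul _) ((i2.const_mul _).const_mul _)]
      refine integral_mono_of_nonneg (Filter.Eventually.of_forall fun x => by positivity)
        (((i1.const_mul _).const_mul _).add ((i2.const_mul _).const_mul _)) ?_
      filter_upwards [H1.grad_sub_ae (rescale p.1 p.2 u) (rescale p₀.1 p₀.2 u),
        rescale_grad hp.ne' p.2 u, rescale_grad h₀.ne' p₀.2 u] with x h1 h2 h3
      rw [h1, h2, h3]
      have e : p.1⁻¹ • u.grad (p.1⁻¹ • (x - p.2)) - p₀.1⁻¹ • u.grad (p₀.1⁻¹ • (x - p₀.2)) =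
          p.1⁻¹ • (u.grad (p.1⁻¹ • (x - p.2)) - u.grad (p₀.1⁻¹ • (x - p₀.2))) +
          (p.1⁻¹ - p₀.1⁻¹) • u.grad (p₀.1⁻¹ • (x - p₀.2)) := by
        generalize u.grad (p.1⁻¹ • (x - p.2)) = a
        generalize u.grad (p₀.1⁻¹ • (x - p₀.2)) = b
        module
      rw [e, ← sq_abs (p.1⁻¹ - p₀.1⁻¹), ← sq_abs (p.1⁻¹), ← mul_pow, ← mul_pow,
        ← Real.norm_eq_abs, ← Real.norm_eq_abs, ← norm_smul, ← norm_smul]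
      generalize p.1⁻¹ • (u.grad (p.1⁻¹ • (x - p.2)) - u.grad (p₀.1⁻¹ • (x - p₀.2))) = a
      generalize (p.1⁻¹ - p₀.1⁻¹) • u.grad (p₀.1⁻¹ • (x - p₀.2)) = b
      have := pow_le_pow_left₀ (norm_nonneg _) (norm_add_le a b) 2
      nlinarith [sq_nonneg (‖a‖ - ‖b‖)]
  rw [ContinuousAt, tendsto_iff_norm_sub_tendsto_zero]
  have := hsq.sqrt
  simpa [Real.sqrt_sq (norm_nonneg _)] using this

/-! ### Local norms -/

/-- The restriction of `(u, ∇u)` to `A`. -/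
noncomputable def restrictPair (A : Set (E N)) (u : H1 N) :
    WithLp 2 (Lp ℝ 2 (volume.restrict A) × Lp (E N) 2 (volume.restrict A)) :=
  WithLp.toLp 2 ((u.memLp_fn.restrict A).toLp u.fn, (u.memLp_grad.restrict A).toLp u.grad)

lemma restrictPair_sub (A : Set (E N)) (u v : H1 N) :
    restrictPair A (u - v) = restrictPair A u - restrictPair A v := by
  refine WithLp.ofLp_injective 2 (Prod.ext ?_ ?_)
  · refine Eq.trans ?_ (MemLp.toLp_sub (u.memLp_fn.restrict A) (v.memLp_fn.restrict A))
    exact MemLp.toLp_congr ((u - v).memLp_fn.restrict A)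
      ((u.memLp_fn.restrict A).sub (v.memLp_fn.restrict A)) (ae_restrict_of_ae (H1.fn_sub_ae u v))
  · refine Eq.trans ?_ (MemLp.toLp_sub (u.memLp_grad.restrict A) (v.memLp_grad.restrict A))
    exact MemLp.toLp_congr ((u - v).memLp_grad.restrict A)
      ((u.memLp_grad.restrict A).sub (v.memLp_grad.restrict A))
      (ae_restrict_of_ae (H1.grad_sub_ae u v))

lemma integrable_energyDensity (u : H1 N) :
    Integrable (fun x => ‖u.grad x‖ ^ 2 + u.fn x ^ 2) :=
  (integrable_norm_sq u.memLp_grad).add (integrable_sq u.memLp_fn)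

/-- Writing the local norm as the norm of a vector in a Hilbert space makes its triangle inequality
available. -/
lemma h1NormOn_eq (A : Set (E N)) (u : H1 N) : h1NormOn A u = ‖restrictPair A u‖ := by
  rw [h1NormOn, WithLp.prod_norm_eq_of_L2]
  congr 1
  change _ = ‖(u.memLp_fn.restrict A).toLp u.fn‖ ^ 2 + ‖(u.memLp_grad.restrict A).toLp u.grad‖ ^ 2
  rw [toLp_norm_sq, toLp_norm_sq, integral_add (integrable_norm_sq u.memLp_grad).restrict
    (integrable_sq u.memLp_fn).restrict, add_comm]
  simp

lemma h1NormOn_nonneg (A : Set (E N)) (u : H1 N) : 0 ≤ h1NormOn A u := Real.sqrt_nonneg _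

lemma h1NormOn_le_add (A : Set (E N)) (u v : H1 N) :
    h1NormOn A u ≤ h1NormOn A v + h1NormOn A (u - v) := by
  rw [h1NormOn_eq, h1NormOn_eq, h1NormOn_eq, restrictPair_sub]
  have := norm_add_le (restrictPair A v) (restrictPair A u - restrictPair A v)
  rwa [add_sub_cancel] at this

lemma h1NormOn_sub_comm (A : Set (E N)) (u v : H1 N) :
    h1NormOn A (u - v) = h1NormOn A (v - u) := by
  rw [h1NormOn_eq, h1NormOn_eq, restrictPair_sub, restrictPair_sub, norm_sub_rev]

lemma h1NormOn_mono {A B : Set (E N)} (h : A ⊆ B) (u : H1 N) : h1NormOn A u ≤ h1NormOn B u :=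
  Real.sqrt_le_sqrt (setIntegral_mono_set (integrable_energyDensity u).integrableOn
    (Filter.Eventually.of_forall fun x => by positivity) h.eventuallyLE)

lemma h1NormOn_univ (u : H1 N) : h1NormOn univ u = ‖u‖ := by
  rw [h1NormOn, setIntegral_univ, H1.norm_eq, H1.fn_norm_sq, H1.grad_norm_sq,
    integral_add (integrable_norm_sq u.memLp_grad) (integrable_sq u.memLp_fn), add_comm]

lemma h1NormOn_le_norm (A : Set (E N)) (u : H1 N) : h1NormOn A u ≤ ‖u‖ :=
  (h1NormOn_mono (subset_univ A) u).trans (h1NormOn_univ u).le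

lemma h1NormOn_translate {A : Set (E N)} (hA : MeasurableSet A) (q : E N) (u : H1 N) :
    h1NormOn ((fun x => x - q) ⁻¹' A) (translate q u) = h1NormOn A u := by
  have hA' : MeasurableSet ((fun x => x - q) ⁻¹' A) := (measurable_sub_const q) hA
  rw [h1NormOn, h1NormOn, ← integral_indicator hA, ← integral_indicator hA',
    ← integral_sub_right_eq_self (A.indicator _) q]
  congr 1
  refine integral_congr_ae ?_
  filter_upwards [rescale_fn one_ne_zero q u, rescale_grad one_ne_zero q u] with x h1 h2
  rw [inv_one, one_smul] at h1 h2
  rw [one_smul] at h2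
  by_cases hx : x - q ∈ A
  · rw [indicator_of_mem hx, indicator_of_mem (show x ∈ (fun x => x - q) ⁻¹' A from hx),
      translate, h1, h2]
  · rw [indicator_of_notMem hx, indicator_of_notMem (show x ∉ (fun x => x - q) ⁻¹' A from hx)]

lemma preimage_sub_closedBall (q : E N) (R : ℝ) :
    (fun x => x - q) ⁻¹' {x | ‖x‖ ≤ R} = Metric.closedBall q R := by
  ext x; simp [dist_eq_norm]

lemma measurableSet_norm_le (R : ℝ) : MeasurableSet {x : E N | ‖x‖ ≤ R} :=
  (isClosed_le continuous_norm continuous_const).measurableSet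

/-! ### Difference estimates by duality -/

/-- The inequality `⟨w, f⟩ ≤ c ‖f‖` is a closed condition on `f`, so it passes from the dense class
of test functions to `f = w`. -/
lemma norm_le_of_forall_test {w : Lp ℝ 2 (volume : Measure (E N))} {c : ℝ} (hc : 0 ≤ c)
    (h : ∀ ζ : E N → ℝ, ContDiff ℝ ∞ ζ → HasCompactSupport ζ →
      ∫ x, w x * ζ x ≤ c * Real.sqrt (∫ x, ζ x ^ 2)) : ‖w‖ ≤ c := by
  have hclosed : IsClosed {f : Lp ℝ 2 (volume : Measure (E N)) | inner ℝ w f ≤ c * ‖f‖} :=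
    isClosed_le (continuous_const.inner continuous_id) (continuous_const.mul continuous_norm)
  have hdense := Lp.dense_hasCompactSupport_contDiff (F := ℝ) (μ := (volume : Measure (E N)))
    (p := 2) (by simp)
  have hsub := (hclosed.closure_subset_iff (s :=
    {f : Lp ℝ 2 (volume : Measure (E N)) |
      ∃ g : E N → ℝ, f =ᵐ[volume] g ∧ HasCompactSupport g ∧ ContDiff ℝ ∞ g})).2 (by
    rintro f ⟨g, hfg, hgc, hg⟩
    have h1 := h g hg hgc
    have h2 : ‖f‖ = Real.sqrt (∫ x, g x ^ 2) := by
      rw [← Real.sqrt_sq (norm_nonneg f), l2_norm_sq]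
      congr 1
      refine integral_congr_ae ?_
      filter_upwards [hfg] with x hx
      simp [hx]
    rw [mem_ofPred_eq, h2, integral_inner_coeFn]
    refine le_trans (le_of_eq (integral_congr_ae ?_)) h1
    filter_upwards [hfg] with x hx
    rw [hx])
  have hw : inner ℝ w w ≤ c * ‖w‖ := hsub (hdense w)
  rw [real_inner_self_eq_norm_sq] at hw
  by_contra hcon
  push Not at hcon
  nlinarith [norm_nonneg w]

/-- Differentiation under the integral sign for kernels with locally uniformly bounded support. -/
lemma hasDerivAt_integral_mul {w : E N → ℝ} (hw : MemLp w 2 volume) {K K' : ℝ → E N → ℝ}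
    (hK : Continuous (Function.uncurry K)) (hK' : Continuous (Function.uncurry K'))
    (hd : ∀ t x, HasDerivAt (fun t => K t x) (K' t x) t) {t₀ r ρ : ℝ} (hr : 0 < r)
    (h0 : ∀ t ∈ Metric.closedBall t₀ r, ∀ x, ρ < ‖x‖ → K t x = 0)
    (h0' : ∀ t ∈ Metric.closedBall t₀ r, ∀ x, ρ < ‖x‖ → K' t x = 0) :
    HasDerivAt (fun t => ∫ x, w x * K t x) (∫ x, w x * K' t₀ x) t₀ := by
  have hcomp : IsCompact (Metric.closedBall t₀ r ×ˢ Metric.closedBall (0 : E N) ρ) :=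
    (isCompact_closedBall _ _).prod (isCompact_closedBall _ _)
  obtain ⟨C, hC⟩ := hcomp.exists_bound_of_continuousOn hK'.continuousOn
  have hKt : ∀ t, Continuous (K t) := fun t => hK.comp (Continuous.prodMk_right t)
  have hKt' : ∀ t, Continuous (K' t) := fun t => hK'.comp (Continuous.prodMk_right t)
  have ht₀ : t₀ ∈ Metric.closedBall t₀ r := Metric.mem_closedBall_self hr.le
  have hcs : HasCompactSupport (K t₀) := by
    refine HasCompactSupport.intro (isCompact_closedBall (0 : E N) ρ) fun x hx => h0 t₀ ht₀ x ?_
    simpa using hx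
  refine (hasDerivAt_integral_of_dominated_loc_of_deriv_le (F := fun t x => w x * K t x)
    (F' := fun t x => w x * K' t x)
    (bound := (Metric.closedBall (0 : E N) ρ).indicator fun x => C * |w x|)
    (Metric.closedBall_mem_nhds t₀ hr) ?_ ?_ ?_ ?_ ?_ ?_).2
  · exact Filter.Eventually.of_forall fun t => hw.1.mul (hKt t).aestronglyMeasurable
  · exact hw.integrable_mul ((hKt t₀).memLp_of_hasCompactSupport (p := 2) hcs)
  · exact hw.1.mul (hKt' t₀).aestronglyMeasurable
  · refine Filter.Eventually.of_forall fun x t ht => ?_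
    by_cases hx : ‖x‖ ≤ ρ
    · rw [indicator_of_mem (by simpa using hx), norm_mul, mul_comm, Real.norm_eq_abs (w x)]
      exact mul_le_mul_of_nonneg_right (hC (t, x) ⟨ht, by simpa using hx⟩) (abs_nonneg _)
    · rw [h0' t ht x (not_le.1 hx), indicator_of_notMem (by simpa using hx)]
      simp
  · refine (integrable_indicator_iff measurableSet_closedBall).2 (Integrable.const_mul ?_ C)
    have : IsFiniteMeasure ((volume : Measure (E N)).restrict (Metric.closedBall 0 ρ)) :=
      ⟨by simpa using measure_closedBall_lt_top⟩
    exact ((hw.restrict _).integrable (by norm_num)).abs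
  · exact Filter.Eventually.of_forall fun x t _ => (hd t x).const_mul (w x)

lemma exists_norm_bound_tsupport {ζ : E N → ℝ} (hc : HasCompactSupport ζ) :
    ∃ R : ℝ, 0 ≤ R ∧ ∀ x, R < ‖x‖ → ζ x = 0 ∧ fderiv ℝ ζ x = 0 := by
  obtain ⟨R, hR⟩ := hc.isCompact.isBounded.subset_closedBall (0 : E N)
  have hx : ∀ x, max R 0 < ‖x‖ → x ∉ tsupport ζ := by
    intro x hx hmem
    have := hR hmem
    rw [mem_closedBall_zero_iff] at this
    linarith [le_max_left R 0]
  refine ⟨max R 0, le_max_right _ _, fun x hR => ⟨image_eq_zero_of_notMem_tsupport (hx x hR), ?_⟩⟩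
  by_contra hne
  exact hx x hR (support_fderiv_subset ℝ (Function.mem_support.2 hne))

lemma integral_mul_le_of_memLp {w ζ : E N → ℝ} (hw : MemLp w 2 volume) (hζ : MemLp ζ 2 volume) :
    |∫ x, ζ x * w x| ≤ Real.sqrt (∫ x, ζ x ^ 2) * Real.sqrt (∫ x, w x ^ 2) := by
  have := abs_integral_inner_le hw hζ
  simpa [mul_comm] using this

/-- By duality the translation is moved onto the test function. Along the path `t ↦ ζ(· + t z)` the
pairing with `w` has a derivative controlled by the weak gradient, and the mean value inequality
concludes. -/
lemma translate_sub_norm_le (w : H1 N) (z : E N) :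
    ‖(translate z w - w).fn‖ ≤ ‖z‖ * ‖w.grad‖ := by
  refine norm_le_of_forall_test (by positivity) fun ζ hζ hc => ?_
  have hζm : MemLp ζ 2 volume := hζ.continuous.memLp_of_hasCompactSupport hc
  obtain ⟨R, hR0, hR⟩ := exists_norm_bound_tsupport hc
  set K : ℝ → E N → ℝ := fun t x => ζ (x + t • z) with hKdef
  set K' : ℝ → E N → ℝ := fun t x => fderiv ℝ ζ (x + t • z) z with hK'def
  have hKc : ∀ t, HasCompactSupport (K t) := fun t =>
    hc.comp_homeomorph (Homeomorph.addRight (t • z))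
  have hKs : ∀ t, ContDiff ℝ ∞ (K t) := fun t => by simp only [hKdef]; fun_prop
  have hKm : ∀ t, MemLp (K t) 2 volume := fun t =>
    (hKs t).continuous.memLp_of_hasCompactSupport (hKc t)
  have hfar : ∀ t₀ : ℝ, ∀ t ∈ Metric.closedBall t₀ 1, ∀ x : E N,
      R + (|t₀| + 1) * ‖z‖ < ‖x‖ → R < ‖x + t • z‖ := by
    intro t₀ t ht x hx
    have h1 : |t| ≤ |t₀| + 1 := by
      rw [Metric.mem_closedBall, Real.dist_eq] at ht
      have := abs_add_le (t - t₀) t₀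
      rw [sub_add_cancel] at this
      linarith
    have h2 := norm_sub_norm_le x (-(t • z))
    rw [sub_neg_eq_add, norm_neg, norm_smul, Real.norm_eq_abs] at h2
    have := mul_le_mul_of_nonneg_right h1 (norm_nonneg z)
    linarith
  have hderiv : ∀ t₀ : ℝ, HasDerivAt (fun t => ∫ x, w.fn x * K t x)
      (∫ x, w.fn x * K' t₀ x) t₀ := by
    intro t₀
    refine hasDerivAt_integral_mul w.memLp_fn (K := K) (K' := K') ?_ ?_ ?_ one_pos
      (ρ := R + (|t₀| + 1) * ‖z‖) ?_ ?_
    · exact hζ.continuous.comp (by fun_prop)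
    · exact ((hζ.continuous_fderiv (by simp)).comp (by fun_prop)).clm_apply continuous_const
    · intro t x
      have h1 : HasDerivAt (fun t : ℝ => x + t • z) z t := by
        simpa using ((hasDerivAt_id t).smul_const z).const_add x
      exact (hζ.differentiable (by simp) (x + t • z)).hasFDerivAt.comp_hasDerivAt t h1
    · intro t ht x hx
      exact (hR _ (hfar t₀ t ht x hx)).1
    · intro t ht x hx
      simp only [hK'def, (hR _ (hfar t₀ t ht x hx)).2, _root_.zero_apply]
  have hKint : ∀ t, ∫ x, K t x ^ 2 = ∫ x, ζ x ^ 2 := fun t =>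
    integral_add_right_eq_self (fun x => ζ x ^ 2) (t • z)
  have hbound : ∀ t, ‖∫ x, w.fn x * K' t x‖ ≤ ‖z‖ * ‖w.grad‖ * Real.sqrt (∫ x, ζ x ^ 2) := by
    intro t
    have h1 : ∫ x, w.fn x * K' t x = - ∫ x, K t x * inner ℝ (w.grad x) z := by
      rw [← w.isWeakGradient (K t) (hKs t) (hKc t) z]
      refine integral_congr_ae (Filter.Eventually.of_forall fun x => ?_)
      simp only [hK'def, hKdef]
      rw [fderiv_comp_add_right]
    have hm : MemLp (fun x => inner ℝ (w.grad x) z) 2 volume := w.memLp_grad.inner_const z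
    have h2 := integral_mul_le_of_memLp hm (hKm t)
    rw [h1, norm_neg, Real.norm_eq_abs]
    refine h2.trans ?_
    rw [hKint, mul_comm]
    refine mul_le_mul_of_nonneg_right ?_ (Real.sqrt_nonneg _)
    refine Real.sqrt_le_iff.2 ⟨by positivity, ?_⟩
    rw [mul_pow, H1.grad_norm_sq, ← integral_const_mul]
    refine integral_mono (integrable_sq hm) ((integrable_norm_sq w.memLp_grad).const_mul _)
      fun x => ?_
    rw [← sq_abs, ← mul_pow, mul_comm]
    exact pow_le_pow_left₀ (abs_nonneg _) (abs_real_inner_le_norm _ _) 2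
  have hmv := (convex_univ (𝕜 := ℝ) (E := ℝ)).norm_image_sub_le_of_norm_hasDerivWithin_le
    (fun t _ => (hderiv t).hasDerivWithinAt) (fun t _ => hbound t) (mem_univ 0) (mem_univ 1)
  rw [sub_zero, norm_one, mul_one] at hmv
  refine le_trans (le_of_eq ?_) ((le_abs_self _).trans hmv)
  have i1 : Integrable (fun x => w.fn x * K 0 x) := w.memLp_fn.integrable_mul (hKm 0)
  have i2 : Integrable (fun x => (translate z w).fn x * ζ x) :=
    (translate z w).memLp_fn.integrable_mul hζm
  have e1 : ∫ x, w.fn x * K 1 x = ∫ x, (translate z w).fn x * ζ x := by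
    rw [← integral_sub_right_eq_self _ z]
    refine integral_congr_ae ?_
    filter_upwards [rescale_fn one_ne_zero z w] with x hx
    rw [inv_one, one_smul] at hx
    rw [translate, hx]
    simp [hKdef]
  rw [e1, ← integral_sub i2 i1]
  refine integral_congr_ae ?_
  filter_upwards [H1.fn_sub_ae (translate z w) w] with x hx
  rw [hx]
  simp [hKdef, sub_mul]

/-- The weak divergence identity for the vector field `x ↦ φ(x) x`. -/
lemma integral_mul_divergence (w : H1 N) {φ : E N → ℝ} (hφ : ContDiff ℝ ∞ φ)
    (hc : HasCompactSupport φ) :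
    ∫ x, w.fn x * (N * φ x + fderiv ℝ φ x x) = - ∫ x, φ x * inner ℝ (w.grad x) x := by
  set e : Fin N → E N := fun i => EuclideanSpace.single i (1 : ℝ)
  have hsum : ∀ x : E N, ∑ i, x i • e i = x := by
    intro x
    have := (EuclideanSpace.basisFun (Fin N) ℝ).sum_repr x
    simpa using this
  have hco : ∀ i, ContDiff ℝ ∞ (fun x : E N => x i) := fun i =>
    (EuclideanSpace.proj (𝕜 := ℝ) i).contDiff
  have hs : ∀ i, ContDiff ℝ ∞ (fun x : E N => x i * φ x) := fun i => (hco i).mul hφ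
  have hcs : ∀ i, HasCompactSupport (fun x : E N => x i * φ x) := fun i => hc.mul_left
  -- The identity is the sum over `i` of the weak derivative in direction `e i` tested against `x i
  -- * φ x`.
  have key := fun i => w.isWeakGradient _ (hs i) (hcs i) (e i)
  have hd : ∀ i x, fderiv ℝ (fun x : E N => x i * φ x) x (e i) =
      φ x + x i * fderiv ℝ φ x (e i) := by
    intro i x
    have h1 : HasFDerivAt (fun x : E N => x i) (EuclideanSpace.proj (𝕜 := ℝ) i) x :=
      (EuclideanSpace.proj (𝕜 := ℝ) i).hasFDerivAt
    rw [fderiv_fun_mul h1.differentiableAt (hφ.differentiable (by simp) x), h1.fderiv]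
    simp [e, add_comm]
  have e1 : ∫ x, w.fn x * (N * φ x + fderiv ℝ φ x x) =
      ∑ i, ∫ x, w.fn x * fderiv ℝ (fun x : E N => x i * φ x) x (e i) := by
    rw [← integral_finsetSum _ fun i _ => integrable_mul_test w.memLp_fn (hs i) (hcs i) (e i)]
    refine integral_congr_ae (Filter.Eventually.of_forall fun x => ?_)
    simp only [hd]
    rw [← Finset.mul_sum, Finset.sum_add_distrib]
    simp only [Finset.sum_const, Finset.card_univ, Fintype.card_fin, nsmul_eq_mul]
    congr 2
    conv_lhs => rw [← hsum x]
    rw [map_sum]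
    refine Finset.sum_congr rfl fun i _ => ?_
    rw [map_smul, smul_eq_mul, hsum]
  have e2 : ∫ x, φ x * inner ℝ (w.grad x) x =
      ∑ i, ∫ x, x i * φ x * inner ℝ (w.grad x) (e i) := by
    rw [← integral_finsetSum _ fun i _ => integrable_test_inner w.memLp_grad (hs i) (hcs i) (e i)]
    refine integral_congr_ae (Filter.Eventually.of_forall fun x => ?_)
    simp only
    have : inner ℝ (w.grad x) x = ∑ i, x i * inner ℝ (w.grad x) (e i) := by
      conv_lhs => rw [← hsum x]
      rw [inner_sum]
      refine Finset.sum_congr rfl fun i _ => ?_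
      rw [real_inner_smul_right, hsum]
    rw [this, Finset.mul_sum]
    refine Finset.sum_congr rfl fun i _ => ?_
    ring
  rw [e1, e2, ← Finset.sum_neg_distrib]
  exact Finset.sum_congr rfl fun i _ => key i

/-- This is the duality argument for translations, applied to dilations, whose generator is `x · ∇`.
The `t`-derivative of `t ^ N ζ(t x)` is `t ^ (N - 1)` times the divergence of `ζ(t x) x`, so
`integral_mul_divergence` turns the pairing with `w` into one with `x · ∇w`. -/
lemma rescale_sub_norm_le (hN : N ≠ 0) (w : H1 N)
    (hx : MemLp (fun x => inner ℝ (w.grad x) x) 2 volume) {s : ℝ} (hs : s ∈ Icc (1 / 2 : ℝ) 2) :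
    ‖(rescale s 0 w - w).fn‖ ≤
      4 ^ N * Real.sqrt (∫ x, inner ℝ (w.grad x) x ^ 2) * |s - 1| := by
  refine norm_le_of_forall_test (by positivity) fun ζ hζ hc => ?_
  have hζm : MemLp ζ 2 volume := hζ.continuous.memLp_of_hasCompactSupport hc
  obtain ⟨R, hR0, hR⟩ := exists_norm_bound_tsupport hc
  -- The Jacobian `t ^ N` makes the pairing of `w` with `K t` equal to the pairing of `w(·/t)` with
  -- `ζ`.
  set K : ℝ → E N → ℝ := fun t x => t ^ N * ζ (t • x) with hKdef
  set K' : ℝ → E N → ℝ := fun t x =>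
    N * t ^ (N - 1) * ζ (t • x) + t ^ N * fderiv ℝ ζ (t • x) x with hK'def
  have hpow : ∀ t : ℝ, t ^ N = t ^ (N - 1) * t := fun t => (pow_sub_one_mul hN t).symm
  have hsc : ∀ t : ℝ, t ≠ 0 → HasCompactSupport (fun x => ζ (t • x)) := fun t ht =>
    hc.comp_homeomorph (Homeomorph.smulOfNeZero t ht)
  have hss : ∀ t : ℝ, ContDiff ℝ ∞ (fun x => ζ (t • x)) := fun t => by fun_prop
  have hfar : ∀ t₀ ∈ Icc (1 / 2 : ℝ) 2, ∀ t ∈ Metric.closedBall t₀ (1 / 4), ∀ x : E N,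
      4 * R < ‖x‖ → R < ‖t • x‖ := by
    intro t₀ h₀ t ht x hx
    rw [Metric.mem_closedBall, Real.dist_eq, abs_le] at ht
    have h1 : 1 / 4 ≤ t := by linarith [h₀.1]
    rw [norm_smul, Real.norm_of_nonneg (by linarith)]
    nlinarith [norm_nonneg x]
  have hderiv : ∀ t₀ ∈ Icc (1 / 2 : ℝ) 2, HasDerivAt (fun t => ∫ x, w.fn x * K t x)
      (∫ x, w.fn x * K' t₀ x) t₀ := by
    intro t₀ h₀
    refine hasDerivAt_integral_mul w.memLp_fn (K := K) (K' := K') ?_ ?_ ?_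
      (by norm_num : (0 : ℝ) < 1 / 4) (ρ := 4 * R) ?_ ?_
    · have h1 : Continuous fun p : ℝ × E N => ζ (p.1 • p.2) := hζ.continuous.comp (by fun_prop)
      exact (continuous_fst.pow N).mul h1
    · have h1 : Continuous fun p : ℝ × E N => ζ (p.1 • p.2) := hζ.continuous.comp (by fun_prop)
      have h2 : Continuous fun p : ℝ × E N => fderiv ℝ ζ (p.1 • p.2) p.2 :=
        ((hζ.continuous_fderiv (by simp)).comp (by fun_prop)).clm_apply continuous_snd
      exact ((continuous_const.mul (continuous_fst.pow (N - 1))).mul h1).add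
        ((continuous_fst.pow N).mul h2)
    · intro t x
      have h1 : HasDerivAt (fun t : ℝ => t • x) x t := by
        simpa using (hasDerivAt_id t).smul_const x
      exact (hasDerivAt_pow N t).mul
        ((hζ.differentiable (by simp) (t • x)).hasFDerivAt.comp_hasDerivAt t h1)
    · intro t ht x hx
      simp only [hKdef, (hR _ (hfar t₀ h₀ t ht x hx)).1, mul_zero]
    · intro t ht x hx
      simp only [hK'def, (hR _ (hfar t₀ h₀ t ht x hx)).1, (hR _ (hfar t₀ h₀ t ht x hx)).2,
        _root_.zero_apply, mul_zero, add_zero]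
  set M := Real.sqrt (∫ x, inner ℝ (w.grad x) x ^ 2)
  set Z := Real.sqrt (∫ x, ζ x ^ 2)
  have hbound : ∀ t ∈ Icc (1 / 2 : ℝ) 2, ‖∫ x, w.fn x * K' t x‖ ≤ 4 ^ N * M * Z := by
    intro t ht
    have htpos : 0 < t := by linarith [ht.1]
    have h1 : ∫ x, w.fn x * K' t x = - (t ^ (N - 1) * ∫ x, ζ (t • x) * inner ℝ (w.grad x) x) := by
      have := integral_mul_divergence w (hss t) (hsc t htpos.ne')
      rw [← mul_neg, ← this, ← integral_const_mul]
      refine integral_congr_ae (Filter.Eventually.of_forall fun x => ?_)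
      have hd : fderiv ℝ (fun x => ζ (t • x)) x x = t * fderiv ℝ ζ (t • x) x := by
        rw [fderiv_comp_smul]; simp
      simp only [hK'def]
      rw [hd, hpow]
      ring
    have hm2 : MemLp (fun x => ζ (t • x)) 2 volume :=
      (hss t).continuous.memLp_of_hasCompactSupport (hsc t htpos.ne')
    have h2 := integral_mul_le_of_memLp hx hm2
    -- The sharp factor is `t⁻¹ ^ N ≤ 2 ^ N`; it is enlarged to a square so that the root below is
    -- explicit.
    have h3 : ∫ x, ζ (t • x) ^ 2 ≤ (2 ^ N) ^ 2 * ∫ x, ζ x ^ 2 := by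
      have := integral_comp_affine_of_pos (fun x => ζ x ^ 2) (inv_pos.2 htpos) (0 : E N)
      simp only [inv_inv, sub_zero] at this
      rw [this]
      refine mul_le_mul_of_nonneg_right ?_ (integral_nonneg fun x => sq_nonneg _)
      have h4 : t⁻¹ ≤ 2 := by
        rw [inv_le_comm₀ htpos two_pos]; linarith [ht.1]
      calc t⁻¹ ^ N ≤ 2 ^ N := pow_le_pow_left₀ (by positivity) h4 N
        _ ≤ (2 ^ N) ^ 2 := by
          have : (1 : ℝ) ≤ 2 ^ N := one_le_pow₀ (by norm_num)
          nlinarith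
    have h5 : Real.sqrt (∫ x, ζ (t • x) ^ 2) ≤ 2 ^ N * Z := by
      refine (Real.sqrt_le_sqrt h3).trans (le_of_eq ?_)
      rw [Real.sqrt_mul (by positivity), Real.sqrt_sq (by positivity)]
    have h6 : t ^ (N - 1) ≤ 2 ^ N :=
      (pow_le_pow_left₀ htpos.le ht.2 _).trans
        (pow_le_pow_right₀ (by norm_num) (Nat.sub_le N 1))
    rw [h1, norm_neg, norm_mul, Real.norm_of_nonneg (by positivity), Real.norm_eq_abs]
    calc t ^ (N - 1) * |∫ x, ζ (t • x) * inner ℝ (w.grad x) x|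
        ≤ 2 ^ N * ((2 ^ N * Z) * M) := by
          refine mul_le_mul h6 (h2.trans ?_) (abs_nonneg _) (by positivity)
          exact mul_le_mul_of_nonneg_right h5 (Real.sqrt_nonneg _)
      _ = 4 ^ N * M * Z := by
          rw [show (4 : ℝ) = 2 * 2 by norm_num, mul_pow]; ring
  have hmv := (convex_Icc (1 / 2 : ℝ) 2).norm_image_sub_le_of_norm_hasDerivWithin_le
    (fun t ht => (hderiv t ht).hasDerivWithinAt) (fun t ht => hbound t ht)
    (show (1 : ℝ) ∈ Icc (1 / 2 : ℝ) 2 by constructor <;> norm_num) hs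
  rw [Real.norm_eq_abs (s - 1)] at hmv
  have hspos : 0 < s := by linarith [hs.1]
  have hKm : ∀ t : ℝ, t ≠ 0 → MemLp (K t) 2 volume := fun t ht =>
    (((hss t).continuous.memLp_of_hasCompactSupport (hsc t ht)).const_mul (t ^ N))
  have i1 : Integrable (fun x => w.fn x * K 1 x) := w.memLp_fn.integrable_mul (hKm 1 one_ne_zero)
  have i2 : Integrable (fun x => (rescale s 0 w).fn x * ζ x) :=
    (rescale s 0 w).memLp_fn.integrable_mul hζm
  have e1 : ∫ x, w.fn x * K s x = ∫ x, (rescale s 0 w).fn x * ζ x := by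
    have := integral_comp_affine_of_pos (fun x => w.fn x * ζ (s • x)) hspos (0 : E N)
    have e2 : ∫ x, w.fn x * K s x = s ^ N * ∫ x, w.fn x * ζ (s • x) := by
      rw [← integral_const_mul]
      refine integral_congr_ae (Filter.Eventually.of_forall fun x => ?_)
      simp only [hKdef]; ring
    rw [e2, ← this]
    refine integral_congr_ae ?_
    filter_upwards [rescale_fn hspos.ne' 0 w] with x hx
    rw [hx, sub_zero, smul_smul, mul_inv_cancel₀ hspos.ne', one_smul]
  calc ∫ x, (rescale s 0 w - w).fn x * ζ x = (∫ x, w.fn x * K s x) - ∫ x, w.fn x * K 1 x := by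
        rw [e1, ← integral_sub i2 i1]
        refine integral_congr_ae ?_
        filter_upwards [H1.fn_sub_ae (rescale s 0 w) w] with x hx
        rw [hx]
        simp [hKdef, sub_mul]
    _ ≤ 4 ^ N * M * Z * |s - 1| := (le_abs_self _).trans hmv
    _ = 4 ^ N * M * |s - 1| * Z := by ring

/-! ### Concentration on sets of small measure -/

/-- An `H¹` function has little mass on sets of small measure. -/
lemma setIntegral_sq_le (w : H1 N) {A : Set (E N)} (hA : volume A ≠ ⊤)
    {r : ℝ} (hr : 0 < r) :
    ∫ x in A, w.fn x ^ 2 ≤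
      2 * (volume A).toReal / (volume (Metric.ball (0 : E N) r)).toReal * ‖w.fn‖ ^ 2 +
        2 * r ^ 2 * ‖w.grad‖ ^ 2 := by
  set B := Metric.ball (0 : E N) r
  have hB0 : volume B ≠ 0 := (Metric.measure_ball_pos volume _ hr).ne'
  have hBt : volume B ≠ ⊤ := measure_ball_lt_top.ne
  have hBpos : 0 < (volume B).toReal := ENNReal.toReal_pos hB0 hBt
  set W : E N → ℝ≥0∞ := fun x => ENNReal.ofReal (w.fn x ^ 2) with hW
  have hWm : Measurable W :=
    (((Lp.stronglyMeasurable w.fn).measurable.pow_const 2)).ennreal_ofReal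
  have hsq : Integrable (fun x => w.fn x ^ 2) := integrable_sq w.memLp_fn
  -- On `A`, compare `w` with each translate by `z` in the small ball `B`; the translation error
  -- costs `r² ‖∇w‖²`. Averaging over `z` then spreads the mass.
  have hz : ∀ z ∈ B, ∫⁻ x in A, W x ≤
      2 * (∫⁻ x in A, W (x - z)) + ENNReal.ofReal (2 * r ^ 2 * ‖w.grad‖ ^ 2) := by
    intro z hz
    have hzr : ‖z‖ ≤ r := by
      have := mem_ball_zero_iff.1 hz
      exact this.le
    have h1 := pow_le_pow_left₀ (norm_nonneg _) (translate_sub_norm_le w z) 2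
    rw [H1.fn_norm_sq] at h1
    have isub : Integrable (fun x => (w.fn (x - z)) ^ 2) := hsq.comp_sub_right z
    have h2 : ∫ x in A, w.fn x ^ 2 ≤ 2 * (∫ x in A, w.fn (x - z) ^ 2) + 2 * r ^ 2 * ‖w.grad‖ ^ 2 := by
      have j1 : Integrable (fun x => (translate z w - w).fn x ^ 2) :=
        integrable_sq (translate z w - w).memLp_fn
      have h3 : ∫ x in A, w.fn x ^ 2 ≤
          ∫ x in A, (2 * w.fn (x - z) ^ 2 + 2 * (translate z w - w).fn x ^ 2) := by
        refine setIntegral_mono_ae hsq.integrableOn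
          ((isub.const_mul 2).add (j1.const_mul 2)).integrableOn ?_
        filter_upwards [H1.fn_sub_ae (translate z w) w, rescale_fn one_ne_zero z w] with x hx hx'
        rw [inv_one, one_smul] at hx'
        rw [hx, translate, hx']
        nlinarith [sq_nonneg (2 * w.fn (x - z) - w.fn x)]
      rw [integral_add (isub.const_mul 2).integrableOn (j1.const_mul 2).integrableOn,
        integral_const_mul, integral_const_mul] at h3
      have h4 : ∫ x in A, (translate z w - w).fn x ^ 2 ≤ ∫ x, (translate z w - w).fn x ^ 2 :=
        setIntegral_le_integral j1 (Filter.Eventually.of_forall fun x => sq_nonneg _)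
      have h5 : (‖z‖ * ‖w.grad‖) ^ 2 ≤ r ^ 2 * ‖w.grad‖ ^ 2 := by
        rw [mul_pow]
        exact mul_le_mul_of_nonneg_right (pow_le_pow_left₀ (norm_nonneg _) hzr 2) (sq_nonneg _)
      linarith
    have k1 : ∫⁻ x in A, W x = ENNReal.ofReal (∫ x in A, w.fn x ^ 2) :=
      (ofReal_integral_eq_lintegral_ofReal hsq.integrableOn
        (Filter.Eventually.of_forall fun x => sq_nonneg _)).symm
    have k2 : ∫⁻ x in A, W (x - z) = ENNReal.ofReal (∫ x in A, w.fn (x - z) ^ 2) :=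
      (ofReal_integral_eq_lintegral_ofReal isub.integrableOn
        (Filter.Eventually.of_forall fun x => sq_nonneg _)).symm
    have htwo : 2 * ENNReal.ofReal (∫ x in A, w.fn (x - z) ^ 2) =
        ENNReal.ofReal (2 * ∫ x in A, w.fn (x - z) ^ 2) := by
      rw [ENNReal.ofReal_mul (by norm_num), ENNReal.ofReal_ofNat]
    rw [k1, k2, htwo, ← ENNReal.ofReal_add (mul_nonneg (by norm_num)
        (integral_nonneg fun x => sq_nonneg _)) (by positivity)]
    exact ENNReal.ofReal_le_ofReal h2
  have hmass : ∫⁻ x, W x = ENNReal.ofReal (‖w.fn‖ ^ 2) := by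
    rw [H1.fn_norm_sq]
    exact (ofReal_integral_eq_lintegral_ofReal hsq
      (Filter.Eventually.of_forall fun x => sq_nonneg _)).symm
  -- By Tonelli, the inner integral over `z` is at most the whole mass for each `x`, and only the
  -- measure of `A` remains. This takes the place of a Sobolev embedding.
  have hswap : ∫⁻ z in B, ∫⁻ x in A, W (x - z) ≤ volume A * ENNReal.ofReal (‖w.fn‖ ^ 2) := by
    rw [lintegral_lintegral_swap]
    · calc ∫⁻ x in A, ∫⁻ z in B, W (x - z) ≤ ∫⁻ _x in A, ENNReal.ofReal (‖w.fn‖ ^ 2) := by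
            refine lintegral_mono fun x => ?_
            refine (setLIntegral_le_lintegral _ _).trans (le_of_eq ?_)
            rw [lintegral_sub_left_eq_self, hmass]
        _ = volume A * ENNReal.ofReal (‖w.fn‖ ^ 2) := by rw [setLIntegral_const, mul_comm]
    · exact (hWm.comp (measurable_snd.sub measurable_fst)).aemeasurable
  have hmain : (∫⁻ x in A, W x) * volume B ≤
      2 * (volume A * ENNReal.ofReal (‖w.fn‖ ^ 2)) +
        ENNReal.ofReal (2 * r ^ 2 * ‖w.grad‖ ^ 2) * volume B := by
    rw [← setLIntegral_const, ← setLIntegral_const]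
    refine (setLIntegral_mono' measurableSet_ball hz).trans ?_
    rw [lintegral_add_right _ measurable_const]
    refine add_le_add ?_ le_rfl
    rw [lintegral_const_mul' _ _ (by simp)]
    exact mul_le_mul_right hswap 2
  have k1 : ∫⁻ x in A, W x = ENNReal.ofReal (∫ x in A, w.fn x ^ 2) :=
    (ofReal_integral_eq_lintegral_ofReal hsq.integrableOn
      (Filter.Eventually.of_forall fun x => sq_nonneg _)).symm
  rw [k1] at hmain
  have hfin : 2 * (volume A * ENNReal.ofReal (‖w.fn‖ ^ 2)) +
        ENNReal.ofReal (2 * r ^ 2 * ‖w.grad‖ ^ 2) * volume B ≠ ⊤ := by finiteness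
  have hreal := ENNReal.toReal_mono hfin hmain
  rw [ENNReal.toReal_add (by finiteness) (by finiteness)] at hreal
  simp only [ENNReal.toReal_mul, ENNReal.toReal_ofNat] at hreal
  rw [ENNReal.toReal_ofReal (integral_nonneg fun x => sq_nonneg _),
    ENNReal.toReal_ofReal (by positivity), ENNReal.toReal_ofReal (by positivity)] at hreal
  rw [← mul_le_mul_iff_left₀ hBpos]
  refine hreal.trans (le_of_eq ?_)
  field_simp

/-! ### Bounded nonlinearities on `L²` -/

/-- A bounded, uniformly continuous nonlinearity that is superlinear at the origin. -/
structure TameNonlinearity (h : ℝ → ℝ) : Prop where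
  uniformContinuous : UniformContinuous h
  bounded : ∃ B, ∀ ξ, |h ξ| ≤ B
  superlinear : ∀ κ > 0, ∃ τ > 0, ∀ ξ, |ξ| ≤ τ → |h ξ| ≤ κ * |ξ|

/-- The primitive vanishing at the origin. -/
noncomputable def primitive (h : ℝ → ℝ) (ξ : ℝ) : ℝ := ∫ τ in (0 : ℝ)..ξ, h τ

namespace TameNonlinearity

variable {h : ℝ → ℝ} (hh : TameNonlinearity h)
include hh

lemma exists_linear_bound : ∃ C, 0 ≤ C ∧ ∀ ξ, |h ξ| ≤ C * |ξ| := by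
  obtain ⟨τ, hτ, hb⟩ := hh.superlinear 1 one_pos
  obtain ⟨B, hB⟩ := hh.bounded
  have hB0 : 0 ≤ B := (abs_nonneg _).trans (hB 0)
  refine ⟨1 + B / τ, by positivity, fun ξ => ?_⟩
  by_cases hξ : |ξ| ≤ τ
  · refine (hb ξ hξ).trans (mul_le_mul_of_nonneg_right ?_ (abs_nonneg _))
    have : 0 ≤ B / τ := by positivity
    linarith
  · push Not at hξ
    have : B ≤ B / τ * |ξ| := by
      rw [div_mul_eq_mul_div, le_div_iff₀ hτ]
      exact mul_le_mul_of_nonneg_left hξ.le hB0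
    nlinarith [hB ξ, abs_nonneg ξ]

/-- For large `d`, boundedness suffices. For small `d`, superlinearity at the origin handles small
`u`, and uniform continuity handles the rest. -/
lemma exists_modulus {κ : ℝ} (hκ : 0 < κ) :
    ∃ C, 0 ≤ C ∧ ∀ u d, |h (u + d) - h u| ≤ κ * |u| + C * |d| := by
  obtain ⟨τ, hτ, hb⟩ := hh.superlinear (κ / 2) (by positivity)
  obtain ⟨B, hB⟩ := hh.bounded
  have hB0 : 0 ≤ B := (abs_nonneg _).trans (hB 0)
  -- The tolerance is used only when `|u| > τ / 2`, where it is at most `κ |u|`.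
  obtain ⟨δ, hδ, hu⟩ := Metric.uniformContinuous_iff.1 hh.uniformContinuous (κ * (τ / 2))
    (by positivity)
  set r := min δ (τ / 2) with hr
  have hr0 : 0 < r := lt_min hδ (by positivity)
  refine ⟨2 * B / r + κ, by positivity, fun u d => ?_⟩
  have habs : |h (u + d) - h u| ≤ |h (u + d)| + |h u| := abs_sub _ _
  have hCd : 0 ≤ 2 * B / r * |d| := by positivity
  have hκd : 0 ≤ κ * |d| := by positivity
  have hκu : 0 ≤ κ * |u| := by positivity
  by_cases hd : r ≤ |d|
  · have : 2 * B ≤ 2 * B / r * |d| := by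
      rw [div_mul_eq_mul_div, le_div_iff₀ hr0]
      exact mul_le_mul_of_nonneg_left hd (by positivity)
    have h1 := hB (u + d)
    have h2 := hB u
    linarith
  · push Not at hd
    by_cases hu' : |u| ≤ τ / 2
    · have hud : |u + d| ≤ |u| + |d| := abs_add_le _ _
      have h1 := hb (u + d) (by linarith [min_le_right δ (τ / 2)])
      have h2 := hb u (by linarith)
      nlinarith
    · push Not at hu'
      have h1 := hu (a := u + d) (b := u) (by
        rw [Real.dist_eq, add_sub_cancel_left]; exact hd.trans_le (min_le_left _ _))
      rw [Real.dist_eq] at h1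
      nlinarith

lemma abs_primitive_taylor_le {κ C : ℝ} (hC0 : 0 ≤ C)
    (hC : ∀ u d, |h (u + d) - h u| ≤ κ * |u| + C * |d|) (u d : ℝ) :
    |primitive h (u + d) - primitive h u - h u * d| ≤ κ * (|u| * |d|) + C * d ^ 2 := by
  have hi : ∀ a b : ℝ, IntervalIntegrable h volume a b := fun a b =>
    hh.uniformContinuous.continuous.intervalIntegrable a b
  have h1 : primitive h (u + d) - primitive h u = ∫ τ in u..(u + d), h τ :=
    intervalIntegral.integral_interval_sub_left (hi _ _) (hi _ _)
  have h2 : primitive h (u + d) - primitive h u - h u * d =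
      ∫ τ in u..(u + d), (h τ - h u) := by
    rw [h1, intervalIntegral.integral_sub (hi _ _) (by simp), intervalIntegral.integral_const]
    simp [mul_comm]
  have h3 := intervalIntegral.norm_integral_le_of_norm_le_const (a := u) (b := u + d)
    (f := fun τ => h τ - h u) (C := κ * |u| + C * |d|) (fun x hx => by
      have h4 := hC u (x - u)
      rw [add_sub_cancel] at h4
      refine h4.trans (add_le_add le_rfl (mul_le_mul_of_nonneg_left ?_ hC0))
      have := abs_sub_left_of_mem_uIcc (uIoc_subset_uIcc hx)
      rwa [add_sub_cancel_left] at this)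
  rw [h2]
  refine h3.trans (le_of_eq ?_)
  rw [add_sub_cancel_left, add_mul, mul_assoc, mul_assoc, ← sq, sq_abs]

lemma exists_primitive_bound : ∃ C, 0 ≤ C ∧ ∀ ξ, |primitive h ξ| ≤ C * ξ ^ 2 := by
  obtain ⟨C, hC0, hC⟩ := hh.exists_linear_bound
  refine ⟨C, hC0, fun ξ => ?_⟩
  have h3 := intervalIntegral.norm_integral_le_of_norm_le_const (a := 0) (b := ξ)
    (f := h) (C := C * |ξ|) (fun x hx => by
      refine (hC x).trans (mul_le_mul_of_nonneg_left ?_ hC0)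
      have := abs_sub_left_of_mem_uIcc (uIoc_subset_uIcc hx)
      rwa [sub_zero, sub_zero] at this)
  refine h3.trans (le_of_eq ?_)
  rw [sub_zero, mul_assoc, ← sq, sq_abs]

lemma continuous_primitive : Continuous (primitive h) :=
  intervalIntegral.continuous_primitive
    (fun a b => hh.uniformContinuous.continuous.intervalIntegrable a b) 0

lemma integrable_primitive {u : E N → ℝ} (hu : MemLp u 2 volume) :
    Integrable (fun x => primitive h (u x)) := by
  obtain ⟨C, -, hC⟩ := hh.exists_primitive_bound
  refine ((integrable_sq hu).const_mul C).mono' (hh.continuous_primitive.comp_aestronglyMeasurable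
    hu.1) (Filter.Eventually.of_forall fun x => hC (u x))

lemma memLp_comp {u : E N → ℝ} (hu : MemLp u 2 volume) :
    MemLp (fun x => h (u x)) 2 volume := by
  obtain ⟨C, -, hC⟩ := hh.exists_linear_bound
  exact hu.of_le_mul (hh.uniformContinuous.continuous.comp_aestronglyMeasurable hu.1)
    (Filter.Eventually.of_forall fun x => hC (u x))

/-- First order Taylor expansion of `u ↦ ∫ H(u)` in `L²`. -/
lemma exists_integral_taylor {κ : ℝ} (hκ : 0 < κ) :
    ∃ C, 0 ≤ C ∧ ∀ u d : H1 N,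
      |(∫ x, primitive h ((u + d).fn x)) - (∫ x, primitive h (u.fn x)) -
        ∫ x, h (u.fn x) * d.fn x| ≤ κ * (‖u.fn‖ * ‖d.fn‖) + C * ‖d.fn‖ ^ 2 := by
  obtain ⟨C, hC0, hC⟩ := hh.exists_modulus hκ
  refine ⟨C, hC0, fun u d => ?_⟩
  have i1 := hh.integrable_primitive (u + d).memLp_fn
  have i2 := hh.integrable_primitive u.memLp_fn
  have i3 : Integrable (fun x => h (u.fn x) * d.fn x) :=
    (hh.memLp_comp u.memLp_fn).integrable_mul d.memLp_fn
  have i4 : Integrable (fun x => |u.fn x| * |d.fn x|) :=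
    u.memLp_fn.abs.integrable_mul d.memLp_fn.abs
  have i5 := integrable_sq d.memLp_fn
  have i12 : Integrable (fun x => primitive h ((u + d).fn x) - primitive h (u.fn x)) := i1.sub i2
  rw [← integral_sub i1 i2, ← integral_sub i12 i3]
  have hCS : ∫ x, |u.fn x| * |d.fn x| ≤ ‖u.fn‖ * ‖d.fn‖ := by
    have hu' : MemLp (fun x => |u.fn x|) 2 volume := u.memLp_fn.abs
    have hd' : MemLp (fun x => |d.fn x|) 2 volume := d.memLp_fn.abs
    have := integral_mul_le_of_memLp hd' hu'
    simp only [sq_abs] at this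
    rw [← H1.fn_norm_sq, ← H1.fn_norm_sq, Real.sqrt_sq (norm_nonneg _),
      Real.sqrt_sq (norm_nonneg _)] at this
    exact (le_abs_self _).trans this
  calc _ ≤ ∫ x, |primitive h ((u + d).fn x) - primitive h (u.fn x) - h (u.fn x) * d.fn x| :=
        abs_integral_le_integral_abs
    _ ≤ ∫ x, (κ * (|u.fn x| * |d.fn x|) + C * d.fn x ^ 2) := by
        refine integral_mono_ae (i12.sub i3).abs ((i4.const_mul κ).add (i5.const_mul C)) ?_
        filter_upwards [H1.fn_add_ae u d] with x hx
        rw [hx]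
        exact hh.abs_primitive_taylor_le hC0 hC _ _
    _ = κ * (∫ x, |u.fn x| * |d.fn x|) + C * ‖d.fn‖ ^ 2 := by
        rw [integral_add (i4.const_mul κ) (i5.const_mul C), integral_const_mul,
          integral_const_mul, H1.fn_norm_sq]
    _ ≤ _ := add_le_add (mul_le_mul_of_nonneg_left hCS hκ.le) le_rfl

end TameNonlinearity

/-! ### The truncated nonlinearity and the weak equation -/

namespace Problem

/-- The nonlinearity truncated above the level `M`. -/
def trunc (P : Problem N) (M ξ : ℝ) : ℝ := P.f (min ξ M)

variable {P : Problem N}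

/-- Since `f` vanishes on the negative axis, truncating above at `M` amounts to evaluating `f` at
the projection of `ξ` to `[0, M]`, so compactness gives boundedness and uniform continuity. -/
lemma tameNonlinearity_trunc (hP : P.Assumptions) {M : ℝ} (hM : 0 < M) :
    TameNonlinearity (P.trunc M) := by
  have heq : ∀ ξ, P.trunc M ξ = P.f (max 0 (min ξ M)) := by
    intro ξ
    rw [trunc]
    rcases le_total (min ξ M) 0 with h | h
    · rw [max_eq_left h, hP.f_nonpos _ h, hP.f_zero]
    · rw [max_eq_right h]
  have hmem : ∀ ξ, max 0 (min ξ M) ∈ Icc 0 M := fun ξ =>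
    ⟨le_max_left _ _, max_le hM.le (min_le_right _ _)⟩
  refine ⟨?_, ?_, ?_⟩
  · rw [Metric.uniformContinuous_iff]
    intro ε hε
    obtain ⟨δ, hδ, hu⟩ := Metric.uniformContinuousOn_iff.1
      ((isCompact_Icc (a := (0 : ℝ)) (b := M)).uniformContinuousOn_of_continuous
        hP.f_continuous.continuousOn) ε hε
    refine ⟨δ, hδ, fun {a b} hab => ?_⟩
    rw [heq, heq]
    refine hu _ (hmem a) _ (hmem b) (lt_of_le_of_lt ?_ hab)
    have := (((LipschitzWith.id (α := ℝ)).min_const M).const_max 0).dist_le_mul a b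
    simpa using this
  · obtain ⟨B, hB⟩ := (isCompact_Icc (a := (0 : ℝ)) (b := M)).exists_bound_of_continuousOn
      hP.f_continuous.continuousOn
    exact ⟨B, fun ξ => by rw [heq]; exact hB _ (hmem ξ)⟩
  · intro κ hκ
    have h1 := Metric.tendsto_nhdsWithin_nhds.1 hP.f_superlinear κ hκ
    obtain ⟨δ, hδ, h2⟩ := h1
    refine ⟨min (δ / 2) M, lt_min (by positivity) hM, fun ξ hξ => ?_⟩
    have hξM : ξ ≤ M := (le_abs_self ξ).trans (hξ.trans (min_le_right _ _))
    rw [trunc, min_eq_left hξM]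
    rcases eq_or_ne ξ 0 with rfl | hne
    · simp [hP.f_zero]
    · have h3 := h2 (x := ξ) hne (by
        rw [Real.dist_0_eq_abs]
        exact lt_of_le_of_lt (hξ.trans (min_le_left _ _)) (by linarith))
      rw [Real.dist_0_eq_abs, abs_div, div_lt_iff₀ (abs_pos.2 hne)] at h3
      exact h3.le

lemma F_eq_primitive_trunc {M ξ : ℝ} (hM : 0 ≤ M) (hξ : ξ ≤ M) :
    P.F ξ = primitive (P.trunc M) ξ := by
  rw [F, primitive]
  refine intervalIntegral.integral_congr fun x hx => ?_
  have hx' : x ≤ M := (mem_uIcc.1 hx).elim (fun h => h.2.trans hξ) (fun h => h.2.trans hM)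
  simp only [trunc, min_eq_left hx']

lemma integral_F_eq {M : ℝ} (hM : 0 ≤ M) {u : H1 N} (hu : ∀ᵐ x, u.fn x ≤ M) :
    ∫ x, P.F (u.fn x) = ∫ x, primitive (P.trunc M) (u.fn x) :=
  integral_congr_ae (hu.mono fun _ hx => F_eq_primitive_trunc hM hx)

/-- The differential of the truncated energy. -/
noncomputable def dL (P : Problem N) (M a : ℝ) (u φ : H1 N) : ℝ :=
  inner ℝ u.grad φ.grad + a * inner ℝ u.fn φ.fn - ∫ x, P.trunc M (u.fn x) * φ.fn x

lemma L_add (hM : 0 ≤ M) (a : ℝ) {u d : H1 N} (hu : ∀ᵐ x, u.fn x ≤ M)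
    (hud : ∀ᵐ x, (u + d).fn x ≤ M) :
    P.L a (u + d) = P.L a u + P.dL M a u d + ‖d.grad‖ ^ 2 / 2 + a / 2 * ‖d.fn‖ ^ 2 -
      ((∫ x, primitive (P.trunc M) ((u + d).fn x)) - (∫ x, primitive (P.trunc M) (u.fn x)) -
        ∫ x, P.trunc M (u.fn x) * d.fn x) := by
  rw [L, L, dL, integral_F_eq hM hu, integral_F_eq hM hud, H1.grad_add, H1.fn_add,
    norm_add_sq_real, norm_add_sq_real]
  ring

lemma dL_smul (M a t : ℝ) (u φ : H1 N) : P.dL M a u (t • φ) = t * P.dL M a u φ := by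
  have : ∫ x, P.trunc M (u.fn x) * (t • φ).fn x = t * ∫ x, P.trunc M (u.fn x) * φ.fn x := by
    rw [← integral_const_mul]
    refine integral_congr_ae ?_
    filter_upwards [H1.fn_smul_ae t φ] with x hx
    rw [hx]
    ring
  rw [dL, dL, this, H1.grad_smul, H1.fn_smul, real_inner_smul_right, real_inner_smul_right]
  ring

lemma IsCritical.hasDerivAt_line {a : ℝ} {u : H1 N} (hcrit : P.IsCritical a u) (φ : H1 N) :
    HasDerivAt (fun t : ℝ => P.L a (u + t • φ)) 0 0 := by
  have h1 : HasDerivAt (fun t : ℝ => u + t • φ) φ 0 := by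
    simpa using ((hasDerivAt_id (0 : ℝ)).smul_const φ).const_add u
  have h2 : HasFDerivAt (P.L a) (0 : H1 N →L[ℝ] ℝ) (u + (0 : ℝ) • φ) := by
    simpa using! hcrit
  simpa using! h2.comp_hasDerivAt (0 : ℝ) h1

/-- Arithmetic behind `dL_eq_zero`: divide the expansion by the step size `t`, which is small enough
for the quadratic terms to contribute at most `κ`. -/
lemma abs_le_of_expansion {t κ A C D l Δ rem q : ℝ} (ht : 0 < t) (h1 : |Δ| ≤ κ * t)
    (hΔ : Δ = t * l + t ^ 2 * A - rem) (hrem : |rem| ≤ κ * (t * D) + C * (t ^ 2 * q))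
    (hκ : t * (|A| + C * q) ≤ κ) : |l| ≤ κ * (2 + D) := by
  have e1 : t * l = Δ - t ^ 2 * A + rem := by linarith
  have e2 : |t * l| ≤ κ * t + t ^ 2 * |A| + (κ * (t * D) + C * (t ^ 2 * q)) := by
    rw [e1]
    refine (abs_add_le _ _).trans (add_le_add ((abs_sub _ _).trans (add_le_add h1 ?_)) hrem)
    rw [abs_mul, abs_of_nonneg (sq_nonneg t)]
  rw [abs_mul, abs_of_pos ht] at e2
  have e3 := mul_le_mul_of_nonneg_left hκ ht.le
  refine le_of_mul_le_mul_left (a := t) ?_ ht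
  linarith

/-- The weak form of the equation, for variations staying below the truncation level. -/
lemma dL_eq_zero (hP : P.Assumptions) {M a : ℝ} (hM : 0 < M) {u φ : H1 N}
    (hcrit : P.IsCritical a u) (hu : ∀ᵐ x, u.fn x ≤ M) (huφ : ∀ᵐ x, (u + φ).fn x ≤ M) :
    P.dL M a u φ = 0 := by
  have hh := tameNonlinearity_trunc hP hM
  set A := ‖φ.grad‖ ^ 2 / 2 + a / 2 * ‖φ.fn‖ ^ 2 with hA
  set D := ‖u.fn‖ * ‖φ.fn‖ with hD
  have hD0 : 0 ≤ D := by positivity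
  have hline := hcrit.hasDerivAt_line φ
  have key : ∀ κ > 0, |P.dL M a u φ| ≤ κ * (2 + D) := by
    intro κ hκ
    obtain ⟨C, hC0, hC⟩ := hh.exists_integral_taylor (N := N) hκ
    have h1 := (hasDerivAt_iff_isLittleO.1 hline).def hκ
    simp only [zero_smul, add_zero, sub_zero, smul_zero, Real.norm_eq_abs] at h1
    have hev : ∀ᶠ t : ℝ in nhds 0, |t| < min 1 (κ / (|A| + C * ‖φ.fn‖ ^ 2 + 1)) := by
      have : Filter.Tendsto (fun t : ℝ => |t|) (nhds 0) (nhds 0) := by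
        simpa using (continuous_abs (G := ℝ)).tendsto 0
      exact this.eventually (gt_mem_nhds (lt_min one_pos (by positivity)))
    -- Only positive `t` are admissible, because `u + t φ ≤ M` follows by convexity for `t` in `[0,
    -- 1]`. The derivative along the line is zero, so one-sided information already gives an
    -- equality.
    obtain ⟨t, ⟨ht1, ht2⟩, ht0⟩ := ((((h1.and hev).filter_mono
      (nhdsWithin_le_nhds (s := Ioi (0 : ℝ)))).and self_mem_nhdsWithin).exists)
    rw [abs_of_pos ht0] at ht1 ht2
    have htle : t ≤ 1 := (ht2.trans_le (min_le_left _ _)).le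
    have htκ : t * (|A| + C * ‖φ.fn‖ ^ 2) ≤ κ := by
      have h3 := ht2.trans_le (min_le_right _ _)
      rw [lt_div_iff₀ (by positivity)] at h3
      nlinarith
    have hut : ∀ᵐ x, (u + t • φ).fn x ≤ M := by
      filter_upwards [hu, huφ, H1.fn_add_ae u φ, H1.fn_add_ae u (t • φ), H1.fn_smul_ae t φ]
        with x h3 h4 h5 h6 h7
      rw [h6, h7]
      rw [h5] at h4
      nlinarith
    have h8 := L_add (P := P) hM.le a hu hut
    have h9 := hC u (t • φ)
    have h10 := dL_smul (P := P) M a t u φ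
    rw [h10] at h8
    rw [H1.grad_smul, H1.fn_smul, norm_smul, norm_smul, Real.norm_of_nonneg ht0.le] at h8
    rw [H1.fn_smul, norm_smul, Real.norm_of_nonneg ht0.le] at h9
    set rem := (∫ x, primitive (P.trunc M) ((u + t • φ).fn x)) -
      (∫ x, primitive (P.trunc M) (u.fn x)) -
        ∫ x, P.trunc M (u.fn x) * (t • φ.fn : Lp ℝ 2 (volume : Measure (E N))) x
    refine abs_le_of_expansion (A := A) (C := C) (q := ‖φ.fn‖ ^ 2) (rem := rem) ht0 ht1 ?_ ?_ htκ
    · rw [h8, hA]; ring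
    · refine h9.trans (le_of_eq ?_)
      rw [hD]; ring
  by_contra hne
  have hpos : 0 < |P.dL M a u φ| := abs_pos.2 hne
  have h1 := key (|P.dL M a u φ| / (2 * (2 + D))) (by positivity)
  have h2 : |P.dL M a u φ| / (2 * (2 + D)) * (2 + D) = |P.dL M a u φ| / 2 := by
    field_simp
  linarith

end Problem

/-! ### The weights -/

/-- The Japanese bracket `(1 + |x|²)^{1/2}`. -/
noncomputable def bracket (x : E N) : ℝ := Real.sqrt (1 + ‖x‖ ^ 2)

/-- A bounded regularization of the Japanese bracket. -/
noncomputable def weight (ε : ℝ) (x : E N) : ℝ := bracket x / (1 + ε * bracket x)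

lemma bracket_sq (x : E N) : bracket x ^ 2 = 1 + ‖x‖ ^ 2 := Real.sq_sqrt (by positivity)

lemma bracket_pos (x : E N) : 0 < bracket x := Real.sqrt_pos.2 (by positivity)

lemma norm_le_bracket (x : E N) : ‖x‖ ≤ bracket x := by
  have := bracket_sq x
  nlinarith [bracket_pos x, norm_nonneg x]

lemma contDiff_bracket : ContDiff ℝ ∞ (bracket : E N → ℝ) :=
  (contDiff_const.add (contDiff_norm_sq ℝ)).sqrt fun x => by positivity

lemma abs_bracket_sub_le (x y : E N) : |bracket x - bracket y| ≤ ‖x - y‖ := by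
  have hs : 0 < bracket x + bracket y := add_pos (bracket_pos x) (bracket_pos y)
  have h1 : (bracket x - bracket y) * (bracket x + bracket y) =
      (‖x‖ - ‖y‖) * (‖x‖ + ‖y‖) := by
    have := bracket_sq x; have := bracket_sq y; linarith
  have h2 : |bracket x - bracket y| * (bracket x + bracket y) ≤
      ‖x - y‖ * (bracket x + bracket y) := by
    rw [← abs_of_pos hs, ← abs_mul, h1, abs_mul, abs_of_pos hs,
      abs_of_nonneg (add_nonneg (norm_nonneg x) (norm_nonneg y))]
    exact mul_le_mul (abs_norm_sub_norm_le x y)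
      (add_le_add (norm_le_bracket x) (norm_le_bracket y)) (by positivity) (norm_nonneg _)
  exact le_of_mul_le_mul_right h2 hs

section weight

variable {ε : ℝ} (hε : 0 < ε)
include hε

lemma weight_denom_pos (x : E N) : 0 < 1 + ε * bracket x := by
  have := bracket_pos x; positivity

lemma weight_nonneg (x : E N) : 0 ≤ weight ε x :=
  div_nonneg (bracket_pos x).le (weight_denom_pos hε x).le

lemma weight_le_bracket (x : E N) : weight ε x ≤ bracket x :=
  div_le_self (bracket_pos x).le (by have := mul_pos hε (bracket_pos x); linarith)

lemma weight_le (x : E N) : weight ε x ≤ ε⁻¹ := by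
  rw [weight, div_le_iff₀ (weight_denom_pos hε x), mul_add, ← mul_assoc, inv_mul_cancel₀ hε.ne']
  have := inv_pos.2 hε
  linarith

lemma contDiff_weight : ContDiff ℝ ∞ (weight ε : E N → ℝ) :=
  contDiff_bracket.div (contDiff_const.add (contDiff_const.mul contDiff_bracket))
    fun x => (weight_denom_pos hε x).ne'

/-- The weight is `b ↦ b / (1 + ε b)` composed with the bracket, and both maps are 1-Lipschitz. That
the bound does not depend on `ε` is what makes the weighted estimates uniform. -/
lemma norm_gradient_weight_le (x : E N) : ‖gradient (weight ε) x‖ ≤ 1 := by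
  have hl : LipschitzWith 1 (weight ε : E N → ℝ) := by
    refine LipschitzWith.of_dist_le_mul fun x y => ?_
    rw [NNReal.coe_one, one_mul, Real.dist_eq, dist_eq_norm]
    refine le_trans ?_ (abs_bracket_sub_le x y)
    have hx := weight_denom_pos hε x
    have hy := weight_denom_pos hε y
    have : weight ε x - weight ε y =
        (bracket x - bracket y) / ((1 + ε * bracket x) * (1 + ε * bracket y)) := by
      rw [weight, weight, div_sub_div _ _ hx.ne' hy.ne']
      congr 1; ring
    rw [this, abs_div, abs_of_pos (mul_pos hx hy)]
    refine div_le_self (abs_nonneg _) (one_le_mul_of_one_le_of_one_le ?_ ?_)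
    · have := mul_pos hε (bracket_pos x); linarith
    · have := mul_pos hε (bracket_pos y); linarith
  have := norm_fderiv_le_of_lipschitz ℝ hl (x₀ := x)
  rw [gradient, LinearIsometryEquiv.norm_map]
  simpa using this

end weight

lemma exists_tail_le {g : E N → ℝ} (hg : Integrable g) {κ : ℝ} (hκ : 0 < κ) :
    ∃ R : ℝ, 0 < R ∧ ∫ x in {x | R ≤ ‖x‖}, g x ≤ κ := by
  have hm : ∀ n : ℕ, MeasurableSet {x : E N | (n : ℝ) ≤ ‖x‖} := fun n =>
    (isClosed_le continuous_const continuous_norm).measurableSet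
  have hanti : Antitone fun n : ℕ => {x : E N | (n : ℝ) ≤ ‖x‖} := by
    intro m n hmn x hx
    exact le_trans (Nat.cast_le.2 hmn) (show (n : ℝ) ≤ ‖x‖ from hx)
  have hlim := tendsto_setIntegral_of_antitone (μ := volume) (f := g) hm hanti
    ⟨0, hg.integrableOn⟩
  have hempty : ⋂ n : ℕ, {x : E N | (n : ℝ) ≤ ‖x‖} = ∅ := by
    ext x
    simp only [mem_iInter, mem_empty_iff_false, iff_false, not_forall]
    obtain ⟨n, hn⟩ := exists_nat_gt ‖x‖
    exact ⟨n, not_le.2 hn⟩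
  rw [hempty, setIntegral_empty] at hlim
  obtain ⟨n, hn, hn'⟩ := ((hlim.eventually (gt_mem_nhds hκ)).and
    (Filter.eventually_gt_atTop 0)).exists
  exact ⟨n, Nat.cast_pos.2 hn', hn.le⟩

/-- Fatou's lemma along `ε = 1 / (n + 1)`: the weights converge to the bracket, whose square
dominates `‖x‖ ^ 2`. -/
lemma integrable_normSq_mul_of_weight {g : E N → ℝ} (hg : Integrable g) (h0 : ∀ x, 0 ≤ g x) {B : ℝ}
    (hB : ∀ ε : ℝ, 0 < ε → ∫ x, weight ε x ^ 2 * g x ≤ B) :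
    Integrable (fun x => ‖x‖ ^ 2 * g x) := by
  set ε : ℕ → ℝ := fun n => 1 / ((n : ℝ) + 1)
  have hε : ∀ n, 0 < ε n := fun n => Nat.one_div_pos_of_nat
  have hwm : ∀ n, Continuous (weight (ε n) : E N → ℝ) := fun n => (contDiff_weight (hε n)).continuous
  have hint : ∀ n, Integrable (fun x => weight (ε n) x ^ 2 * g x) := by
    intro n
    refine hg.bdd_mul (c := (ε n)⁻¹ ^ 2) ((hwm n).pow 2).aestronglyMeasurable
      (Filter.Eventually.of_forall fun x => ?_)
    rw [norm_pow, Real.norm_of_nonneg (weight_nonneg (hε n) x)]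
    exact pow_le_pow_left₀ (weight_nonneg (hε n) x) (weight_le (hε n) x) 2
  have hpt : ∀ x : E N, Filter.Tendsto (fun n => ENNReal.ofReal (weight (ε n) x ^ 2 * g x))
      Filter.atTop (nhds (ENNReal.ofReal (bracket x ^ 2 * g x))) := by
    intro x
    have h1 : Filter.Tendsto ε Filter.atTop (nhds 0) := tendsto_one_div_add_atTop_nhds_zero_nat
    have h2 : Filter.Tendsto (fun n => weight (ε n) x) Filter.atTop (nhds (bracket x)) := by
      have := (tendsto_const_nhds (x := bracket x)).div
        ((h1.mul_const (bracket x)).const_add 1) (by simp)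
      simpa [weight] using! this
    exact ENNReal.tendsto_ofReal ((h2.pow 2).mul_const _)
  have hfin : ∫⁻ x, ENNReal.ofReal (bracket x ^ 2 * g x) ≤ ENNReal.ofReal B := by
    have h1 := lintegral_liminf_le' (μ := volume) (u := Filter.atTop)
      (f := fun n x => ENNReal.ofReal (weight (ε n) x ^ 2 * g x))
      (fun n => (hint n).1.aemeasurable.ennreal_ofReal)
    have h2 : ∀ x : E N, Filter.liminf (fun n => ENNReal.ofReal (weight (ε n) x ^ 2 * g x))
        Filter.atTop = ENNReal.ofReal (bracket x ^ 2 * g x) := fun x => (hpt x).liminf_eq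
    simp only [h2] at h1
    refine h1.trans (Filter.liminf_le_of_frequently_le' (Filter.Frequently.of_forall fun n => ?_))
    rw [← ofReal_integral_eq_lintegral_ofReal (hint n)
      (Filter.Eventually.of_forall fun x => mul_nonneg (sq_nonneg _) (h0 x))]
    exact ENNReal.ofReal_le_ofReal (hB _ (hε n))
  have hmeas : AEStronglyMeasurable (fun x => bracket x ^ 2 * g x) volume :=
    (contDiff_bracket.continuous.pow 2).aestronglyMeasurable.mul hg.1
  have hbr : Integrable (fun x => bracket x ^ 2 * g x) := by
    refine ⟨hmeas, ?_⟩
    rw [hasFiniteIntegral_iff_ofReal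
      (Filter.Eventually.of_forall fun x => mul_nonneg (sq_nonneg _) (h0 x))]
    exact hfin.trans_lt ENNReal.ofReal_lt_top
  refine hbr.mono' ((continuous_norm.pow 2).aestronglyMeasurable.mul hg.1)
    (Filter.Eventually.of_forall fun x => ?_)
  rw [Real.norm_of_nonneg (mul_nonneg (sq_nonneg _) (h0 x)), bracket_sq]
  nlinarith [h0 x]

namespace Problem

variable {P : Problem N}

/-! ### Decay of critical points -/

/-- The new value is `v` times a factor in `[0, 1]`, which keeps it below the nonnegative level `M`.
This makes the weighted variation admissible in `dL_eq_zero`. -/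
lemma sub_weighted_le {θ η v M : ℝ} (hM : 0 ≤ M) (hv : v ≤ M) (h0 : 0 ≤ θ * η ^ 2)
    (h1 : θ * η ^ 2 ≤ 1) : v + -θ * (η * (η * v)) ≤ M := by
  have e : v + -θ * (η * (η * v)) = (1 - θ * η ^ 2) * v := by ring
  rw [e]
  rcases le_total v 0 with h | h
  · nlinarith
  · nlinarith

/-- The weighted energy identity. -/
lemma weighted_energy (hP : P.Assumptions) {M a : ℝ} (hM : 0 < M) {u : H1 N}
    (hcrit : P.IsCritical a u) (hu : ∀ᵐ x, u.fn x ≤ M) {ε : ℝ} (hε : 0 < ε) :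
    ∃ w : H1 N, (w.fn =ᵐ[volume] fun x => weight ε x * u.fn x) ∧
      (w.grad =ᵐ[volume] fun x => weight ε x • u.grad x + u.fn x • gradient (weight ε) x) ∧
      ‖w.grad‖ ^ 2 + a * ‖w.fn‖ ^ 2 ≤
        ‖u.fn‖ ^ 2 + ∫ x, P.trunc M (u.fn x) * u.fn x * weight ε x ^ 2 := by
  have hA : ∀ x : E N, |weight ε x| ≤ ε⁻¹ := fun x => by
    rw [abs_of_nonneg (weight_nonneg hε x)]; exact weight_le hε x
  obtain ⟨w, hw, hwg⟩ := u.exists_mul (contDiff_weight hε) hA (norm_gradient_weight_le hε)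
  obtain ⟨z, hz, hzg⟩ := w.exists_mul (contDiff_weight hε) hA (norm_gradient_weight_le hε)
  refine ⟨w, hw, hwg, ?_⟩
  -- The variation is `-ε² η² u`. The factor `ε²` is needed because `η ≤ ε⁻¹`, and it drops out of
  -- the equation afterwards by homogeneity.
  have hadm : ∀ᵐ x, (u + (-(ε ^ 2)) • z).fn x ≤ M := by
    filter_upwards [hu, hw, hz, H1.fn_add_ae u ((-(ε ^ 2)) • z), H1.fn_smul_ae (-(ε ^ 2)) z]
      with x h1 h2 h3 h4 h5
    rw [h4, h5, h3, h2]
    refine sub_weighted_le hM.le h1 (by positivity) ?_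
    have h6 := pow_le_pow_left₀ (weight_nonneg hε x) (weight_le hε x) 2
    calc ε ^ 2 * weight ε x ^ 2 ≤ ε ^ 2 * ε⁻¹ ^ 2 := mul_le_mul_of_nonneg_left h6 (sq_nonneg _)
      _ = 1 := by rw [← mul_pow, mul_inv_cancel₀ hε.ne', one_pow]
  have h0 := dL_eq_zero hP hM hcrit hu hadm
  rw [dL_smul, mul_eq_zero] at h0
  have hdz : P.dL M a u z = 0 := h0.resolve_left (neg_ne_zero.2 (by positivity))
  rw [dL] at hdz
  have hcg : Continuous (gradient (weight ε : E N → ℝ)) :=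
    (InnerProductSpace.toDual ℝ (E N)).symm.continuous.comp
      ((contDiff_weight hε).continuous_fderiv (by simp))
  have i1 : Integrable (fun x => ‖w.grad x‖ ^ 2) := integrable_norm_sq w.memLp_grad
  have i2 : Integrable (fun x => inner ℝ (u.grad x) (z.grad x)) :=
    integrable_inner u.memLp_grad z.memLp_grad
  -- Pointwise, `|∇(ηu)|² = ∇u · ∇(η²u) + u² |∇η|²`, and `|∇η| ≤ 1`.
  have hg : ‖w.grad‖ ^ 2 ≤ inner ℝ u.grad z.grad + ‖u.fn‖ ^ 2 := by
    rw [H1.grad_norm_sq, H1.fn_norm_sq, L2.inner_def,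
      ← integral_add i2 (integrable_sq u.memLp_fn)]
    refine integral_mono_ae i1 (i2.add (integrable_sq u.memLp_fn)) ?_
    filter_upwards [hw, hwg, hzg] with x h1 h2 h3
    have h4 := norm_gradient_weight_le hε x
    rw [h3, h2, h1]
    simp only [norm_add_sq_real, inner_add_right, real_inner_smul_left, real_inner_smul_right,
      norm_smul, Real.norm_eq_abs, mul_pow, sq_abs, real_inner_self_eq_norm_sq]
    nlinarith [mul_nonneg (sq_nonneg (u.fn x)) (sub_nonneg.2
      (pow_le_one₀ (n := 2) (norm_nonneg _) h4))]
  have hf : inner ℝ u.fn z.fn = ‖w.fn‖ ^ 2 := by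
    rw [H1.fn_norm_sq, integral_inner_coeFn]
    refine integral_congr_ae ?_
    filter_upwards [hw, hz] with x h1 h2
    rw [h2, h1]; ring
  have hn : ∫ x, P.trunc M (u.fn x) * z.fn x =
      ∫ x, P.trunc M (u.fn x) * u.fn x * weight ε x ^ 2 := by
    refine integral_congr_ae ?_
    filter_upwards [hw, hz] with x h1 h2
    rw [h2, h1]; ring
  rw [hf, hn] at hdz
  linarith

/-- Uniform weighted bounds for critical points that are bounded above. -/
lemma exists_weighted_bound (hP : P.Assumptions) {M a : ℝ} (hM : 0 < M) (ha : 0 < a) {u : H1 N}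
    (hcrit : P.IsCritical a u) (hu : ∀ᵐ x, u.fn x ≤ M) :
    ∃ B, ∀ ε : ℝ, 0 < ε → ∫ x, weight ε x ^ 2 * u.fn x ^ 2 ≤ B ∧
      ∫ x, weight ε x ^ 2 * ‖u.grad x‖ ^ 2 ≤ B := by
  have hh := tameNonlinearity_trunc hP hM
  obtain ⟨C, hC0, hC⟩ := hh.exists_linear_bound
  obtain ⟨τ, hτ, hsmall⟩ := hh.superlinear (a / 4) (by positivity)
  -- With this `r`, the gradient term of `setIntegral_sq_le` multiplied by `C` is at most half of
  -- `‖∇w‖²` and can be absorbed.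
  set r : ℝ := Real.sqrt (1 / (4 * (C + 1))) with hr
  have hr0 : 0 < r := Real.sqrt_pos.2 (by positivity)
  have hr2 : C * (2 * r ^ 2) ≤ 1 / 2 := by
    rw [hr, Real.sq_sqrt (by positivity)]
    rw [show C * (2 * (1 / (4 * (C + 1)))) = C / (C + 1) * (1 / 2) by field_simp; norm_num]
    have : C / (C + 1) ≤ 1 := (div_le_one (by positivity)).2 (by linarith)
    linarith
  set b := (volume (Metric.ball (0 : E N) r)).toReal with hb
  have hb0 : 0 < b := ENNReal.toReal_pos (Metric.measure_ball_pos volume _ hr0).ne'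
    measure_ball_lt_top.ne
  -- By Chebyshev, this tail bound makes `A` so small that the mass term of `setIntegral_sq_le`
  -- multiplied by `C` is at most `a/4 ‖w‖²`.
  obtain ⟨R, hR0, hR⟩ := exists_tail_le (integrable_sq u.memLp_fn)
    (κ := τ ^ 2 * (a * b / (8 * (C + 1)))) (by positivity)
  -- The nonlinear term is split into three regions. Where `|u| ≤ τ` superlinearity gives `a/4 w²`;
  -- where `|x| < R` the weight is bounded; the rest is `A`, which has small measure.
  set A : Set (E N) := {x | τ < |u.fn x| ∧ R ≤ ‖x‖} with hA
  have hum : Measurable (u.fn : E N → ℝ) := (Lp.stronglyMeasurable u.fn).measurable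
  have hAm : MeasurableSet A :=
    (measurableSet_lt measurable_const hum.abs).inter
      (isClosed_le continuous_const continuous_norm).measurableSet
  have hAfin : volume A ≠ ⊤ := by
    have h1 := (integrable_sq u.memLp_fn).measure_norm_ge_lt_top (ε := τ ^ 2) (by positivity)
    refine (lt_of_le_of_lt (measure_mono fun x hx => ?_) h1).ne
    rw [mem_ofPred_eq, norm_pow, Real.norm_eq_abs]
    exact pow_le_pow_left₀ hτ.le hx.1.le 2
  have hAvol : (volume A).toReal ≤ a * b / (8 * (C + 1)) := by
    have h1 : τ ^ 2 * (volume A).toReal ≤ ∫ x in A, u.fn x ^ 2 :=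
      setIntegral_ge_of_const_le_real hAm hAfin (fun x hx => by
        rw [← sq_abs (u.fn x)]
        exact pow_le_pow_left₀ hτ.le hx.1.le 2) (integrable_sq u.memLp_fn).integrableOn
    have h2 : ∫ x in A, u.fn x ^ 2 ≤ ∫ x in {x | R ≤ ‖x‖}, u.fn x ^ 2 :=
      setIntegral_mono_set (integrable_sq u.memLp_fn).integrableOn
        (Filter.Eventually.of_forall fun x => sq_nonneg _)
        (LE.le.eventuallyLE fun x hx => hx.2)
    exact le_of_mul_le_mul_left (h1.trans (h2.trans hR)) (by positivity)
  have hκ : C * (2 * (volume A).toReal / b) ≤ a / 4 := by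
    have h1 : 2 * (volume A).toReal / b ≤ a / (4 * (C + 1)) := by
      rw [div_le_iff₀ hb0]
      refine (mul_le_mul_of_nonneg_left hAvol zero_le_two).trans (le_of_eq ?_)
      field_simp; norm_num
    refine (mul_le_mul_of_nonneg_left h1 hC0).trans ?_
    rw [show C * (a / (4 * (C + 1))) = C / (C + 1) * (a / 4) by field_simp]
    have : C / (C + 1) ≤ 1 := (div_le_one (by positivity)).2 (by linarith)
    nlinarith
  set B₀ := (1 + C * (1 + R ^ 2)) * ‖u.fn‖ ^ 2 with hB₀
  have hB₀0 : 0 ≤ B₀ := by positivity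
  have hmain : ∀ ε : ℝ, 0 < ε → ∃ w : H1 N, (w.fn =ᵐ[volume] fun x => weight ε x * u.fn x) ∧
      (w.grad =ᵐ[volume] fun x => weight ε x • u.grad x + u.fn x • gradient (weight ε) x) ∧
      ‖w.grad‖ ^ 2 / 2 + a / 2 * ‖w.fn‖ ^ 2 ≤ B₀ := by
    intro ε hε
    obtain ⟨w, hw, hwg, hE⟩ := weighted_energy hP hM hcrit hu hε
    refine ⟨w, hw, hwg, ?_⟩
    have j1 : Integrable (fun x => a / 4 * w.fn x ^ 2) := (integrable_sq w.memLp_fn).const_mul _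
    have j2 : Integrable (fun x => C * (1 + R ^ 2) * u.fn x ^ 2) :=
      (integrable_sq u.memLp_fn).const_mul _
    have j3 : Integrable (A.indicator fun x => C * w.fn x ^ 2) :=
      ((integrable_sq w.memLp_fn).const_mul C).indicator hAm
    have hnl : ∫ x, P.trunc M (u.fn x) * u.fn x * weight ε x ^ 2 ≤
        a / 4 * ‖w.fn‖ ^ 2 + C * (1 + R ^ 2) * ‖u.fn‖ ^ 2 + C * ∫ x in A, w.fn x ^ 2 := by
      have h1 : ∫ x, P.trunc M (u.fn x) * u.fn x * weight ε x ^ 2 ≤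
          ∫ x, (a / 4 * w.fn x ^ 2 + C * (1 + R ^ 2) * u.fn x ^ 2 +
            A.indicator (fun x => C * w.fn x ^ 2) x) := by
        have j0 : Integrable (fun x => P.trunc M (u.fn x) * u.fn x * weight ε x ^ 2) := by
          have : Integrable (fun x => P.trunc M (u.fn x) * u.fn x) :=
            (hh.memLp_comp u.memLp_fn).integrable_mul u.memLp_fn
          refine this.mul_bdd (c := ε⁻¹ ^ 2)
            ((contDiff_weight hε).continuous.pow 2).aestronglyMeasurable
            (Filter.Eventually.of_forall fun x => ?_)
          rw [norm_pow, Real.norm_of_nonneg (weight_nonneg hε x)]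
          exact pow_le_pow_left₀ (weight_nonneg hε x) (weight_le hε x) 2
        refine integral_mono_ae j0 ((j1.add j2).add j3) ?_
        filter_upwards [hw] with x hx
        have hη : 0 ≤ weight ε x ^ 2 := sq_nonneg _
        have hle : P.trunc M (u.fn x) * u.fn x ≤ |P.trunc M (u.fn x)| * |u.fn x| := by
          rw [← abs_mul]; exact le_abs_self _
        have hind : 0 ≤ A.indicator (fun x => C * w.fn x ^ 2) x :=
          indicator_nonneg (fun _ _ => by positivity) _
        have hsq : w.fn x ^ 2 = |u.fn x| * |u.fn x| * weight ε x ^ 2 := by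
          rw [hx, ← sq, sq_abs]; ring
        have hu2 : 0 ≤ C * (1 + R ^ 2) * u.fn x ^ 2 := by positivity
        have hw2 : 0 ≤ a / 4 * w.fn x ^ 2 := by positivity
        by_cases h2 : |u.fn x| ≤ τ
        · have h3 := hsmall _ h2
          have h4 : |P.trunc M (u.fn x)| * |u.fn x| * weight ε x ^ 2 ≤ a / 4 * w.fn x ^ 2 := by
            rw [hsq, ← mul_assoc, ← mul_assoc]
            exact mul_le_mul_of_nonneg_right
              (mul_le_mul_of_nonneg_right h3 (abs_nonneg _)) hη
          have h5 := mul_le_mul_of_nonneg_right hle hη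
          linarith
        · push Not at h2
          have h4 : |P.trunc M (u.fn x)| * |u.fn x| * weight ε x ^ 2 ≤ C * w.fn x ^ 2 := by
            rw [hsq, ← mul_assoc, ← mul_assoc]
            exact mul_le_mul_of_nonneg_right
              (mul_le_mul_of_nonneg_right (hC _) (abs_nonneg _)) hη
          have h5 := mul_le_mul_of_nonneg_right hle hη
          by_cases h6 : R ≤ ‖x‖
          · rw [indicator_of_mem (show x ∈ A from ⟨h2, h6⟩)]
            linarith
          · push Not at h6
            have h7 : weight ε x ^ 2 ≤ 1 + R ^ 2 := by
              refine (pow_le_pow_left₀ (weight_nonneg hε x) (weight_le_bracket hε x) 2).trans ?_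
              rw [bracket_sq]
              have := pow_le_pow_left₀ (norm_nonneg x) h6.le 2
              linarith
            have h8 : C * w.fn x ^ 2 ≤ C * (1 + R ^ 2) * u.fn x ^ 2 := by
              rw [hx, mul_pow, mul_assoc]
              exact mul_le_mul_of_nonneg_left
                (mul_le_mul_of_nonneg_right h7 (sq_nonneg _)) hC0
            linarith
      have j12 : Integrable (fun x => a / 4 * w.fn x ^ 2 + C * (1 + R ^ 2) * u.fn x ^ 2) :=
        j1.add j2
      rw [integral_add j12 j3, integral_add j1 j2, integral_const_mul, integral_const_mul,
        integral_indicator hAm, integral_const_mul, ← H1.fn_norm_sq, ← H1.fn_norm_sq] at h1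
      exact h1
    have hsm := mul_le_mul_of_nonneg_left (setIntegral_sq_le w hAfin hr0) hC0
    have k1 := mul_le_mul_of_nonneg_right hκ (sq_nonneg ‖w.fn‖)
    have k2 := mul_le_mul_of_nonneg_right hr2 (sq_nonneg ‖w.grad‖)
    rw [← hb] at hsm
    rw [hB₀]
    linarith
  -- The first summand bounds `‖w‖²`. The others bound `2 ‖∇w‖² + 2 ‖u‖²`, which controls the
  -- weighted gradient since `η ∇u = ∇w - u ∇η`.
  refine ⟨2 * B₀ / a + 4 * B₀ + 2 * ‖u.fn‖ ^ 2, fun ε hε => ?_⟩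
  obtain ⟨w, hw, hwg, hE⟩ := hmain ε hε
  have hq : 0 ≤ 2 * B₀ / a := by positivity
  constructor
  · have e : ∫ x, weight ε x ^ 2 * u.fn x ^ 2 = ‖w.fn‖ ^ 2 := by
      rw [H1.fn_norm_sq]
      refine integral_congr_ae ?_
      filter_upwards [hw] with x hx
      rw [hx, mul_pow]
    have h1 : ‖w.fn‖ ^ 2 ≤ 2 * B₀ / a := by
      rw [le_div_iff₀ ha]
      nlinarith [sq_nonneg ‖w.grad‖]
    rw [e]
    nlinarith [sq_nonneg ‖u.fn‖]
  · have h1 : ∫ x, weight ε x ^ 2 * ‖u.grad x‖ ^ 2 ≤ ∫ x, (2 * ‖w.grad x‖ ^ 2 + 2 * u.fn x ^ 2) := by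
      refine integral_mono_of_nonneg (Filter.Eventually.of_forall fun x => by positivity)
        (((integrable_norm_sq w.memLp_grad).const_mul 2).add
          ((integrable_sq u.memLp_fn).const_mul 2)) ?_
      filter_upwards [hwg] with x hx
      have e : weight ε x • u.grad x = w.grad x + -(u.fn x • gradient (weight ε) x) := by
        rw [hx]; abel
      have h2 : weight ε x ^ 2 * ‖u.grad x‖ ^ 2 = ‖weight ε x • u.grad x‖ ^ 2 := by
        rw [norm_smul, mul_pow, Real.norm_eq_abs, sq_abs]
      rw [h2, e]
      have h3 := pow_le_pow_left₀ (norm_nonneg _)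
        (norm_add_le (w.grad x) (-(u.fn x • gradient (weight ε) x))) 2
      have h4 : ‖-(u.fn x • gradient (weight ε) x)‖ ^ 2 ≤ u.fn x ^ 2 := by
        rw [norm_neg, norm_smul, mul_pow, Real.norm_eq_abs, sq_abs]
        exact mul_le_of_le_one_right (sq_nonneg _)
          (pow_le_one₀ (norm_nonneg _) (norm_gradient_weight_le hε x))
      nlinarith [sq_nonneg (‖w.grad x‖ - ‖-(u.fn x • gradient (weight ε) x)‖)]
    rw [integral_add ((integrable_norm_sq w.memLp_grad).const_mul 2)
      ((integrable_sq u.memLp_fn).const_mul 2), integral_const_mul, integral_const_mul,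
      ← H1.fn_norm_sq, ← H1.grad_norm_sq] at h1
    nlinarith [mul_nonneg ha.le (sq_nonneg ‖w.fn‖)]

/-- Decay of critical points bounded above. -/
lemma integrable_normSq_mul (hP : P.Assumptions) {M a : ℝ} (hM : 0 < M) (ha : 0 < a) {u : H1 N}
    (hcrit : P.IsCritical a u) (hu : ∀ᵐ x, u.fn x ≤ M) :
    Integrable (fun x => ‖x‖ ^ 2 * u.fn x ^ 2) ∧
      MemLp (fun x => inner ℝ (u.grad x) x) 2 volume := by
  obtain ⟨B, hB⟩ := exists_weighted_bound hP hM ha hcrit hu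
  refine ⟨integrable_normSq_mul_of_weight (integrable_sq u.memLp_fn) (fun x => sq_nonneg _)
    fun ε hε => (hB ε hε).1, ?_⟩
  have h1 := integrable_normSq_mul_of_weight (integrable_norm_sq u.memLp_grad)
    (fun x => sq_nonneg _) fun ε hε => (hB ε hε).2
  have hm : AEStronglyMeasurable (fun x => inner ℝ (u.grad x) x) volume :=
    u.memLp_grad.1.inner continuous_id.aestronglyMeasurable
  rw [memLp_two_iff_integrable_sq hm]
  refine h1.mono' (hm.pow 2) (Filter.Eventually.of_forall fun x => ?_)
  rw [norm_pow, Real.norm_eq_abs, ← mul_pow, mul_comm]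
  exact pow_le_pow_left₀ (abs_nonneg _) (abs_real_inner_le_norm _ _) 2

/-! ### The Pohozaev identity -/

/-- The point `1` is a minimum up to first order. The bound at `1 + t` gives `D ≥ -3κ`, and the
bound at `1 - t` gives `D ≤ 3κ`. -/
lemma deriv_eq_zero_of_lower_bound {p : ℝ → ℝ} {D : ℝ} (hp : HasDerivAt p D 1)
    (h : ∀ κ > 0, ∃ C, 0 ≤ C ∧ ∀ s ∈ Icc (1 / 2 : ℝ) 2,
      -(κ * |s - 1| + C * (s - 1) ^ 2) ≤ p s - p 1) : D = 0 := by
  have key : ∀ κ > 0, |D| ≤ 3 * κ := by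
    intro κ hκ
    obtain ⟨C, hC0, hC⟩ := h κ hκ
    have h1 := (hasDerivAt_iff_isLittleO.1 hp).def hκ
    obtain ⟨δ, hδ, h2⟩ := Metric.eventually_nhds_iff.1 h1
    -- The three constraints put `1 ± t` in the range of differentiability, keep them in `[1/2, 2]`,
    -- and ensure `C t² ≤ κ t`.
    set t := min (δ / 2) (min (1 / 2) (κ / (C + 1))) with ht
    have ht0 : 0 < t := lt_min (by positivity) (lt_min (by norm_num) (by positivity))
    have htδ : t < δ := (min_le_left _ _).trans_lt (by linarith)
    have ht2 : t ≤ 1 / 2 := (min_le_right _ _).trans (min_le_left _ _)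
    have htC : C * t ≤ κ := by
      have : t ≤ κ / (C + 1) := (min_le_right _ _).trans (min_le_right _ _)
      rw [le_div_iff₀ (by positivity)] at this
      nlinarith
    have hCt : C * t ^ 2 ≤ κ * t := by nlinarith
    have a1 := h2 (y := 1 + t) (by rw [Real.dist_eq]; simpa [abs_of_pos ht0] using htδ)
    have a2 := h2 (y := 1 - t) (by rw [Real.dist_eq]; simpa [abs_of_pos ht0] using htδ)
    have b1 := hC (1 + t) ⟨by linarith, by linarith⟩
    have b2 := hC (1 - t) ⟨by linarith, by linarith⟩
    have e1 : 1 + t - 1 = t := by ring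
    have e2 : 1 - t - 1 = -t := by ring
    simp only [smul_eq_mul, Real.norm_eq_abs, e1, e2, abs_neg, abs_of_pos ht0, neg_sq]
      at a1 a2 b1 b2
    rw [abs_le] at a1 a2
    rw [abs_le]
    constructor
    · refine le_of_mul_le_mul_left (a := t) ?_ ht0
      linarith [a1.2]
    · refine le_of_mul_le_mul_left (a := t) ?_ ht0
      linarith [a2.2]
  by_contra hne
  have hpos := abs_pos.2 hne
  have := key (|D| / 6) (by positivity)
  linarith

lemma ae_rescale_le {M : ℝ} {u : H1 N} (hu : ∀ᵐ x, u.fn x ≤ M) {s : ℝ} (hs : s ≠ 0) (y : E N) :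
    ∀ᵐ x, (rescale s y u).fn x ≤ M := by
  filter_upwards [rescale_fn hs y u, (quasiMeasurePreserving_affine hs y).ae hu] with x h1 h2
  rw [h1]; exact h2

lemma L_rescale (hN : 2 ≤ N) (a : ℝ) {s : ℝ} (hs : 0 < s) (y : E N) (u : H1 N) :
    P.L a (rescale s y u) = s ^ (N - 2) * (‖u.grad‖ ^ 2 / 2) +
      s ^ N * (a / 2 * ‖u.fn‖ ^ 2 - ∫ x, P.F (u.fn x)) := by
  rw [L, rescale_grad_norm_sq hN hs, rescale_fn_norm_sq hs, integral_comp_rescale_fn P.F hs]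
  ring

/-- The Pohozaev identity. -/
lemma pohozaev (hN : 2 ≤ N) (hP : P.Assumptions) {M a : ℝ} (hM : 0 < M) (ha : 0 < a) {u : H1 N}
    (hcrit : P.IsCritical a u) (hu : ∀ᵐ x, u.fn x ≤ M) :
    ((N : ℝ) - 2) / 2 * ‖u.grad‖ ^ 2 + N * (a / 2 * ‖u.fn‖ ^ 2 - ∫ x, P.F (u.fn x)) = 0 := by
  have hh := tameNonlinearity_trunc hP hM
  obtain ⟨-, hx⟩ := integrable_normSq_mul hP hM ha hcrit hu
  set X := ‖u.grad‖ ^ 2 / 2 with hX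
  set Y := a / 2 * ‖u.fn‖ ^ 2 - ∫ x, P.F (u.fn x) with hY
  set K := 4 ^ N * Real.sqrt (∫ x, inner ℝ (u.grad x) x ^ 2) with hK
  have hK0 : 0 ≤ K := by positivity
  have hderiv : HasDerivAt (fun s : ℝ => s ^ (N - 2) * X + s ^ N * Y)
      ((N - 2 : ℕ) * X + N * Y) 1 := by
    simpa using! ((hasDerivAt_pow (N - 2) (1 : ℝ)).mul_const X).add
      ((hasDerivAt_pow N (1 : ℝ)).mul_const Y)
  -- Expand the energy at `u` in the direction `d = u(·/s) - u`. Its quadratic part is nonnegative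
  -- and is dropped, so only a lower bound results, but no estimate of `∇d` is needed.
  have hz := deriv_eq_zero_of_lower_bound hderiv fun κ hκ => by
    -- As `‖d‖ ≤ K |s - 1|` in `L²`, this scaling of `κ` makes the first order error at most `κ |s -
    -- 1|`.
    obtain ⟨C, hC0, hC⟩ := hh.exists_integral_taylor (N := N)
      (κ := κ / (‖u.fn‖ * K + 1)) (by positivity)
    refine ⟨C * K ^ 2, by positivity, fun s hs => ?_⟩
    have hs0 : 0 < s := by linarith [hs.1]
    set d := rescale s 0 u - u with hd
    have hud : u + d = rescale s 0 u := by rw [hd, add_sub_cancel]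
    have hdn : ‖d.fn‖ ≤ K * |s - 1| := rescale_sub_norm_le (by omega) u hx hs
    have hadm : ∀ᵐ x, (u + d).fn x ≤ M := by
      rw [hud]; exact ae_rescale_le hu hs0.ne' 0
    have h1 := L_add (P := P) hM.le a hu hadm
    have h2 := hC u d
    -- A dilate of `u` is again at most `M`, so `d` is an admissible variation and the linear term
    -- vanishes.
    rw [dL_eq_zero hP hM hcrit hu hadm, hud, L_rescale hN a hs0, ← hX, ← hY] at h1
    rw [hud] at h2
    have h3 : P.L a u = X + Y := by rw [L, hX, hY]; ring
    have h4 := (abs_le.1 h2).2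
    have h5 : κ / (‖u.fn‖ * K + 1) * (‖u.fn‖ * ‖d.fn‖) ≤ κ * |s - 1| := by
      calc κ / (‖u.fn‖ * K + 1) * (‖u.fn‖ * ‖d.fn‖)
          ≤ κ / (‖u.fn‖ * K + 1) * (‖u.fn‖ * (K * |s - 1|)) := by gcongr
        _ = κ * |s - 1| * ((‖u.fn‖ * K) / (‖u.fn‖ * K + 1)) := by ring
        _ ≤ κ * |s - 1| := mul_le_of_le_one_right (by positivity)
            ((div_le_one (by positivity)).2 (by linarith))
    have h6 : C * ‖d.fn‖ ^ 2 ≤ C * K ^ 2 * (s - 1) ^ 2 := by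
      rw [mul_assoc, ← sq_abs (s - 1), ← mul_pow]
      gcongr
    have h7 : 0 ≤ ‖d.grad‖ ^ 2 / 2 := by positivity
    have h8 : 0 ≤ a / 2 * ‖d.fn‖ ^ 2 := by positivity
    simp only [one_pow, one_mul]
    linarith
  rw [Nat.cast_sub hN, hX] at hz
  push_cast at hz
  linarith

/-- If the gradient vanished, so would `x · ∇u`. Then `u` would coincide with its dilate by `2`,
whose squared `L²` norm is `2 ^ N` times larger. -/
lemma grad_ne_zero (hN : N ≠ 0) {u : H1 N} (hu : u ≠ 0) : ‖u.grad‖ ≠ 0 := by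
  intro h0
  have hg : u.grad = 0 := norm_eq_zero.1 h0
  have hz : (fun x => inner ℝ (u.grad x) x) =ᵐ[volume] fun _ => (0 : ℝ) := by
    rw [hg]
    filter_upwards [Lp.coeFn_zero (E N) 2 (volume : Measure (E N))] with x hx
    rw [hx]; simp
  have hm : MemLp (fun x => inner ℝ (u.grad x) x) 2 volume :=
    (memLp_congr_ae hz).2 MemLp.zero
  have h1 := rescale_sub_norm_le hN u hm (s := 2) ⟨by norm_num, le_rfl⟩
  have h2 : ∫ x, inner ℝ (u.grad x) x ^ 2 = 0 := by
    refine integral_eq_zero_of_ae (hz.mono fun x hx => ?_)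
    simp only at hx
    simp [hx]
  rw [h2, Real.sqrt_zero, mul_zero, zero_mul] at h1
  have h3 : (rescale 2 0 u).fn = u.fn := by
    have := norm_le_zero_iff.1 h1
    rwa [H1.fn_sub, sub_eq_zero] at this
  have h4 := rescale_fn_norm_sq (N := N) two_pos 0 u
  rw [h3] at h4
  have h5 : (1 : ℝ) < 2 ^ N := one_lt_pow₀ (by norm_num) hN
  have h6 : ‖u.fn‖ ^ 2 = 0 := by nlinarith [sq_nonneg ‖u.fn‖]
  refine hu (norm_eq_zero.1 ?_)
  rw [H1.norm_eq, h6, h0]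
  simp

/-- By the Pohozaev identity the numerator and denominator of `P₀` agree at `u`. Under dilation they
scale by `s ^ N` and `s ^ (N - 2)`, so the quotient is `s²`. -/
lemma P₀_rescale (hN : 3 ≤ N) {u : H1 N} (hu : ‖u.grad‖ ≠ 0)
    (hpoh : ((N : ℝ) - 2) / 2 * ‖u.grad‖ ^ 2 +
      N * (P.m₀ / 2 * ‖u.fn‖ ^ 2 - ∫ x, P.F (u.fn x)) = 0) {s : ℝ} (hs : 0 < s) (y : E N) :
    P.P₀ (rescale s y u) = s := by
  have hN' : (3 : ℝ) ≤ N := by exact_mod_cast hN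
  have hc : ((N : ℝ) - 2) / 2 * ‖u.grad‖ ^ 2 ≠ 0 :=
    mul_ne_zero (by linarith) (pow_ne_zero 2 hu)
  rw [P₀, rescale_grad_norm_sq (by omega) hs, rescale_fn_norm_sq hs,
    integral_comp_rescale_fn P.F hs]
  have h2 : s ^ N = s ^ (N - 2) * s ^ 2 := by rw [← pow_add, Nat.sub_add_cancel (by omega)]
  have e1 : (N : ℝ) * (s ^ N * (∫ x, P.F (u.fn x)) - P.m₀ / 2 * (s ^ N * ‖u.fn‖ ^ 2)) =
      s ^ 2 * (s ^ (N - 2) * (((N : ℝ) - 2) / 2 * ‖u.grad‖ ^ 2)) := by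
    have : ((N : ℝ) - 2) / 2 * ‖u.grad‖ ^ 2 =
      - (N * (P.m₀ / 2 * ‖u.fn‖ ^ 2 - ∫ x, P.F (u.fn x))) := by linarith
    rw [this, h2]; ring
  have e2 : ((N : ℝ) - 2) / 2 * (s ^ (N - 2) * ‖u.grad‖ ^ 2) =
      s ^ (N - 2) * (((N : ℝ) - 2) / 2 * ‖u.grad‖ ^ 2) := by ring
  rw [e1, e2, mul_div_assoc, div_self (mul_ne_zero (by positivity) hc), mul_one,
    Real.sqrt_sq hs.le]

end Problem

namespace Problem

variable {P : Problem N}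

/-! ### The potential well -/

lemma Assumptions.bddBelow_V (hP : P.Assumptions) : BddBelow (range P.V) := by
  by_contra h
  have := hP.V_inf_pos
  rw [iInf, Real.sInf_of_not_bddBelow h] at this
  exact lt_irrefl _ this

lemma Assumptions.iInf_le (hP : P.Assumptions) (x : E N) : ⨅ x, P.V x ≤ P.V x :=
  ciInf_le hP.bddBelow_V x

lemma Assumptions.m₀_pos (hP : P.Assumptions) : 0 < P.m₀ := by
  refine hP.V_inf_pos.trans_le (le_csInf (hP.Ω_connected.nonempty.image _) ?_)
  rintro _ ⟨x, -, rfl⟩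
  exact hP.iInf_le x

lemma Assumptions.m₀_le (hP : P.Assumptions) {x : E N} (hx : x ∈ P.Ω) : P.m₀ ≤ P.V x :=
  csInf_le (hP.bddBelow_V.mono (image_subset_range _ _)) (mem_image_of_mem _ hx)

/-- Since `V > m₀` on the boundary, `K` is also the level set in the compact closure of `Ω`. -/
lemma Assumptions.isCompact_K (hP : P.Assumptions) : IsCompact P.K := by
  have hK : P.K = closure P.Ω ∩ {x | P.V x = P.m₀} := by
    refine Subset.antisymm (fun x hx => ⟨subset_closure hx.1, hx.2⟩) fun x hx => ⟨?_, hx.2⟩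
    by_contra hxΩ
    have hfr : x ∈ frontier P.Ω := by
      rw [hP.Ω_open.frontier_eq]; exact ⟨hx.1, hxΩ⟩
    have h1 : sInf (P.V '' frontier P.Ω) ≤ P.V x :=
      csInf_le (hP.bddBelow_V.mono (image_subset_range _ _)) (mem_image_of_mem _ hfr)
    have h2 : P.V x = P.m₀ := hx.2
    linarith [hP.V_well]
  rw [hK]
  exact (hP.Ω_bounded.isCompact_closure).inter_right
    (isClosed_eq hP.V_continuous continuous_const)

lemma Assumptions.exists_nhd_K (hP : P.Assumptions) {ν : ℝ} (hν : 0 < ν) :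
    ∃ r > 0, ∀ y ∈ P.K, ∀ x, ‖x - y‖ ≤ r → x ∈ P.ΩOf (Icc 0 ν) := by
  have hopen : IsOpen (P.Ω ∩ {x | P.V x < P.m₀ + ν}) :=
    hP.Ω_open.inter (isOpen_lt hP.V_continuous continuous_const)
  obtain ⟨r, hr, hsub⟩ := hP.isCompact_K.exists_cthickening_subset_open hopen
    fun x hx => ⟨hx.1, by
      have h : P.V x = P.m₀ := hx.2
      show P.V x < P.m₀ + ν
      linarith⟩
  refine ⟨r, hr, fun y hy x hx => ?_⟩
  obtain ⟨h1, h2⟩ := hsub (Metric.mem_cthickening_of_dist_le x y r P.K hy (by rwa [dist_eq_norm]))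
  have h3 : P.V x < P.m₀ + ν := h2
  exact ⟨h1, by linarith [hP.m₀_le h1], by linarith⟩

/-- Near `K` this is uniform continuity. At distance at least `δ` the oscillation of the bounded
function `V` is below `B`, hence below `B / δ²` times the squared distance. The quadratic form fits
the second moment of the profile. -/
lemma Assumptions.exists_V_modulus (hP : P.Assumptions) {κ : ℝ} (hκ : 0 < κ) :
    ∃ C, 0 ≤ C ∧ ∀ y ∈ P.K, ∀ x, |P.V x - P.m₀| ≤ κ + C * ‖x - y‖ ^ 2 := by
  obtain ⟨B, hB⟩ := hP.V_bddAbove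
  have hV : ∀ x, 0 < P.V x ∧ P.V x ≤ B := fun x =>
    ⟨hP.V_inf_pos.trans_le (hP.iInf_le x), hB (mem_range_self x)⟩
  have hB0 : 0 < B := (hV 0).1.trans_le (hV 0).2
  have hu := hP.isCompact_K.uniformContinuousAt_of_continuousAt P.V
    (fun x _ => hP.V_continuous.continuousAt) (Metric.dist_mem_uniformity hκ)
  obtain ⟨δ, hδ, h⟩ := Metric.mem_uniformity_dist.1 hu
  refine ⟨B / δ ^ 2, by positivity, fun y hy x => ?_⟩
  have hyV : P.V y = P.m₀ := hy.2
  have hnn : 0 ≤ B / δ ^ 2 * ‖x - y‖ ^ 2 := by positivity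
  by_cases hx : ‖x - y‖ < δ
  · have h1 : dist (P.V y) (P.V x) < κ := h (a := y) (b := x)
      (by rwa [dist_comm, dist_eq_norm]) hy
    rw [dist_comm, Real.dist_eq, hyV] at h1
    linarith
  · push Not at hx
    have h1 : |P.V x - P.m₀| ≤ B := by
      rw [← hyV, abs_le]
      constructor
      · linarith [(hV x).1, (hV y).2]
      · linarith [(hV x).2, (hV y).1]
    have h2 : B ≤ B / δ ^ 2 * ‖x - y‖ ^ 2 := by
      rw [div_mul_eq_mul_div, le_div_iff₀ (by positivity)]
      exact mul_le_mul_of_nonneg_left (pow_le_pow_left₀ hδ.le hx 2) hB0.le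
    linarith

/-! ### The penalized energy of concentrating profiles -/

lemma I_eq (ε : ℝ) (u : H1 N) :
    P.I ε u = P.L P.m₀ u + ((∫ x, P.V (ε • x) * u.fn x ^ 2) - P.m₀ * ‖u.fn‖ ^ 2) / 2 := by
  rw [I, L]; ring

/-- The substitution `x = y/ε + s z` turns the potential term into the integral of `V(y + ε s z)
u(z)²`, where `exists_V_modulus` and the second moment apply uniformly in `s` and `y`. -/
lemma exists_I_rescale_le (hP : P.Assumptions) {u : H1 N}
    (hu : Integrable (fun x => ‖x‖ ^ 2 * u.fn x ^ 2)) {σ : ℝ} (hσ : 0 < σ) :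
    ∃ ε₁ > 0, ∀ ε : ℝ, 0 < ε → ε < ε₁ → ∀ s : ℝ, 0 < s → s ≤ 2 → ∀ y ∈ P.K,
      P.I ε (rescale s (ε⁻¹ • y) u) ≤ P.L P.m₀ (rescale s (ε⁻¹ • y) u) + σ := by
  set m := ‖u.fn‖ ^ 2 with hm
  set T := ∫ x, ‖x‖ ^ 2 * u.fn x ^ 2 with hT
  have hT0 : 0 ≤ T := integral_nonneg fun x => by positivity
  have hm0 : 0 ≤ m := sq_nonneg _
  -- The constant and the quadratic error are each made at most `σ`; the factor `1/2` in front of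
  -- the potential term brings the sum back to `σ`.
  set κ := σ / (2 ^ N * (m + 1)) with hκ
  obtain ⟨C, hC0, hC⟩ := hP.exists_V_modulus (κ := κ) (by positivity)
  obtain ⟨B, hB⟩ := hP.V_bddAbove
  refine ⟨min 1 (σ / (2 ^ N * (4 * C * T) + 1)), lt_min one_pos (by positivity), ?_⟩
  intro ε hε hεlt s hs hs2 y hy
  rw [I_eq]
  have hε1 : ε < 1 := hεlt.trans_le (min_le_left _ _)
  have hεσ : 2 ^ N * (4 * C * T) * ε ^ 2 ≤ σ := by
    have h1 := (hεlt.trans_le (min_le_right _ _)).le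
    rw [le_div_iff₀ (by positivity)] at h1
    have h2 : ε ^ 2 ≤ ε := by nlinarith
    have h3 : 2 ^ N * (4 * C * T) * ε ^ 2 ≤ 2 ^ N * (4 * C * T) * ε :=
      mul_le_mul_of_nonneg_left h2 (by positivity)
    linarith
  have hcov : (∫ x, P.V (ε • x) * (rescale s (ε⁻¹ • y) u).fn x ^ 2) =
      s ^ N * ∫ z, P.V (y + (ε * s) • z) * u.fn z ^ 2 := by
    rw [← integral_comp_affine_of_pos _ hs (ε⁻¹ • y)]
    refine integral_congr_ae ?_
    filter_upwards [rescale_fn hs.ne' (ε⁻¹ • y) u] with x hx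
    have e : y + (ε * s) • s⁻¹ • (x - ε⁻¹ • y) = ε • x := by
      rw [smul_smul, mul_assoc, mul_inv_cancel₀ hs.ne', mul_one, smul_sub, smul_smul,
        mul_inv_cancel₀ hε.ne', one_smul]
      abel
    rw [hx, e]
  have hsq := integrable_sq u.memLp_fn
  have hVi : Integrable (fun z => P.V (y + (ε * s) • z) * u.fn z ^ 2) := by
    refine hsq.bdd_mul (c := B) ?_ (Filter.Eventually.of_forall fun z => ?_)
    · exact (hP.V_continuous.comp (by fun_prop)).aestronglyMeasurable
    · rw [Real.norm_of_nonneg (hP.V_inf_pos.le.trans (hP.iInf_le _))]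
      exact hB (mem_range_self _)
  have hdiff : (∫ z, P.V (y + (ε * s) • z) * u.fn z ^ 2) - P.m₀ * m ≤
      κ * m + C * (ε * s) ^ 2 * T := by
    rw [hm, H1.fn_norm_sq, hT, ← integral_const_mul, ← integral_sub hVi (hsq.const_mul _),
      ← integral_const_mul, ← integral_const_mul,
      ← integral_add (hsq.const_mul _) (hu.const_mul _)]
    refine integral_mono (hVi.sub (hsq.const_mul _)) ((hsq.const_mul _).add (hu.const_mul _))
      fun z => ?_
    have h1 := (le_abs_self _).trans (hC y hy (y + (ε * s) • z))
    rw [add_sub_cancel_left, norm_smul, Real.norm_of_nonneg (by positivity), mul_pow] at h1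
    have h2 := mul_le_mul_of_nonneg_right h1 (sq_nonneg (u.fn z))
    linarith
  rw [hcov, rescale_fn_norm_sq hs, ← hm]
  have hsN : s ^ N ≤ 2 ^ N := pow_le_pow_left₀ hs.le hs2 N
  have hb0 : 0 ≤ κ * m + C * (ε * s) ^ 2 * T := by positivity
  have h1 : s ^ N * ((∫ z, P.V (y + (ε * s) • z) * u.fn z ^ 2) - P.m₀ * m) ≤
      2 ^ N * (κ * m + C * (ε * s) ^ 2 * T) :=
    (mul_le_mul_of_nonneg_left hdiff (by positivity)).trans (mul_le_mul_of_nonneg_right hsN hb0)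
  have h2 : 2 ^ N * (κ * m) ≤ σ := by
    rw [show (2 : ℝ) ^ N * (κ * m) = σ * (m / (m + 1)) by rw [hκ]; field_simp]
    exact mul_le_of_le_one_right hσ.le ((div_le_one (by positivity)).2 (by linarith))
  have h3 : 2 ^ N * (C * (ε * s) ^ 2 * T) ≤ σ := by
    refine le_trans ?_ hεσ
    have h4 : s ^ 2 ≤ 4 := by nlinarith
    calc 2 ^ N * (C * (ε * s) ^ 2 * T) = 2 ^ N * (C * T) * ε ^ 2 * s ^ 2 := by ring
      _ ≤ 2 ^ N * (C * T) * ε ^ 2 * 4 := mul_le_mul_of_nonneg_left h4 (by positivity)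
      _ = 2 ^ N * (4 * C * T) * ε ^ 2 := by ring
  linarith

/-- Outside `Ω` the rescaled variable satisfies `ε s |z| ≥ r`, so the squared `L²` mass there is at
most a multiple of `ε²` times a tail of the second moment. A small tail puts it below the threshold
`ε²`, and the penalization is exactly zero. -/
lemma exists_Q_rescale_eq_zero (hP : P.Assumptions) (h₀ : ℝ) {u : H1 N}
    (hu : Integrable (fun x => ‖x‖ ^ 2 * u.fn x ^ 2)) :
    ∃ ε₁ > 0, ∀ ε : ℝ, 0 < ε → ε < ε₁ → ∀ s : ℝ, 0 < s → s ≤ 2 → ∀ y ∈ P.K,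
      P.Q h₀ ε (rescale s (ε⁻¹ • y) u) = 0 := by
  obtain ⟨r, hr, hrK⟩ := hP.exists_nhd_K one_pos
  -- With `s ≤ 2` this gives `(ε s / r)² · 2 ^ N · r² / (4 · 2 ^ N) ≤ ε²`.
  obtain ⟨R, hR0, hR⟩ := exists_tail_le hu (κ := r ^ 2 / (4 * 2 ^ N)) (by positivity)
  -- For such `ε`, the condition `r ≤ ε s |z| ≤ 2 ε |z|` forces `|z| ≥ R`.
  refine ⟨r / (2 * R), by positivity, ?_⟩
  intro ε hε hεlt s hs hs2 y hy
  rw [lt_div_iff₀ (by positivity)] at hεlt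
  have hexp : (P.p + 1) / 2 ≠ 0 := by
    have := hP.p_range.1
    have h : 0 < (P.p + 1) / 2 := by linarith
    exact h.ne'
  suffices h : ε⁻¹ ^ 2 * (∫ x in {x : E N | ε • x ∉ P.Ωnhd (2 * h₀)},
      (rescale s (ε⁻¹ • y) u).fn x ^ 2) - 1 ≤ 0 by
    rw [Q, max_eq_right h, Real.zero_rpow hexp]
  set w := rescale s (ε⁻¹ • y) u with hw
  set A' : Set (E N) := {x | r ≤ ‖ε • x - y‖}
  have hA'm : MeasurableSet A' :=
    (isClosed_le continuous_const (by fun_prop)).measurableSet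
  have hTm : MeasurableSet {z : E N | R ≤ ‖z‖} :=
    (isClosed_le continuous_const continuous_norm).measurableSet
  have hsub : {x : E N | ε • x ∉ P.Ωnhd (2 * h₀)} ⊆ A' := by
    intro x hx
    by_contra hcon
    have h1 : ¬ r ≤ ‖ε • x - y‖ := hcon
    exact hx (Or.inr (hrK y hy (ε • x) (not_le.1 h1).le).1)
  have h1 : ∫ x in {x : E N | ε • x ∉ P.Ωnhd (2 * h₀)}, w.fn x ^ 2 ≤ ∫ x in A', w.fn x ^ 2 :=
    setIntegral_mono_set (integrable_sq w.memLp_fn).integrableOn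
      (Filter.Eventually.of_forall fun x => sq_nonneg _) (LE.le.eventuallyLE hsub)
  set g : E N → ℝ := {z : E N | R ≤ ‖z‖}.indicator fun z => ‖z‖ ^ 2 * u.fn z ^ 2 with hg
  have hgi : Integrable g := hu.indicator hTm
  have h2 : ∫ x in A', w.fn x ^ 2 ≤ ∫ x, (ε * s / r) ^ 2 * g (s⁻¹ • (x - ε⁻¹ • y)) := by
    rw [← integral_indicator hA'm]
    refine integral_mono_ae ((integrable_sq w.memLp_fn).indicator hA'm)
      ((integrable_comp_affine hgi hs.ne' _).const_mul _) ?_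
    filter_upwards [rescale_fn hs.ne' (ε⁻¹ • y) u] with x hx
    have hg0 : 0 ≤ g (s⁻¹ • (x - ε⁻¹ • y)) := indicator_nonneg (fun z _ => by positivity) _
    by_cases hxA : x ∈ A'
    · rw [indicator_of_mem hxA, hw, hx]
      have hxA' : r ≤ ‖ε • x - y‖ := hxA
      set z := s⁻¹ • (x - ε⁻¹ • y) with hz
      have e : (ε * s) • z = ε • x - y := by
        rw [hz, smul_smul, mul_assoc, mul_inv_cancel₀ hs.ne', mul_one, smul_sub, smul_smul,
          mul_inv_cancel₀ hε.ne', one_smul]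
      have hzr : r ≤ ε * s * ‖z‖ := by
        rw [← e, norm_smul, Real.norm_of_nonneg (by positivity)] at hxA'
        exact hxA'
      have hzR : R ≤ ‖z‖ := by
        have h3 : ε * s * ‖z‖ ≤ ε * 2 * ‖z‖ := by gcongr
        by_contra hcon
        push Not at hcon
        have h4 : ε * 2 * ‖z‖ ≤ ε * 2 * R := by gcongr
        linarith
      rw [hg, indicator_of_mem (show z ∈ {z : E N | R ≤ ‖z‖} from hzR), ← mul_assoc, ← mul_pow]
      refine le_mul_of_one_le_left (sq_nonneg _) (one_le_pow₀ ?_)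
      rw [div_mul_eq_mul_div, le_div_iff₀ hr, one_mul]
      exact hzr
    · rw [indicator_of_notMem hxA]
      positivity
  rw [integral_const_mul, integral_comp_affine_of_pos g hs, hg, integral_indicator hTm] at h2
  have h3 : s ^ N * ∫ z in {z : E N | R ≤ ‖z‖}, ‖z‖ ^ 2 * u.fn z ^ 2 ≤
      2 ^ N * (r ^ 2 / (4 * 2 ^ N)) :=
    mul_le_mul (pow_le_pow_left₀ hs.le hs2 N) hR
      (integral_nonneg fun z => by positivity) (by positivity)
  have h4 : ∫ x in {x : E N | ε • x ∉ P.Ωnhd (2 * h₀)}, w.fn x ^ 2 ≤ ε ^ 2 := by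
    calc _ ≤ (ε * s / r) ^ 2 * (2 ^ N * (r ^ 2 / (4 * 2 ^ N))) :=
          (h1.trans h2).trans (mul_le_mul_of_nonneg_left h3 (sq_nonneg _))
      _ = ε ^ 2 * (s ^ 2 / 4) := by field_simp
      _ ≤ ε ^ 2 := mul_le_of_le_one_right (sq_nonneg _) (by nlinarith)
  have h5 := mul_le_mul_of_nonneg_left h4 (sq_nonneg ε⁻¹)
  rw [← mul_pow, inv_mul_cancel₀ hε.ne', one_pow] at h5
  linarith

end Problem

/-! ### Energy along dilations. -/

/-- With `N = n + 2` the claim is `(n + 2) t ^ n ≤ 2 + n t ^ (n + 2)`. In the induction, the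
previous case times `t` is completed by two instances of `(t ^ m - 1)(t - 1) ≥ 0`. -/
lemma gFun_le_one {N : ℕ} (hN : 2 ≤ N) {t : ℝ} (ht : 0 ≤ t) : gFun N t ≤ 1 := by
  obtain ⟨n, rfl⟩ := Nat.exists_eq_add_of_le' hN
  have key : ∀ n : ℕ, ((n : ℝ) + 2) * t ^ n ≤ 2 + n * t ^ (n + 2) := by
    intro n
    induction n with
    | zero => simp
    | succ k ih =>
      have h1 : ∀ m : ℕ, 0 ≤ (t ^ m - 1) * (t - 1) := by
        intro m
        rw [← geom_sum_mul t m, mul_assoc]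
        exact mul_nonneg (Finset.sum_nonneg fun i _ => pow_nonneg ht i) (mul_self_nonneg _)
      have h2 := mul_le_mul_of_nonneg_left ih ht
      have h3 := h1 (k + 1)
      have h4 := h1 (k + 2)
      push_cast
      ring_nf at h2 h3 h4 ⊢
      linarith
  rw [gFun]
  have := key n
  rw [Nat.add_sub_cancel]
  push_cast
  linarith

/-- The Pohozaev identity expresses the zero order part of the energy through `‖∇u‖²`, leaving one
common factor. -/
lemma L_rescale_eq_gFun {P : Problem N} (hN : 3 ≤ N) {u : H1 N}
    (hpoh : ((N : ℝ) - 2) / 2 * ‖u.grad‖ ^ 2 +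
      N * (P.m₀ / 2 * ‖u.fn‖ ^ 2 - ∫ x, P.F (u.fn x)) = 0) {s : ℝ} (hs : 0 < s) (y : E N) :
    P.L P.m₀ (rescale s y u) = gFun N s * P.L P.m₀ u := by
  have hN0 : (N : ℝ) ≠ 0 := by positivity
  have hY : P.m₀ / 2 * ‖u.fn‖ ^ 2 - ∫ x, P.F (u.fn x) =
      -(((N : ℝ) - 2) / 2 * ‖u.grad‖ ^ 2) / N := by
    rw [eq_div_iff hN0]; linarith
  have hL : P.L P.m₀ u = ‖u.grad‖ ^ 2 / 2 + (P.m₀ / 2 * ‖u.fn‖ ^ 2 - ∫ x, P.F (u.fn x)) := by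
    rw [Problem.L]; ring
  rw [Problem.L_rescale (by omega) _ hs, hL, hY, gFun]
  field_simp
  ring

/-- The Pohozaev identity gives `N L(u) = ‖∇u‖²`. -/
lemma L_nonneg_of_pohozaev {P : Problem N} (hN : 3 ≤ N) {u : H1 N}
    (hpoh : ((N : ℝ) - 2) / 2 * ‖u.grad‖ ^ 2 +
      N * (P.m₀ / 2 * ‖u.fn‖ ^ 2 - ∫ x, P.F (u.fn x)) = 0) : 0 ≤ P.L P.m₀ u := by
  have hN0 : (0 : ℝ) < N := by positivity
  have hL : N * P.L P.m₀ u = ‖u.grad‖ ^ 2 := by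
    rw [Problem.L]; linarith
  nlinarith [sq_nonneg ‖u.grad‖]

/-! ### The center of mass of rescaled profiles -/

/-- The local distance of `w` to a set of profiles. -/
noncomputable def localDist (A : Set (E N)) (S : Set (H1 N)) (w : H1 N) : ℝ :=
  sInf ((fun V : H1 N => h1NormOn A (w - V)) '' S)

lemma localDist_nonneg (A : Set (E N)) (S : Set (H1 N)) (w : H1 N) : 0 ≤ localDist A S w := by
  refine Real.sInf_nonneg ?_
  rintro _ ⟨V, -, rfl⟩
  exact h1NormOn_nonneg _ _

lemma localDist_le (A : Set (E N)) {S : Set (H1 N)} (w : H1 N) {V : H1 N} (hV : V ∈ S) :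
    localDist A S w ≤ h1NormOn A (w - V) := by
  refine csInf_le ⟨0, ?_⟩ (mem_image_of_mem _ hV)
  rintro _ ⟨V, -, rfl⟩
  exact h1NormOn_nonneg _ _

lemma localDist_le_add (A : Set (E N)) {S : Set (H1 N)} (hS : S.Nonempty) (w w' : H1 N) :
    localDist A S w ≤ localDist A S w' + ‖w - w'‖ := by
  rw [← sub_le_iff_le_add]
  refine le_csInf (hS.image _) ?_
  rintro _ ⟨V, hV, rfl⟩
  rw [sub_le_iff_le_add]
  refine (localDist_le A w hV).trans ((h1NormOn_le_add A (w - V) (w' - V)).trans ?_)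
  rw [sub_sub_sub_cancel_right]
  exact add_le_add le_rfl (h1NormOn_le_norm _ _)

lemma continuous_localDist (A : Set (E N)) {S : Set (H1 N)} (hS : S.Nonempty) :
    Continuous (localDist A S) := by
  have : LipschitzWith 1 (localDist A S) := by
    refine LipschitzWith.of_le_add fun w w' => ?_
    rw [dist_eq_norm]
    exact localDist_le_add A hS w w'
  exact this.continuous

namespace Constants

variable {C : Constants N} {P : Problem N}

/-- The density of the rescaled profile `U₀(· / s)` seen from the point `-z`. -/
noncomputable def profileDensity (C : Constants N) (P : Problem N) (s : ℝ) (z : E N) : ℝ :=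
  C.ψ (localDist {x | ‖x‖ ≤ C.R₀} (C.Shat P) (rescale s z C.U₀))

/-- The displacement of the center of mass of `U₀(· / s)`. -/
noncomputable def profileShift (C : Constants N) (P : Problem N) (s : ℝ) : E N :=
  -((∫ z, C.profileDensity P s z)⁻¹ • ∫ z, C.profileDensity P s z • z)

/-- Translating by `q` carries the ball at the origin to the ball at `q`, so only `y - q` matters.
-/
lemma density_rescale {s : ℝ} (hs : s ≠ 0) (q y : E N) :
    C.density P q (rescale s y C.U₀) = C.profileDensity P s (y - q) := by
  rw [density, profileDensity, localDist]
  congr 3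
  funext V
  rw [← preimage_sub_closedBall, ← h1NormOn_translate (measurableSet_norm_le C.R₀) q,
    translate_sub, translate_rescale hs, sub_add_cancel]

section

variable (hC : C.Admissible P)
include hC

lemma Admissible.Shat_nonempty : (C.Shat P).Nonempty := ⟨_, hC.U₀_mem⟩

lemma Admissible.pos_of_mem_Icc {s : ℝ} (hs : s ∈ Icc (1 - C.s₀) (1 + C.s₀)) : 0 < s := by
  linarith [hs.1, hC.s₀_lt]

lemma Admissible.rStar_pos : 0 < C.rStar P := by
  linarith [hC.ρ₁_pos, hC.ρ₁_lt, hC.ρ₀_lt]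

lemma Admissible.continuousOn_profileDensity :
    ContinuousOn (Function.uncurry (C.profileDensity P)) (Icc (1 - C.s₀) (1 + C.s₀) ×ˢ univ) := by
  intro p hp
  have h1 := continuousAt_rescale C.U₀ (hC.pos_of_mem_Icc hp.1)
  have h2 := (continuous_localDist {x | ‖x‖ ≤ C.R₀} hC.Shat_nonempty).continuousAt.comp
    (f := fun p : ℝ × E N => rescale p.1 p.2 C.U₀) h1
  exact (hC.ψ_smooth.continuous.continuousAt.comp h2).continuousWithinAt

lemma Admissible.profileDensity_nonneg (s : ℝ) (z : E N) : 0 ≤ C.profileDensity P s z :=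
  (hC.ψ_mem _ (localDist_nonneg _ _ _)).1

/-- At the origin the local distance is below `ρ₁ < r_*/8`, where `ψ = 1`. This keeps the
denominator of the center of mass positive. -/
lemma Admissible.profileDensity_zero {s : ℝ} (hs : s ∈ Icc (1 - C.s₀) (1 + C.s₀)) :
    C.profileDensity P s 0 = 1 := by
  refine hC.ψ_one _ (localDist_nonneg _ _ _) ?_
  have h1 := (localDist_le {x | ‖x‖ ≤ C.R₀} (rescale s 0 C.U₀) hC.U₀_mem).trans
    (h1NormOn_le_norm _ _)
  linarith [hC.s₀_close s hs, hC.ρ₁_lt, hC.ρ₀_lt, hC.rStar_pos]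

lemma Admissible.rescale_sub_translate_norm_lt {s : ℝ} (hs : s ∈ Icc (1 - C.s₀) (1 + C.s₀))
    (z : E N) : ‖rescale s z C.U₀ - translate z C.U₀‖ < C.ρ₁ := by
  have h := translate_rescale (hC.pos_of_mem_Icc hs).ne' z 0 C.U₀
  rw [zero_add] at h
  rw [← h, ← translate_sub, norm_translate]
  exact hC.s₀_close s hs

/-- On the ball of radius `R₀` every profile has norm above `3/4 r_*`. For `|z| ≥ 2 R₀` the
translate of `U₀` has norm below `1/8 r_*` there, and the dilation adds less than `1/8 r_*`. The
distance exceeds `1/2 r_*`, where `ψ = 0`. -/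
lemma Admissible.profileDensity_eq_zero {s : ℝ} (hs : s ∈ Icc (1 - C.s₀) (1 + C.s₀)) {z : E N}
    (hz : 2 * C.R₀ ≤ ‖z‖) : C.profileDensity P s z = 0 := by
  refine hC.ψ_zero _ (le_csInf (hC.Shat_nonempty.image _) ?_)
  rintro _ ⟨V, hV, rfl⟩
  set A : Set (E N) := {x | ‖x‖ ≤ C.R₀}
  have h1 := hC.R₀_inside V hV
  have h2 := h1NormOn_le_add A V (rescale s z C.U₀)
  rw [h1NormOn_sub_comm] at h2
  have h3 := h1NormOn_le_add A (rescale s z C.U₀) (translate z C.U₀)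
  have h4 := (h1NormOn_le_norm A (rescale s z C.U₀ - translate z C.U₀)).trans_lt
    (hC.rescale_sub_translate_norm_lt hs z)
  have hm : MeasurableSet {x : E N | C.R₀ ≤ ‖x‖} :=
    (isClosed_le continuous_const continuous_norm).measurableSet
  have hsub : A ⊆ (fun x => x - z) ⁻¹' {x : E N | C.R₀ ≤ ‖x‖} := by
    intro x hx
    have hx' : ‖x‖ ≤ C.R₀ := hx
    have := norm_sub_norm_le z x
    rw [norm_sub_rev] at this
    show C.R₀ ≤ ‖x - z‖
    linarith
  have h5 := h1NormOn_mono hsub (translate z C.U₀)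
  rw [h1NormOn_translate hm] at h5
  have h6 := hC.R₀_outside _ hC.U₀_mem
  simp only
  linarith [hC.ρ₁_lt, hC.ρ₀_lt]

lemma Admissible.continuous_profileDensity {s : ℝ} (hs : s ∈ Icc (1 - C.s₀) (1 + C.s₀)) :
    Continuous (C.profileDensity P s) := by
  have := hC.continuousOn_profileDensity.comp (f := fun z : E N => (s, z)) (s := univ)
    (by fun_prop) (fun z _ => ⟨hs, mem_univ _⟩)
  exact continuousOn_univ.1 this

lemma Admissible.hasCompactSupport_profileDensity {s : ℝ}
    (hs : s ∈ Icc (1 - C.s₀) (1 + C.s₀)) : HasCompactSupport (C.profileDensity P s) := by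
  refine HasCompactSupport.intro (isCompact_closedBall (0 : E N) (2 * C.R₀)) fun z hz => ?_
  rw [mem_closedBall_zero_iff, not_le] at hz
  exact hC.profileDensity_eq_zero hs hz.le

lemma Admissible.integral_profileDensity_pos {s : ℝ} (hs : s ∈ Icc (1 - C.s₀) (1 + C.s₀)) :
    0 < ∫ z, C.profileDensity P s z :=
  (hC.continuous_profileDensity hs).integral_pos_of_hasCompactSupport_nonneg_nonzero (x := 0)
    (hC.hasCompactSupport_profileDensity hs) (hC.profileDensity_nonneg s)
    (by rw [hC.profileDensity_zero hs]; exact one_ne_zero)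

lemma Admissible.integrable_profileDensity {s : ℝ} (hs : s ∈ Icc (1 - C.s₀) (1 + C.s₀)) :
    Integrable (C.profileDensity P s) :=
  (hC.continuous_profileDensity hs).integrable_of_hasCompactSupport
    (hC.hasCompactSupport_profileDensity hs)

lemma Admissible.integrable_profileDensity_smul {s : ℝ} (hs : s ∈ Icc (1 - C.s₀) (1 + C.s₀)) :
    Integrable (fun z => C.profileDensity P s z • z) :=
  ((hC.continuous_profileDensity hs).smul continuous_id).integrable_of_hasCompactSupport
    (hC.hasCompactSupport_profileDensity hs).smul_right

/-- Substitute `q = y - z` in both integrals. That the shift is independent of `y` makes the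
composition of the two maps explicit. -/
lemma Admissible.Upsilon_rescale {s : ℝ} (hs : s ∈ Icc (1 - C.s₀) (1 + C.s₀)) (y : E N) :
    C.Upsilon P (rescale s y C.U₀) = y + C.profileShift P s := by
  have hs0 := (hC.pos_of_mem_Icc hs).ne'
  have hpos := hC.integral_profileDensity_pos hs
  have e1 : ∫ q, C.density P q (rescale s y C.U₀) = ∫ z, C.profileDensity P s z := by
    simp only [density_rescale hs0]
    exact integral_sub_left_eq_self (C.profileDensity P s) volume y
  have e2 : ∫ q, C.density P q (rescale s y C.U₀) • q =
      (∫ z, C.profileDensity P s z) • y - ∫ z, C.profileDensity P s z • z := by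
    simp only [density_rescale hs0]
    have h1 := integral_sub_left_eq_self (fun z => C.profileDensity P s z • (y - z)) volume y
    simp only [sub_sub_cancel] at h1
    rw [h1, ← integral_smul_const, ← integral_sub ((hC.integrable_profileDensity hs).smul_const y)
      (hC.integrable_profileDensity_smul hs)]
    simp only [smul_sub]
  rw [Upsilon, e1, e2, smul_sub, smul_smul, inv_mul_cancel₀ hpos.ne', one_smul, profileShift,
    sub_eq_add_neg]

lemma Admissible.norm_profileShift_le {s : ℝ} (hs : s ∈ Icc (1 - C.s₀) (1 + C.s₀)) :
    ‖C.profileShift P s‖ ≤ 2 * C.R₀ := by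
  have hpos := hC.integral_profileDensity_pos hs
  rw [profileShift, norm_neg, norm_smul, norm_inv, Real.norm_of_nonneg hpos.le,
    inv_mul_le_iff₀ hpos, ← integral_mul_const]
  refine norm_integral_le_of_norm_le ((hC.integrable_profileDensity hs).mul_const _)
    (Filter.Eventually.of_forall fun z => ?_)
  rw [norm_smul, Real.norm_of_nonneg (hC.profileDensity_nonneg s z)]
  rcases le_total (2 * C.R₀) ‖z‖ with h | h
  · rw [hC.profileDensity_eq_zero hs h, zero_mul, zero_mul]
  · exact mul_le_mul_of_nonneg_left h (hC.profileDensity_nonneg s z)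

/-- The supports lie in one ball for all `s`, so both parametric integrals are continuous, and the
denominator is positive. -/
lemma Admissible.continuousOn_profileShift :
    ContinuousOn (C.profileShift P) (Icc (1 - C.s₀) (1 + C.s₀)) := by
  have hvan : ∀ s z, s ∈ Icc (1 - C.s₀) (1 + C.s₀) → z ∉ Metric.closedBall (0 : E N) (2 * C.R₀) →
      C.profileDensity P s z = 0 := by
    intro s z hs hz
    rw [mem_closedBall_zero_iff, not_le] at hz
    exact hC.profileDensity_eq_zero hs hz.le
  have h1 : ContinuousOn (fun s => ∫ z, C.profileDensity P s z) (Icc (1 - C.s₀) (1 + C.s₀)) :=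
    continuousOn_integral_of_compact_support (isCompact_closedBall _ _)
      hC.continuousOn_profileDensity hvan
  have h2 : ContinuousOn (fun s => ∫ z, C.profileDensity P s z • z)
      (Icc (1 - C.s₀) (1 + C.s₀)) := by
    refine continuousOn_integral_of_compact_support
      (isCompact_closedBall (0 : E N) (2 * C.R₀)) ?_ fun s z hs hz => ?_
    · exact hC.continuousOn_profileDensity.smul continuous_snd.continuousOn
    · rw [hvan s z hs hz, zero_smul]
  exact ((h1.inv₀ fun s hs => (hC.integral_profileDensity_pos hs).ne').smul h2).neg

lemma Admissible.rescale_mem_tube {s : ℝ} (hs : s ∈ Icc (1 - C.s₀) (1 + C.s₀)) (y : E N) :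
    rescale s y C.U₀ ∈ C.tube P C.ρ₀ :=
  ⟨y, C.U₀, hC.U₀_mem, rescale s y C.U₀ - translate y C.U₀,
    (hC.rescale_sub_translate_norm_lt hs y).trans hC.ρ₁_lt, by rw [add_sub_cancel]⟩

lemma Admissible.rhoHat_rescale_le {s : ℝ} (hs : s ∈ Icc (1 - C.s₀) (1 + C.s₀)) (y : E N) :
    C.rhoHat P (rescale s y C.U₀) ≤ C.ρ₁ := by
  have hmem : ‖rescale s y C.U₀ - translate y C.U₀‖ ∈
      {t | ∃ z : E N, ∃ U ∈ C.Shat P, t = ‖rescale s y C.U₀ - translate z U‖} :=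
    ⟨y, C.U₀, hC.U₀_mem, rfl⟩
  refine (csInf_le ⟨0, ?_⟩ hmem).trans (hC.rescale_sub_translate_norm_lt hs y).le
  rintro _ ⟨y, V, -, rfl⟩
  exact norm_nonneg _

lemma Admissible.U₀_ne_zero : C.U₀ ≠ 0 := by
  obtain ⟨a, -, h⟩ := mem_iUnion₂.1 hC.U₀_mem
  exact h.1

lemma Admissible.exists_U₀_le : ∃ M, 0 < M ∧ ∀ᵐ x, C.U₀.fn x ≤ M := by
  obtain ⟨a, -, -, -, -, W, -, hW, hmax⟩ := mem_iUnion₂.1 hC.U₀_mem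
  refine ⟨max (W 0) 1, lt_max_of_lt_right one_pos, ?_⟩
  filter_upwards [hW] with x hx
  rw [hx]
  exact (hmax x).trans (le_max_left _ _)

end

/-- Energy and concentration estimates for the map `Φ_ε`, for all small `ε`. -/
lemma Admissible.exists_estimates (hN : 3 ≤ N) (hP : P.Assumptions) (hC : C.Admissible P) :
    ∃ ε₀ : ℝ, 0 < ε₀ ∧ ∀ ε : ℝ, 0 < ε → ε < ε₀ →
      (∀ y ∈ P.K, ∀ x, ‖x - y‖ ≤ ε * (2 * C.R₀) →
        x ∈ P.ΩOf (Icc 0 C.ν₁)) ∧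
      (∀ s ∈ Icc (1 - C.s₀) (1 + C.s₀), ∀ y, P.P₀ (rescale s y C.U₀) = s) ∧
      (∀ s ∈ Icc (1 - C.s₀) (1 + C.s₀), ∀ y ∈ P.K,
        P.J C.h₀ ε (C.Phi ε (s, y)) ≤ P.leastEnergy P.m₀ + min C.δ C.δhat) ∧
      (∀ s ∈ ({1 - C.s₀, 1 + C.s₀} : Set ℝ), ∀ y ∈ P.K,
        P.J C.h₀ ε (C.Phi ε (s, y)) ≤ P.leastEnergy P.m₀ - C.δhat) := by
  obtain ⟨M, hM, hUM⟩ := hC.exists_U₀_le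
  have hpoh := Problem.pohozaev (by omega) hP hM hP.m₀_pos hC.U₀_critical hUM
  have hgrad := Problem.grad_ne_zero (by omega) hC.U₀_ne_zero
  have hdec := (Problem.integrable_normSq_mul hP hM hP.m₀_pos hC.U₀_critical hUM).1
  have hE0 : 0 ≤ P.leastEnergy P.m₀ := by
    rw [← hC.U₀_energy]; exact L_nonneg_of_pohozaev hN hpoh
  set e := P.leastEnergy P.m₀ with he
  -- The first entries keep the energy below both levels `E(m₀) + δ` and `E(m₀) + δ̂`. The last two
  -- are the gaps in the strict inequalities defining `δ̂`, which leave room at the endpoints.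
  set σ := min (min C.δ C.δhat)
    (min (e - C.δhat - gFun N (1 - C.s₀) * e) (e - C.δhat - gFun N (1 + C.s₀) * e)) with hσ
  have hσ0 : 0 < σ := by
    refine lt_min (lt_min hC.δ_pos hC.δhat_pos) (lt_min ?_ ?_)
    · linarith [hC.δhat_left]
    · linarith [hC.δhat_right]
  obtain ⟨ε₁, hε₁, hI⟩ := Problem.exists_I_rescale_le hP hdec hσ0
  obtain ⟨ε₂, hε₂, hQ⟩ := Problem.exists_Q_rescale_eq_zero hP C.h₀ hdec
  obtain ⟨r, hr, hrK⟩ := hP.exists_nhd_K hC.ν₁_pos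
  have hR : 0 < C.R₀ := one_pos.trans hC.R₀_gt
  have hs2 : ∀ s ∈ Icc (1 - C.s₀) (1 + C.s₀), s ≤ 2 := fun s hs => by
    linarith [hs.2, hC.s₀_lt]
  -- The last entry keeps every displacement of length at most `2 ε R₀` within distance `r` of `K`.
  refine ⟨min ε₁ (min ε₂ (r / (2 * C.R₀))), lt_min hε₁ (lt_min hε₂ (by positivity)), ?_⟩
  intro ε hε hεlt
  have h1 := hεlt.trans_le (min_le_left _ _)
  have h2 := hεlt.trans_le ((min_le_right _ _).trans (min_le_left _ _))
  have h3 := hεlt.trans_le ((min_le_right _ _).trans (min_le_right _ _))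
  rw [lt_div_iff₀ (by positivity)] at h3
  have hJ : ∀ s ∈ Icc (1 - C.s₀) (1 + C.s₀), ∀ y ∈ P.K,
      P.J C.h₀ ε (C.Phi ε (s, y)) ≤ gFun N s * e + σ := by
    intro s hs y hy
    have hs0 := hC.pos_of_mem_Icc hs
    have h4 := hI ε hε h1 s hs0 (hs2 s hs) y hy
    rw [L_rescale_eq_gFun hN hpoh hs0, hC.U₀_energy] at h4
    rw [Problem.J, Phi, hQ ε hε h2 s hs0 (hs2 s hs) y hy, add_zero]
    exact h4
  refine ⟨fun y hy x hx => hrK y hy x (hx.trans h3.le), fun s hs y =>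
    Problem.P₀_rescale hN hgrad hpoh (hC.pos_of_mem_Icc hs) y, fun s hs y hy => ?_,
    fun s hs y hy => ?_⟩
  · have h4 := mul_le_mul_of_nonneg_right
      (gFun_le_one (N := N) (by omega) (hC.pos_of_mem_Icc hs).le) hE0
    have h5 : σ ≤ min C.δ C.δhat := min_le_left _ _
    linarith [hJ s hs y hy]
  · have h5 : σ ≤ e - C.δhat - gFun N (1 - C.s₀) * e :=
      (min_le_right _ _).trans (min_le_left _ _)
    have h6 : σ ≤ e - C.δhat - gFun N (1 + C.s₀) * e :=
      (min_le_right _ _).trans (min_le_right _ _)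
    have hs0 := hC.s₀_pos
    rcases hs with rfl | hs
    · linarith [hJ (1 - C.s₀) ⟨le_rfl, by linarith⟩ y hy]
    · rw [mem_singleton_iff] at hs
      subst hs
      linarith [hJ (1 + C.s₀) ⟨by linarith, le_rfl⟩ y hy]

lemma P₀t_eq_of_P₀_eq {u : H1 N} {s : ℝ} (hs : s ∈ Icc (1 - C.s₀) (1 + C.s₀))
    (h : P.P₀ u = s) : C.P₀t P u = s := by
  rw [P₀t, h]
  split_ifs with h1 h2
  · exact le_antisymm h1 hs.2
  · exact le_antisymm hs.1 h2
  · rfl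

end Constants

end SemiclassicalNLS

/-! ### The maps of pairs and the homotopy. -/

open SemiclassicalNLS in
theorem proposition4p2 (N : ℕ) (hN : 3 ≤ N) (P : Problem N) (hP : P.Assumptions)
    (C : Constants N) (hC : C.Admissible P) :
    ∃ ε₀ : ℝ, 0 < ε₀ ∧ ∀ ε : ℝ, 0 < ε → ε < ε₀ →
      IsPairMap (C.Phi ε)
        (Set.Icc (1 - C.s₀) (1 + C.s₀) ×ˢ P.K) ({1 - C.s₀, 1 + C.s₀} ×ˢ P.K)
        (C.Xlevel P ε (P.leastEnergy P.m₀ + C.δhat))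
        (C.Xlevel P ε (P.leastEnergy P.m₀ - C.δhat)) ∧
      IsPairMap (C.Psi P ε ∘ C.Phi ε)
        (Set.Icc (1 - C.s₀) (1 + C.s₀) ×ˢ P.K) ({1 - C.s₀, 1 + C.s₀} ×ˢ P.K)
        (Set.Icc (1 - C.s₀) (1 + C.s₀) ×ˢ P.ΩOf (Set.Icc 0 C.ν₁))
        ((Set.Icc (1 - C.s₀) (1 + C.s₀) \ {1}) ×ˢ P.ΩOf (Set.Icc 0 C.ν₁)) ∧
      ∃ η : ℝ × ℝ × E N → ℝ × E N,
        ContinuousOn η (Set.Icc 0 1 ×ˢ Set.Icc (1 - C.s₀) (1 + C.s₀) ×ˢ P.K) ∧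
        Set.MapsTo η (Set.Icc 0 1 ×ˢ Set.Icc (1 - C.s₀) (1 + C.s₀) ×ˢ P.K)
          (Set.Icc (1 - C.s₀) (1 + C.s₀) ×ˢ P.ΩOf (Set.Icc 0 C.ν₁)) ∧
        (∀ s ∈ Set.Icc (1 - C.s₀) (1 + C.s₀), ∀ y ∈ P.K,
          η (0, s, y) = C.Psi P ε (C.Phi ε (s, y))) ∧
        (∀ s ∈ Set.Icc (1 - C.s₀) (1 + C.s₀), ∀ y ∈ P.K, η (1, s, y) = (s, y)) ∧
        (∀ t ∈ Set.Icc (0 : ℝ) 1, ∀ s ∈ ({1 - C.s₀, 1 + C.s₀} : Set ℝ), ∀ y ∈ P.K,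
          η (t, s, y) ∈
            (Set.Icc (1 - C.s₀) (1 + C.s₀) \ {1}) ×ˢ P.ΩOf (Set.Icc 0 C.ν₁)) := by
  obtain ⟨ε₀, hε₀, hest⟩ := hC.exists_estimates hN hP
  refine ⟨ε₀, hε₀, fun ε hε hεlt => ?_⟩
  obtain ⟨hΩ, hP₀, hJ, hJend⟩ := hest ε hε hεlt
  have hs₀ := hC.s₀_pos
  have hend : ({1 - C.s₀, 1 + C.s₀} : Set ℝ) ⊆ Icc (1 - C.s₀) (1 + C.s₀) \ {1} := by
    rintro s (rfl | hs)
    · exact ⟨⟨le_rfl, by linarith⟩, by rw [mem_singleton_iff]; linarith⟩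
    · rw [mem_singleton_iff] at hs
      subst hs
      exact ⟨⟨by linarith, le_rfl⟩, by rw [mem_singleton_iff]; linarith⟩
  have hend' : ({1 - C.s₀, 1 + C.s₀} : Set ℝ) ⊆ Icc (1 - C.s₀) (1 + C.s₀) :=
    hend.trans sdiff_subset
  have hBA : ({1 - C.s₀, 1 + C.s₀} : Set ℝ) ×ˢ P.K ⊆ Icc (1 - C.s₀) (1 + C.s₀) ×ˢ P.K :=
    prod_mono hend' Subset.rfl
  have hΩmono : P.ΩOf (Icc 0 C.ν₁) ⊆ P.ΩOf (Icc 0 C.ν₀) := fun x hx =>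
    ⟨hx.1, hx.2.1, hx.2.2.trans hC.ν₁_lt.le⟩
  -- This covers the whole homotopy at once; the case `t = 0` is also what places `Φ_ε` in the
  -- neighborhood of expected solutions.
  have hshift : ∀ t ∈ Icc (0 : ℝ) 1, ∀ s ∈ Icc (1 - C.s₀) (1 + C.s₀), ∀ y ∈ P.K,
      y + ((1 - t) * ε) • C.profileShift P s ∈ P.ΩOf (Icc 0 C.ν₁) := by
    intro t ht s hs y hy
    refine hΩ y hy _ ?_
    have h1 : 0 ≤ 1 - t := by linarith [ht.2]
    rw [add_sub_cancel_left, norm_smul, Real.norm_of_nonneg (mul_nonneg h1 hε.le)]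
    have h2 := hC.norm_profileShift_le hs
    have h3 : (1 - t) * ε ≤ ε := mul_le_of_le_one_left hε.le (by linarith [ht.1])
    exact mul_le_mul h3 h2 (norm_nonneg _) hε.le
  have hUps : ∀ s ∈ Icc (1 - C.s₀) (1 + C.s₀), ∀ y,
      ε • C.Upsilon P (C.Phi ε (s, y)) = y + ε • C.profileShift P s := by
    intro s hs y
    rw [Constants.Phi, hC.Upsilon_rescale hs, smul_add, smul_smul, mul_inv_cancel₀ hε.ne',
      one_smul]
  -- The truncation in `P₀t` is inactive, since `P₀` already equals `s` in the interval.
  have hPsi : ∀ s ∈ Icc (1 - C.s₀) (1 + C.s₀), ∀ y,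
      C.Psi P ε (C.Phi ε (s, y)) = (s, y + ε • C.profileShift P s) := by
    intro s hs y
    rw [Constants.Psi, hUps s hs y,
      Constants.P₀t_eq_of_P₀_eq hs (show P.P₀ (C.Phi ε (s, y)) = s from hP₀ s hs _)]
  have hX : ∀ s ∈ Icc (1 - C.s₀) (1 + C.s₀), ∀ y ∈ P.K, C.Phi ε (s, y) ∈ C.X P ε := by
    intro s hs y hy
    refine ⟨hC.rescale_mem_tube hs _, ?_, ?_⟩
    · rw [hUps s hs y]
      have := hshift 0 ⟨le_rfl, zero_le_one⟩ s hs y hy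
      rw [sub_zero, one_mul] at this
      exact hΩmono this
    -- Since `ρ̂ ≤ ρ₁`, the term with `δ₂` vanishes and only the bound `E(m₀) + δ` has to be
    -- checked.
    · have h1 : C.rhoHat P (C.Phi ε (s, y)) ≤ C.ρ₁ := hC.rhoHat_rescale_le hs _
      rw [max_eq_right (by linarith), mul_zero, sub_zero]
      exact (hJ s hs y hy).trans (by linarith [min_le_left C.δ C.δhat])
  refine ⟨⟨hBA, ?_, ?_, ?_, ?_⟩, ⟨hBA, ?_, ?_, ?_, ?_⟩, ?_⟩
  · exact fun u hu => ⟨hu.1, hu.2.trans (by linarith [hC.δhat_pos])⟩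
  · intro z hz
    have h1 : ContinuousAt (fun z : ℝ × E N => (z.1, ε⁻¹ • z.2)) z := by fun_prop
    exact (ContinuousAt.comp (f := fun z : ℝ × E N => (z.1, ε⁻¹ • z.2))
      (continuousAt_rescale C.U₀ (hC.pos_of_mem_Icc hz.1)) h1).continuousWithinAt
  · rintro ⟨s, y⟩ ⟨hs, hy⟩
    exact ⟨hX s hs y hy, (hJ s hs y hy).trans (by linarith [min_le_right C.δ C.δhat])⟩
  · rintro ⟨s, y⟩ ⟨hs, hy⟩
    exact ⟨hX s (hend' hs) y hy, hJend s hs y hy⟩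
  · exact prod_mono sdiff_subset Subset.rfl
  · have h1 : ContinuousOn (fun z : ℝ × E N => (z.1, z.2 + ε • C.profileShift P z.1))
        (Icc (1 - C.s₀) (1 + C.s₀) ×ˢ P.K) := by
      have h2 : ContinuousOn (fun z : ℝ × E N => C.profileShift P z.1)
          (Icc (1 - C.s₀) (1 + C.s₀) ×ˢ P.K) :=
        hC.continuousOn_profileShift.comp continuousOn_fst fun z hz => hz.1
      exact continuousOn_fst.prodMk (continuousOn_snd.add (h2.const_smul ε))
    exact h1.congr fun z hz => hPsi z.1 hz.1 z.2
  · rintro ⟨s, y⟩ ⟨hs, hy⟩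
    have := hshift 0 ⟨le_rfl, zero_le_one⟩ s hs y hy
    rw [sub_zero, one_mul] at this
    rw [Function.comp_apply, hPsi s hs y]
    exact ⟨hs, this⟩
  · rintro ⟨s, y⟩ ⟨hs, hy⟩
    have := hshift 0 ⟨le_rfl, zero_le_one⟩ s (hend' hs) y hy
    rw [sub_zero, one_mul] at this
    rw [Function.comp_apply, hPsi s (hend' hs) y]
    exact ⟨hend hs, this⟩
  -- The homotopy contracts the displacement of the center of mass linearly and fixes the first
  -- coordinate, so the endpoints `1 ± s₀` never reach `1`.
  · refine ⟨fun z => (z.2.1, z.2.2 + ((1 - z.1) * ε) • C.profileShift P z.2.1), ?_, ?_, ?_, ?_, ?_⟩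
    · have h2 : ContinuousOn (fun z : ℝ × ℝ × E N => C.profileShift P z.2.1)
          (Icc 0 1 ×ˢ Icc (1 - C.s₀) (1 + C.s₀) ×ˢ P.K) :=
        hC.continuousOn_profileShift.comp (by fun_prop) fun z hz => hz.2.1
      have h3 : ContinuousOn (fun z : ℝ × ℝ × E N => (1 - z.1) * ε)
          (Icc 0 1 ×ˢ Icc (1 - C.s₀) (1 + C.s₀) ×ˢ P.K) := by fun_prop
      have h4 : ContinuousOn (fun z : ℝ × ℝ × E N => z.2.1)
          (Icc 0 1 ×ˢ Icc (1 - C.s₀) (1 + C.s₀) ×ˢ P.K) := by fun_prop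
      have h5 : ContinuousOn (fun z : ℝ × ℝ × E N => z.2.2)
          (Icc 0 1 ×ˢ Icc (1 - C.s₀) (1 + C.s₀) ×ˢ P.K) := by fun_prop
      exact h4.prodMk (h5.add (h3.smul h2))
    · rintro ⟨t, s, y⟩ ⟨ht, hs, hy⟩
      exact ⟨hs, hshift t ht s hs y hy⟩
    · intro s hs y _
      rw [hPsi s hs y]
      simp
    · intro s _ y _
      simp
    · intro t ht s hs y hy
      exact ⟨hend hs, hshift t ht s (hend' hs) y hy⟩
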